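/- Let $\Bbbk$ be a field of characteristic $0$ and let $n\ge 1$. Algebra. Let $\widehat Q$ be the quiver with vertices $1,\dots,n$, a loop $z=z_i$ at each vertex $i$, and, for each pair $i<j$, two arrows $x,y\colon i\to j$ and two arrows $x^*,y^*\colon j\to i$ (and $(a^*)^*=a$). Paths are composed from left to right and $e_i$ is the length-zero path at $i$. The zigzag algebra $\widehat A$ is the quotient of the path algebra $\Bbbk\widehat Q$ by the two-sided ideal generated by all length-two paths with distinct end points and by the elements $a b-\delta_{b,a^*}\,z_i$ for all arrows $a\colon i\to j$, $b\colon j\to i$ with $i\neq j$ (for $n=1$ one puts $\widehat A=\Bbbk[z]/z^2$). It is graded by $\deg e_i=0$, $\deg x=\deg y=1$, $\deg x^*=\deg y^*=0$, $\deg z=1$. For a graded module $M$ write $M\langle 1\rangle_d=M_{d+1}$. Category and free group action. Let $\mathcal D$ be the homotopy category of bounded complexes of finitely generated graded projective left $\widehat A$-modules, and $P_i=\widehat A e_i$ with $e_i$ in degree $0$. Let $\Sigma_i$ and $\Sigma_i^{-1}$ be the endofunctors of $\mathcal D$ given by tensoring over $\widehat A$ with the complexes of bimodules $$\widehat A\xrightarrow{\,g_i\,}(\widehat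 A e_i\otimes_{\Bbbk} e_i\widehat A)\langle 1\rangle,\qquad \widehat A e_i\otimes_{\Bbbk} e_i\widehat A\xrightarrow{\,f_i\,}\widehat A,$$ with $\widehat A$ in homological degree $0$, where $f_i(e_i\otimes e_i)=e_i$ and $g_i(1)=z_i\otimes e_i+e_i\otimes z_i+\sum_a a^*\otimes a$, the sum being over all arrows $a$ from $i$ to other vertices. Let $F_n$ be the free group on $\sigma_1,\dots,\sigma_n$. For $g\in F_n$ let $\Psi_g$ be the composite of the functors $\Sigma_i^{\pm1}$ prescribed by the reduced word of $g$ in the letters $\sigma_i^{\pm1}$. Spherical collections. An object of $\mathcal D$ is called spherical if it is isomorphic to $\Psi_g(P_j)$ for some $g\in F_n$ and some $j$. An ordered spherical collection is an $n$-tuple $(E_1,\dots,E_n)$ of isomorphism classes of spherical objects. For $E\cong\Psi_g(P_j)$ the spherical twist is $\Phi_E=\Psi_g\Sigma_j\Psi_{g^{-1}}$. Let $B_n$ be the Artin braid group with standard generators $\tau_1,\dots,\tau_{n-1}$. Reflection expressions. Let $\gamma=\sigma_1\sigma_2\cdots\sigma_n$. A reflection of $F_n$ is a conjugate of some $\sigma_i$.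 A minimal reflection expression of $\gamma$ is an $n$-tuple $(t_1,\dots,t_n)$ of reflections with $t_1\cdots t_n=\gamma$, and $\mathrm{Red}(\gamma)$ is the set of these. The group $B_n$ acts on $\mathrm{Red}(\gamma)$ by $$\tau_i(t_1,\dots,t_n)=(t_1,\dots,t_{i-1},\,t_it_{i+1}t_i^{-1},\,t_i,\,t_{i+2},\dots,t_n).$$ Claim. There is a unique action of $B_n$ on the set of ordered spherical collections such that $$\tau_i(E_1,\dots,E_n)=(E_1,\dots,E_{i-1},\,\Phi_{E_i}(E_{i+1}),\,E_i,\,E_{i+2},\dots,E_n)$$ for all $i$, where $\Phi_{E_i}(E_{i+1})$ does not depend on the presentation $E_i\cong\Psi_g(P_j)$ used to define $\Phi_{E_i}$. For this action (the Hurwitz action), $B_n$ acts freely on the orbit $\mathcal O$ of $(P_1,\dots,P_n)$. Moreover there is exactly one $B_n$-equivariant map $\mathrm{Red}(\gamma)\to\mathcal O$ sending $(\sigma_1,\dots,\sigma_n)$ to $(P_1,\dots,P_n)$, and this map is a bijection. -/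

import Mathlib

noncomputable section

open CategoryTheory Limits
open scoped TensorProduct

universe u v

namespace ZigzagFree

/-! ### The zigzag algebra of the doubled complete graph -/

/-- Generators of the path algebra of the Ginzburg double of the doubled complete graph on `n`
vertices: the length-zero paths `e i`, the loops `z i`, and two arrows `i ⟶ j` for every ordered
pair `i ≠ j`.  The Boolean tells the two edges between `i` and `j` apart: for `i < j` the arrows
`i ⟶ j` are `x` (`false`) and `y` (`true`), and the arrows `j ⟶ i` are `x*` (`false`) and
`y*` (`true`). -/
inductive Gen (n : ℕ) : Type
  | e (i : Fin n) : Gen n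
  | z (i : Fin n) : Gen n
  | arr (i j : Fin n) (h : i ≠ j) (c : Bool) : Gen n

open FreeAlgebra (ι) in
/-- The defining relations of the zigzag algebra. Paths are composed from left to right, so that
an arrow `a : i ⟶ j` satisfies `e i * a = a = a * e j`. -/
inductive Rel (k : Type u) [Field k] (n : ℕ) :
    FreeAlgebra k (Gen n) → FreeAlgebra k (Gen n) → Prop
  -- relations presenting the path algebra
  | e_mul_self (i : Fin n) : Rel k n (ι k (.e i) * ι k (.e i)) (ι k (.e i))
  | e_mul_ne (i j : Fin n) (h : i ≠ j) : Rel k n (ι k (.e i) * ι k (.e j)) 0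
  | sum_e : Rel k n (∑ i : Fin n, ι k (.e i)) 1
  | e_mul_z (i : Fin n) : Rel k n (ι k (.e i) * ι k (.z i)) (ι k (.z i))
  | z_mul_e (i : Fin n) : Rel k n (ι k (.z i) * ι k (.e i)) (ι k (.z i))
  | e_mul_arr (i j : Fin n) (h : i ≠ j) (c : Bool) :
      Rel k n (ι k (.e i) * ι k (.arr i j h c)) (ι k (.arr i j h c))
  | arr_mul_e (i j : Fin n) (h : i ≠ j) (c : Bool) :
      Rel k n (ι k (.arr i j h c) * ι k (.e j)) (ι k (.arr i j h c))
  -- paths of length two with distinct end points vanish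
  | arr_mul_arr_ne (i j l : Fin n) (h : i ≠ j) (h' : j ≠ l) (c d : Bool) (hil : i ≠ l) :
      Rel k n (ι k (.arr i j h c) * ι k (.arr j l h' d)) 0
  | z_mul_arr (i j : Fin n) (h : i ≠ j) (c : Bool) :
      Rel k n (ι k (.z i) * ι k (.arr i j h c)) 0
  | arr_mul_z (i j : Fin n) (h : i ≠ j) (c : Bool) :
      Rel k n (ι k (.arr i j h c) * ι k (.z j)) 0
  -- paths `i ⟶ j ⟶ i`: an arrow followed by its dual is the loop, the other ones vanish
  | arr_mul_star (i j : Fin n) (h : i ≠ j) (c : Bool) :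
      Rel k n (ι k (.arr i j h c) * ι k (.arr j i h.symm c)) (ι k (.z i))
  | arr_mul_arr_bne (i j : Fin n) (h : i ≠ j) (c d : Bool) (hcd : c ≠ d) :
      Rel k n (ι k (.arr i j h c) * ι k (.arr j i h.symm d)) 0
  -- the convention `k[z]/z²` for a single vertex
  | z_mul_z (hn : n = 1) (i : Fin n) : Rel k n (ι k (.z i) * ι k (.z i)) 0

/-- The zigzag algebra `Â`. -/
def Zigzag (k : Type u) [Field k] (n : ℕ) : Type u := RingQuot (Rel k n)

instance (k : Type u) [Field k] (n : ℕ) : Ring (Zigzag k n) :=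
  inferInstanceAs (Ring (RingQuot (Rel k n)))

instance (k : Type u) [Field k] (n : ℕ) : Algebra k (Zigzag k n) :=
  inferInstanceAs (Algebra k (RingQuot (Rel k n)))

namespace Zigzag

variable (k : Type u) [Field k] (n : ℕ)

/-- The quotient map onto the zigzag algebra. -/
def mk : FreeAlgebra k (Gen n) →ₐ[k] Zigzag k n := RingQuot.mkAlgHom k (Rel k n)

/-- The class of a generator in the zigzag algebra. -/
def gen (s : Gen n) : Zigzag k n := mk k n (FreeAlgebra.ι k s)

variable {n}

/-- The idempotent at the vertex `i`. -/
def e (i : Fin n) : Zigzag k n := gen k n (.e i)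

/-- The loop at the vertex `i`. -/
def z (i : Fin n) : Zigzag k n := gen k n (.z i)

/-- The arrow `i ⟶ j` of colour `c`; by convention `0` if `i = j`. -/
def arr (i j : Fin n) (c : Bool) : Zigzag k n :=
  if h : i ≠ j then gen k n (.arr i j h c) else 0

variable {k}

@[elab_as_elim]
theorem induction {C : Zigzag k n → Prop} (h0 : ∀ r, C (algebraMap k _ r))
    (h1 : ∀ s, C (gen k n s)) (hm : ∀ a b, C a → C b → C (a * b))
    (ha : ∀ a b, C a → C b → C (a + b)) (a : Zigzag k n) : C a := by
  obtain ⟨x, rfl⟩ : ∃ x, mk k n x = a := RingQuot.mkAlgHom_surjective k (Rel k n) a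
  induction x using FreeAlgebra.induction with
  | grade0 r => simpa using h0 r
  | grade1 s => exact h1 s
  | mul a b h h' => simpa using hm _ _ h h'
  | add a b h h' => simpa using ha _ _ h h'

theorem gen_arr (i j : Fin n) (h : i ≠ j) (c : Bool) : gen k n (.arr i j h c) = arr k i j c := by
  simp [arr, h]

@[simp] theorem arr_self (i : Fin n) (c : Bool) : arr k i i c = 0 := by simp [arr]

theorem rel {a b : FreeAlgebra k (Gen n)} (h : Rel k n a b) :
    mk k n a = mk k n b :=
  RingQuot.mkAlgHom_rel k h

@[simp] theorem e_mul_self (i : Fin n) : e k i * e k i = e k i := by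
  simpa [e, gen] using rel (.e_mul_self (k := k) i)

theorem e_mul_ne {i j : Fin n} (h : i ≠ j) : e k i * e k j = 0 := by
  simpa [e, gen] using rel (.e_mul_ne (k := k) i j h)

theorem sum_e : ∑ i : Fin n, e k i = 1 := by
  simpa [e, gen] using rel (.sum_e (k := k) (n := n))

@[simp] theorem e_mul_z (i : Fin n) : e k i * z k i = z k i := by
  simpa [e, z, gen] using rel (.e_mul_z (k := k) i)

@[simp] theorem z_mul_e (i : Fin n) : z k i * e k i = z k i := by
  simpa [e, z, gen] using rel (.z_mul_e (k := k) i)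

@[simp] theorem e_mul_arr (i j : Fin n) (c : Bool) : e k i * arr k i j c = arr k i j c := by
  by_cases h : i = j
  · subst h; simp
  · simpa [e, arr, gen, h] using rel (.e_mul_arr (k := k) i j h c)

@[simp] theorem arr_mul_e (i j : Fin n) (c : Bool) : arr k i j c * e k j = arr k i j c := by
  by_cases h : i = j
  · subst h; simp
  · simpa [e, arr, gen, h] using rel (.arr_mul_e (k := k) i j h c)

/-- Left and right multiplication by a "matrix unit" type pair kills mismatched vertices. -/
theorem mul_eq_zero_of_ne {a b : Zigzag k n} {i j : Fin n} (h : i ≠ j)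
    (ha : a * e k i = a) (hb : e k j * b = b) : a * b = 0 := by
  rw [← ha, ← hb, mul_assoc, ← mul_assoc (e k i), e_mul_ne h, zero_mul, mul_zero]

theorem arr_mul_arr (i j l : Fin n) (c d : Bool) :
    arr k i j c * arr k j l d = if i = l ∧ i ≠ j ∧ c = d then z k i else 0 := by
  by_cases hij : i = j
  · subst hij; simp
  by_cases hjl : j = l
  · subst hjl; simpa using fun h h' => absurd h h'
  by_cases hil : i = l
  · subst hil
    by_cases hcd : c = d
    · subst hcd
      simpa [arr, z, gen, hij, hjl] using rel (.arr_mul_star (k := k) i j hij c)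
    · simpa [arr, z, gen, hij, hjl, hcd] using rel (.arr_mul_arr_bne (k := k) i j hij c d hcd)
  · simpa [arr, gen, hij, hjl, hil] using rel (.arr_mul_arr_ne (k := k) i j l hij hjl c d hil)

@[simp] theorem z_mul_arr (i j : Fin n) (c : Bool) : z k i * arr k i j c = 0 := by
  by_cases h : i = j
  · subst h; simp
  · simpa [z, arr, gen, h] using rel (.z_mul_arr (k := k) i j h c)

@[simp] theorem arr_mul_z (i j : Fin n) (c : Bool) : arr k i j c * z k j = 0 := by
  by_cases h : i = j
  · subst h; simp
  · simpa [z, arr, gen, h] using rel (.arr_mul_z (k := k) i j h c)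

@[simp] theorem z_mul_z (i : Fin n) : z k i * z k i = 0 := by
  by_cases h : n = 1
  · simpa [z, gen] using rel (.z_mul_z (k := k) h i)
  · have : Nontrivial (Fin n) := by
      rw [Fin.nontrivial_iff_two_le]
      have := i.2
      omega
    obtain ⟨j, hj⟩ := exists_ne i
    have h1 : z k i = arr k i j true * arr k j i true := by
      rw [arr_mul_arr]; simp [hj.symm]
    nth_rewrite 2 [h1]
    rw [← mul_assoc, z_mul_arr, zero_mul]

/-! The three cases of multiplication by arbitrary vertices. -/

theorem e_mul_e' (i j : Fin n) : e k i * e k j = if i = j then e k j else 0 := by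
  split_ifs with h
  · subst h; simp
  · exact e_mul_ne h

theorem e_mul_z' (i j : Fin n) : e k i * z k j = if i = j then z k j else 0 := by
  split_ifs with h
  · subst h; simp
  · exact mul_eq_zero_of_ne h (by simp) (by simp)

theorem z_mul_e' (i j : Fin n) : z k i * e k j = if i = j then z k j else 0 := by
  split_ifs with h
  · subst h; simp
  · exact mul_eq_zero_of_ne h (by simp) (by simp)

theorem z_mul_z' (i j : Fin n) : z k i * z k j = 0 := by
  by_cases h : i = j
  · subst h; simp
  · exact mul_eq_zero_of_ne h (by simp) (by simp)

theorem e_mul_arr' (i j l : Fin n) (c : Bool) :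
    e k i * arr k j l c = if i = j then arr k j l c else 0 := by
  split_ifs with h
  · subst h; simp
  · exact mul_eq_zero_of_ne h (by simp) (by simp)

theorem arr_mul_e' (i j l : Fin n) (c : Bool) :
    arr k i j c * e k l = if j = l then arr k i j c else 0 := by
  split_ifs with h
  · subst h; simp
  · exact mul_eq_zero_of_ne h (by simp) (by simp)

theorem z_mul_arr' (i j l : Fin n) (c : Bool) : z k i * arr k j l c = 0 := by
  by_cases h : i = j
  · subst h; simp
  · exact mul_eq_zero_of_ne h (by simp) (by simp)

theorem arr_mul_z' (i j l : Fin n) (c : Bool) : arr k i j c * z k l = 0 := by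
  by_cases h : j = l
  · subst h; simp
  · exact mul_eq_zero_of_ne h (by simp) (by simp)

theorem arr_mul_arr' (i j p q : Fin n) (c d : Bool) :
    arr k i j c * arr k p q d = if j = p ∧ i = q ∧ i ≠ j ∧ c = d then z k i else 0 := by
  by_cases h : j = p
  · subst h; rw [arr_mul_arr]; simp
  · rw [mul_eq_zero_of_ne (k := k) h (by simp) (by simp)]; simp [h]

/-! ### Finite-dimensionality -/

/-- The (finite) set of classes of paths of length at most one. -/
def basisSet (k : Type u) [Field k] (n : ℕ) : Set (Zigzag k n) :=
  Set.range (e k) ∪ Set.range (z k) ∪ Set.range fun t : Fin n × Fin n × Bool => arr k t.1 t.2.1 t.2.2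

theorem e_mem (i : Fin n) : e k i ∈ Submodule.span k (basisSet k n) :=
  Submodule.subset_span (Or.inl (Or.inl ⟨i, rfl⟩))

theorem z_mem (i : Fin n) : z k i ∈ Submodule.span k (basisSet k n) :=
  Submodule.subset_span (Or.inl (Or.inr ⟨i, rfl⟩))

theorem arr_mem (i j : Fin n) (c : Bool) : arr k i j c ∈ Submodule.span k (basisSet k n) :=
  Submodule.subset_span (Or.inr ⟨(i, j, c), rfl⟩)

theorem span_basisSet : Submodule.span k (basisSet k n) = ⊤ := by
  have key : ∀ a b : Zigzag k n, b ∈ Submodule.span k (basisSet k n) →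
      a * b ∈ Submodule.span k (basisSet k n) := by
    intro a
    induction a using Zigzag.induction with
    | h0 r => intro b hb; rw [← Algebra.smul_def]; exact Submodule.smul_mem _ _ hb
    | hm a a' h h' => intro b hb; rw [mul_assoc]; exact h _ (h' _ hb)
    | ha a a' h h' => intro b hb; rw [add_mul]; exact add_mem (h _ hb) (h' _ hb)
    | h1 s =>
      intro b hb
      induction hb using Submodule.span_induction with
      | zero => simp
      | add x y _ _ hx hy => rw [mul_add]; exact add_mem hx hy
      | smul r x _ hx => rw [mul_smul_comm]; exact Submodule.smul_mem _ _ hx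
      | mem b hb =>
        have H : ∀ (P : Prop) [Decidable P] (w : Zigzag k n), w ∈ Submodule.span k (basisSet k n) →
            (if P then w else 0) ∈ Submodule.span k (basisSet k n) := by
          intro P _ w hw; split_ifs
          · exact hw
          · exact zero_mem _
        obtain (⟨j, rfl⟩ | ⟨j, rfl⟩) | ⟨⟨p, q, d⟩, rfl⟩ := hb <;> rcases s with i | i | ⟨i, l, h, c⟩
        · change e k i * _ ∈ _; rw [e_mul_e']; exact H _ _ (e_mem _)
        · change z k i * _ ∈ _; rw [z_mul_e']; exact H _ _ (z_mem _)
        · rw [gen_arr, arr_mul_e']; exact H _ _ (arr_mem _ _ _)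
        · change e k i * _ ∈ _; rw [e_mul_z']; exact H _ _ (z_mem _)
        · change z k i * _ ∈ _; rw [z_mul_z']; exact zero_mem _
        · rw [gen_arr, arr_mul_z']; exact zero_mem _
        · change e k i * _ ∈ _; rw [e_mul_arr']; exact H _ _ (arr_mem _ _ _)
        · change z k i * _ ∈ _; rw [z_mul_arr']; exact zero_mem _
        · rw [gen_arr, arr_mul_arr']; exact H _ _ (z_mem _)
  rw [eq_top_iff]
  intro a _
  rw [← mul_one a, ← sum_e]
  exact key _ _ (sum_mem fun i _ => e_mem i)

instance : Module.Finite k (Zigzag k n) := by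
  have h : (basisSet k n).Finite :=
    ((Set.finite_range _).union (Set.finite_range _)).union (Set.finite_range _)
  exact ⟨⟨h.toFinset, by rw [Set.Finite.coe_toFinset, span_basisSet]⟩⟩

/-! ### The grading attached to the orientation `i ⟶ j` for `i < j` -/

/-- Degrees of the generators: idempotents have degree `0`, loops have degree `1`, the arrows
`x, y : i ⟶ j` (`i < j`) have degree `1`, and the dual arrows `x*, y*` have degree `0`. -/
def genDeg : Gen n → ℤ
  | .e _ => 0
  | .z _ => 1
  | .arr i j _ _ => if i < j then 1 else 0

variable (k n) in
/-- The homogeneous component of degree `d` of the zigzag algebra: the span of all paths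
of degree `d`. -/
def grade (d : ℤ) : Submodule k (Zigzag k n) :=
  Submodule.span k {a | ∃ l : List (Gen n), (l.map genDeg).sum = d ∧ (l.map (gen k n)).prod = a}

theorem gen_mem_grade (s : Gen n) : gen k n s ∈ grade k n (genDeg s) :=
  Submodule.subset_span ⟨[s], by simp, by simp⟩

theorem one_mem_grade : (1 : Zigzag k n) ∈ grade k n 0 :=
  Submodule.subset_span ⟨[], by simp, by simp⟩

theorem mul_mem_grade {a b : Zigzag k n} {c d : ℤ} (ha : a ∈ grade k n c) (hb : b ∈ grade k n d) :
    a * b ∈ grade k n (c + d) := by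
  have h := Submodule.mul_mem_mul ha hb
  rw [grade, grade, Submodule.span_mul_span] at h
  refine Submodule.span_mono ?_ h
  rintro _ ⟨_, ⟨l, rfl, rfl⟩, _, ⟨l', rfl, rfl⟩, rfl⟩
  exact ⟨l ++ l', by simp, by simp⟩

theorem e_mem_grade (i : Fin n) : e k i ∈ grade k n 0 := gen_mem_grade (.e i)

theorem z_mem_grade (i : Fin n) : z k i ∈ grade k n 1 := gen_mem_grade (.z i)

theorem arr_mem_grade (i j : Fin n) (c : Bool) :
    arr k i j c ∈ grade k n (if i < j then 1 else 0) := by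
  by_cases h : i = j
  · subst h; simp
  · rw [← gen_arr i j h]; exact gen_mem_grade (.arr i j h c)

open AddMonoidAlgebra in
/-- The coaction `a ↦ a ⊗ t ^ deg a` which encodes the grading. -/
def coaction (k : Type u) [Field k] (n : ℕ) :
    Zigzag k n →ₐ[k] AddMonoidAlgebra (Zigzag k n) ℤ :=
  RingQuot.liftAlgHom k ⟨FreeAlgebra.lift k fun s => single (genDeg s) (gen k n s), by
    intro a b h
    have H : ∀ (c d : ℤ) (x y : Zigzag k n), c = d → x = y →
        (single c x : AddMonoidAlgebra (Zigzag k n) ℤ) = single d y := by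
      rintro c _ x _ rfl rfl; rfl
    have H0 : ∀ (c : ℤ) (x : Zigzag k n), x = 0 →
        (single c x : AddMonoidAlgebra (Zigzag k n) ℤ) = 0 := by
      rintro c _ rfl; simp
    have R := rel h
    induction h with
    | sum_e =>
      simp only [map_sum, FreeAlgebra.lift_ι_apply, map_one] at R ⊢
      change ∑ i : Fin n, single 0 (gen k n (.e i)) = single 0 1
      rw [← R]
      exact (map_sum (singleAddHom (0 : ℤ)) _ _).symm
    | e_mul_self i | e_mul_z | z_mul_e | e_mul_arr | arr_mul_e =>
      simp only [map_mul, FreeAlgebra.lift_ι_apply, single_mul_single] at R ⊢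
      exact H _ _ _ _ (by simp [genDeg]) R
    | arr_mul_star i j h c =>
      simp only [map_mul, FreeAlgebra.lift_ι_apply, single_mul_single] at R ⊢
      refine H _ _ _ _ ?_ R
      simp only [genDeg]
      split_ifs <;> omega
    | e_mul_ne | arr_mul_arr_ne | z_mul_arr | arr_mul_z | arr_mul_arr_bne | z_mul_z =>
      simp only [map_mul, FreeAlgebra.lift_ι_apply, single_mul_single, map_zero] at R ⊢
      exact H0 _ _ R⟩

theorem coaction_gen (s : Gen n) :
    coaction k n (gen k n s) = AddMonoidAlgebra.single (genDeg s) (gen k n s) := by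
  have h : coaction k n (gen k n s) =
      FreeAlgebra.lift k (fun s => AddMonoidAlgebra.single (genDeg s) (gen k n s))
        (FreeAlgebra.ι k s) := RingQuot.liftAlgHom_mkAlgHom_apply _ _ _ _
  rw [h, FreeAlgebra.lift_ι_apply]

theorem coaction_of_mem {d : ℤ} {a : Zigzag k n} (ha : a ∈ grade k n d) :
    coaction k n a = AddMonoidAlgebra.single d a := by
  induction ha using Submodule.span_induction with
  | zero => simp
  | add x y _ _ hx hy => rw [map_add, hx, hy, AddMonoidAlgebra.single_add]
  | smul r x _ hx => rw [map_smul, hx, AddMonoidAlgebra.smul_single]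
  | mem a ha =>
    obtain ⟨l, rfl, rfl⟩ := ha
    induction l with
    | nil => exact map_one _
    | cons s l ih =>
      rw [List.map_cons, List.prod_cons, List.map_cons, List.sum_cons, map_mul, ih, coaction_gen,
        AddMonoidAlgebra.single_mul_single]

theorem iSup_grade : ⨆ d, grade k n d = ⊤ := by
  rw [eq_top_iff, ← span_basisSet, Submodule.span_le]
  rintro _ ((⟨i, rfl⟩ | ⟨i, rfl⟩) | ⟨⟨i, j, c⟩, rfl⟩)
  · exact Submodule.mem_iSup_of_mem _ (e_mem_grade i)
  · exact Submodule.mem_iSup_of_mem _ (z_mem_grade i)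
  · exact Submodule.mem_iSup_of_mem _ (arr_mem_grade i j c)

end Zigzag

/-! ### Gradings of vector spaces -/

section Internal

variable {k : Type u} [Field k] {M N : Type u} [AddCommGroup M] [Module k M]
  [AddCommGroup N] [Module k N]

theorem isInternal_of_coaction (ℳ : ℤ → Submodule k M) (h : ⨆ d, ℳ d = ⊤)
    (c : M →ₗ[k] (ℤ →₀ M)) (hc : ∀ d, ∀ m ∈ ℳ d, c m = Finsupp.single d m) :
    DirectSum.IsInternal ℳ := by
  refine DirectSum.isInternal_submodule_of_iSupIndep_of_iSup_eq_top ?_ h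
  intro d
  rw [Submodule.disjoint_def]
  intro x hx hx'
  have h1 : c x d = x := by rw [hc d x hx]; simp
  have h2 : (⨆ j, ⨆ (_ : j ≠ d), ℳ j) ≤ LinearMap.ker ((Finsupp.lapply d : (ℤ →₀ M) →ₗ[k] M) ∘ₗ c) := by
    refine iSup₂_le fun j hj m hm => ?_
    simp [hc j m hm, hj]
  rw [← h1]
  exact h2 hx'

theorem exists_coaction {ℳ : ℤ → Submodule k M} (h : DirectSum.IsInternal ℳ) :
    ∃ c : M →ₗ[k] (ℤ →₀ M), ∀ d, ∀ m ∈ ℳ d, c m = Finsupp.single d m := by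
  let E := LinearEquiv.ofBijective (DirectSum.coeLinearMap ℳ) h
  refine ⟨DirectSum.toModule k ℤ (ℤ →₀ M)
    (fun d => (Finsupp.lsingle d : M →ₗ[k] _) ∘ₗ (ℳ d).subtype) ∘ₗ E.symm.toLinearMap, ?_⟩
  intro d m hm
  have : E.symm m = DirectSum.lof k ℤ (fun d => ℳ d) d ⟨m, hm⟩ := by
    rw [LinearEquiv.symm_apply_eq]
    exact (DirectSum.coeLinearMap_lof ℳ d ⟨m, hm⟩).symm
  simp [this]

/-- The induced grading of a degreewise retract. -/
theorem isInternal_of_retract {ℳ : ℤ → Submodule k M} (h : DirectSum.IsInternal ℳ)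
    (j : N →ₗ[k] M) (q : M →ₗ[k] N) (hq : ∀ v, q (j v) = v)
    (hd : ∀ d, ∀ m ∈ ℳ d, j (q m) ∈ ℳ d) :
    DirectSum.IsInternal fun d => (ℳ d).comap j := by
  obtain ⟨c, hc⟩ := exists_coaction h
  refine isInternal_of_coaction _ ?_ (Finsupp.mapRange.linearMap q ∘ₗ c ∘ₗ j) ?_
  · rw [eq_top_iff]
    rintro v -
    have hq' : ∀ m ∈ (⨆ d, ℳ d), q m ∈ ⨆ d, (ℳ d).comap j := by
      intro m hm
      induction hm using Submodule.iSup_induction' with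
      | mem d m hm => exact Submodule.mem_iSup_of_mem d (hd d m hm)
      | zero => simp
      | add x y _ _ hx hy => rw [map_add]; exact add_mem hx hy
    have := hq' (j v) (by rw [h.submodule_iSup_eq_top]; trivial)
    rwa [hq] at this
  · intro d v hv
    simp [hc d (j v) hv, hq]

theorem isInternal_shift {ℳ : ℤ → Submodule k M} (h : DirectSum.IsInternal ℳ) (a : ℤ) :
    DirectSum.IsInternal fun d => ℳ (a + d) := by
  obtain ⟨c, hc⟩ := exists_coaction h
  refine isInternal_of_coaction _ ?_ (Finsupp.lmapDomain M k (fun d => d - a) ∘ₗ c) ?_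
  · rw [← h.submodule_iSup_eq_top]
    exact (Equiv.addLeft a).iSup_comp (g := ℳ)
  · intro d m hm
    simp [hc _ m hm, Finsupp.mapDomain_single]

theorem isInternal_prod {ℳ : ℤ → Submodule k M} {𝒩 : ℤ → Submodule k N}
    (h : DirectSum.IsInternal ℳ) (h' : DirectSum.IsInternal 𝒩) :
    DirectSum.IsInternal fun d => (ℳ d).prod (𝒩 d) := by
  obtain ⟨c, hc⟩ := exists_coaction h
  obtain ⟨c', hc'⟩ := exists_coaction h'
  refine isInternal_of_coaction _ ?_
    (Finsupp.mapRange.linearMap (LinearMap.inl k M N) ∘ₗ c ∘ₗ LinearMap.fst k M N +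
      Finsupp.mapRange.linearMap (LinearMap.inr k M N) ∘ₗ c' ∘ₗ LinearMap.snd k M N) ?_
  · rw [eq_top_iff]
    have h1 : (⨆ d, ℳ d).map (LinearMap.inl k M N) ≤ ⨆ d, (ℳ d).prod (𝒩 d) := by
      rw [Submodule.map_iSup]
      refine iSup_mono fun d => ?_
      rintro _ ⟨m, hm, rfl⟩
      exact ⟨hm, zero_mem _⟩
    have h2 : (⨆ d, 𝒩 d).map (LinearMap.inr k M N) ≤ ⨆ d, (ℳ d).prod (𝒩 d) := by
      rw [Submodule.map_iSup]
      refine iSup_mono fun d => ?_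
      rintro _ ⟨m, hm, rfl⟩
      exact ⟨zero_mem _, hm⟩
    rw [h.submodule_iSup_eq_top] at h1
    rw [h'.submodule_iSup_eq_top] at h2
    rintro ⟨x, y⟩ -
    have := add_mem (h1 ⟨x, trivial, rfl⟩) (h2 ⟨y, trivial, rfl⟩)
    simpa using this
  · rintro d ⟨x, y⟩ ⟨hx, hy⟩
    simp [hc d x hx, hc' d y hy, ← Finsupp.single_add]

/-- The grading of a tensor product. -/
def tensorGrade (ℳ : ℤ → Submodule k M) (𝒩 : ℤ → Submodule k N) (d : ℤ) : Submodule k (M ⊗[k] N) :=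
  Submodule.span k {t | ∃ a b : ℤ, a + b = d ∧ ∃ m ∈ ℳ a, ∃ v ∈ 𝒩 b, m ⊗ₜ[k] v = t}

theorem tmul_mem_tensorGrade {ℳ : ℤ → Submodule k M} {𝒩 : ℤ → Submodule k N} {a b d : ℤ}
    (h : a + b = d) {m : M} {v : N} (hm : m ∈ ℳ a) (hv : v ∈ 𝒩 b) :
    m ⊗ₜ[k] v ∈ tensorGrade ℳ 𝒩 d :=
  Submodule.subset_span ⟨a, b, h, m, hm, v, hv, rfl⟩

theorem map_mem_of_tensorGrade {ℳ : ℤ → Submodule k M} {𝒩 : ℤ → Submodule k N} {L : Type u}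
    [AddCommGroup L] [Module k L] (φ : M ⊗[k] N →ₗ[k] L) (K : Submodule k L) {d : ℤ}
    (h : ∀ a b : ℤ, a + b = d → ∀ m ∈ ℳ a, ∀ v ∈ 𝒩 b, φ (m ⊗ₜ[k] v) ∈ K)
    (t : M ⊗[k] N) (ht : t ∈ tensorGrade ℳ 𝒩 d) : φ t ∈ K := by
  have : tensorGrade ℳ 𝒩 d ≤ K.comap φ := by
    refine Submodule.span_le.2 ?_
    rintro _ ⟨a, b, hab, m, hm, v, hv, rfl⟩
    exact h a b hab m hm v hv
  exact this ht

theorem isInternal_tensor {ℳ : ℤ → Submodule k M} {𝒩 : ℤ → Submodule k N}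
    (h : DirectSum.IsInternal ℳ) (h' : DirectSum.IsInternal 𝒩) :
    DirectSum.IsInternal (tensorGrade ℳ 𝒩) := by
  obtain ⟨c, hc⟩ := exists_coaction h
  obtain ⟨c', hc'⟩ := exists_coaction h'
  refine isInternal_of_coaction _ ?_
    (Finsupp.lmapDomain (M ⊗[k] N) k (fun p : ℤ × ℤ => p.1 + p.2) ∘ₗ
      (finsuppTensorFinsupp k k M N ℤ ℤ).toLinearMap ∘ₗ TensorProduct.map c c') ?_
  · rw [eq_top_iff]
    rintro t -
    induction t using TensorProduct.induction_on with
    | zero => simp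
    | add x y hx hy => exact add_mem hx hy
    | tmul m v =>
      have hm : m ∈ ⨆ d, ℳ d := by rw [h.submodule_iSup_eq_top]; trivial
      have hv : v ∈ ⨆ d, 𝒩 d := by rw [h'.submodule_iSup_eq_top]; trivial
      induction hm using Submodule.iSup_induction' with
      | zero => simp
      | add x y _ _ hx hy => rw [TensorProduct.add_tmul]; exact add_mem hx hy
      | mem a m hm =>
        induction hv using Submodule.iSup_induction' with
        | zero => simp
        | add x y _ _ hx hy => rw [TensorProduct.tmul_add]; exact add_mem hx hy
        | mem b v hv => exact Submodule.mem_iSup_of_mem _ (tmul_mem_tensorGrade rfl hm hv)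
  · intro d t ht
    induction ht using Submodule.span_induction with
    | zero => simp
    | add x y _ _ hx hy => rw [map_add, hx, hy, Finsupp.single_add]
    | smul r x _ hx => rw [map_smul, hx, Finsupp.smul_single]
    | mem t ht =>
      obtain ⟨a, b, rfl, m, hm, v, hv, rfl⟩ := ht
      simp [hc a m hm, hc' b v hv, Finsupp.mapDomain_single]

end Internal


theorem Zigzag.isInternal_grade (k : Type u) [Field k] (n : ℕ) :
    DirectSum.IsInternal (Zigzag.grade k n) := by
  refine isInternal_of_coaction _ Zigzag.iSup_grade
    { toFun := fun a => (Zigzag.coaction k n a).coeff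
      map_add' := fun a b => by rw [map_add]; rfl
      map_smul' := fun r a => by rw [map_smul]; rfl } ?_
  intro d a ha
  change (Zigzag.coaction k n a).coeff = _
  rw [Zigzag.coaction_of_mem ha]; rfl

/-! ### Finitely generated graded projective modules -/

/-- A finitely generated, graded, projective left module over the zigzag algebra `Â`. -/
structure GrProj (k : Type u) [Field k] (n : ℕ) : Type (u + 1) where
  carrier : Type u
  [addCommGroup : AddCommGroup carrier]
  [moduleBase : Module k carrier]
  [module : Module (Zigzag k n) carrier]
  [tower : IsScalarTower k (Zigzag k n) carrier]
  /-- the homogeneous components -/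
  deg : ℤ → Submodule k carrier
  isInternal : DirectSum.IsInternal deg
  smul_mem : ∀ {c d : ℤ} {a : Zigzag k n} {m : carrier},
    a ∈ Zigzag.grade k n c → m ∈ deg d → a • m ∈ deg (c + d)
  [finite : Module.Finite (Zigzag k n) carrier]
  [projective : Module.Projective (Zigzag k n) carrier]

namespace GrProj

open Zigzag

variable {k : Type u} [Field k] {n : ℕ}

instance : CoeSort (GrProj k n) (Type u) := ⟨carrier⟩

attribute [instance] addCommGroup moduleBase module tower finite projective

/-- Morphisms of graded modules: linear maps of degree `0`. -/
def homs (M N : GrProj k n) : AddSubgroup (M →ₗ[Zigzag k n] N) where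
  carrier := {f | ∀ d, ∀ m ∈ M.deg d, f m ∈ N.deg d}
  zero_mem' := fun _ _ _ => zero_mem _
  add_mem' := fun hf hg d m hm => add_mem (hf d m hm) (hg d m hm)
  neg_mem' := fun hf d m hm => neg_mem (hf d m hm)

instance : Category (GrProj k n) where
  Hom M N := homs M N
  id M := ⟨LinearMap.id, fun _ _ h => h⟩
  comp f g := ⟨g.1 ∘ₗ f.1, fun d m hm => g.2 d _ (f.2 d m hm)⟩

/-- The linear map underlying a morphism. -/
def lin {M N : GrProj k n} (f : M ⟶ N) : M →ₗ[Zigzag k n] N := f.1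

/-- Construct a morphism from a linear map of degree `0`. -/
def mkHom {M N : GrProj k n} (f : M →ₗ[Zigzag k n] N) (hf : ∀ d, ∀ m ∈ M.deg d, f m ∈ N.deg d) :
    M ⟶ N := ⟨f, hf⟩

@[ext] theorem hom_ext {M N : GrProj k n} {f g : M ⟶ N} (h : ∀ m, lin f m = lin g m) : f = g :=
  Subtype.ext (LinearMap.ext h)

theorem lin_mem {M N : GrProj k n} (f : M ⟶ N) {d : ℤ} {m : M} (hm : m ∈ M.deg d) :
    lin f m ∈ N.deg d := f.2 d m hm

@[simp] theorem lin_mkHom {M N : GrProj k n} (f : M →ₗ[Zigzag k n] N) (hf) :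
    lin (mkHom f hf) = f := rfl

@[simp] theorem lin_id (M : GrProj k n) : lin (𝟙 M) = LinearMap.id := rfl

@[simp] theorem lin_comp {L M N : GrProj k n} (f : L ⟶ M) (g : M ⟶ N) :
    lin (f ≫ g) = lin g ∘ₗ lin f := rfl

instance : Preadditive (GrProj k n) where
  homGroup M N := inferInstanceAs (AddCommGroup (homs M N))
  add_comp := by
    intro L M N f f' g
    ext m
    exact map_add (lin g) _ _
  comp_add := by
    intro L M N f g g'
    rfl

@[simp] theorem lin_add {M N : GrProj k n} (f g : M ⟶ N) : lin (f + g) = lin f + lin g := rfl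

@[simp] theorem lin_zero {M N : GrProj k n} : lin (0 : M ⟶ N) = 0 := rfl

/-- The zero module. -/
def zeroObj (k : Type u) [Field k] (n : ℕ) : GrProj k n where
  carrier := PUnit
  deg _ := ⊤
  isInternal := isInternal_of_coaction _ (by simp) 0
    (fun d _ _ => (Finsupp.single_zero d).symm)
  smul_mem _ _ := trivial

instance : HasZeroObject (GrProj k n) :=
  ⟨zeroObj k n, by
    rw [IsZero.iff_id_eq_zero]
    ext m
    exact Subsingleton.elim (α := PUnit) _ _⟩

/-- The direct sum of two modules. -/
def prod (M N : GrProj k n) : GrProj k n where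
  carrier := M × N
  deg d := (M.deg d).prod (N.deg d)
  isInternal := isInternal_prod M.isInternal N.isInternal
  smul_mem ha hm := ⟨M.smul_mem ha hm.1, N.smul_mem ha hm.2⟩

/-- The direct sum as a bicone. -/
def bicone (M N : GrProj k n) : BinaryBicone M N where
  pt := prod M N
  fst := mkHom (LinearMap.fst _ M N) fun _ _ h => h.1
  snd := mkHom (LinearMap.snd _ M N) fun _ _ h => h.2
  inl := mkHom (N := prod M N) (LinearMap.inl _ M N) fun _ _ h => ⟨h, zero_mem _⟩
  inr := mkHom (N := prod M N) (LinearMap.inr _ M N) fun _ _ h => ⟨zero_mem _, h⟩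

instance : HasBinaryBiproducts (GrProj k n) where
  has_binary_biproduct M N := ⟨⟨bicone M N, isBinaryBilimitOfTotal _ (by
    ext m
    obtain ⟨x, y⟩ := m
    change ((x, 0) : M × N) + (0, y) = (x, y)
    simp)⟩⟩

/-! #### The grading shift -/

/-- The graded module `M⟨a⟩`, with `M⟨a⟩_d = M_{a+d}`. -/
def shiftObj (a : ℤ) (M : GrProj k n) : GrProj k n where
  carrier := M
  deg d := M.deg (a + d)
  isInternal := isInternal_shift M.isInternal a
  smul_mem {c d _ _} ha hm := by
    rw [show a + (c + d) = c + (a + d) by ring]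
    exact M.smul_mem ha hm

/-- The grading shift `⟨a⟩` as a functor. -/
def shift (a : ℤ) : GrProj k n ⥤ GrProj k n where
  obj := shiftObj a
  map {M N} f := mkHom (M := shiftObj a M) (N := shiftObj a N) (lin (M := M) (N := N) f)
    fun _ _ h => lin_mem f h

instance (a : ℤ) : (shift a : GrProj k n ⥤ GrProj k n).Additive where
  map_add := rfl

/-! #### The indecomposable projective modules -/

/-- The left ideal `Â eᵢ`. -/
def ideal (k : Type u) [Field k] {n : ℕ} (i : Fin n) : Submodule (Zigzag k n) (Zigzag k n) where
  carrier := {a | a * e k i = a}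
  zero_mem' := by simp
  add_mem' := fun {a b} ha hb => by
    simp only [Set.mem_ofPred_eq] at *
    rw [add_mul, ha, hb]
  smul_mem' := fun c a ha => by
    simp only [Set.mem_ofPred_eq, smul_eq_mul] at *
    rw [mul_assoc, ha]

theorem mem_ideal {i : Fin n} {a : Zigzag k n} : a ∈ ideal k i ↔ a * e k i = a := Iff.rfl

/-- Right multiplication by `eᵢ`, as a projection of `Â` onto `Â eᵢ`. -/
def toIdeal (k : Type u) [Field k] {n : ℕ} (i : Fin n) :
    Zigzag k n →ₗ[Zigzag k n] ideal k i where
  toFun a := ⟨a * e k i, by rw [mem_ideal, mul_assoc, e_mul_self]⟩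
  map_add' a b := Subtype.ext (add_mul _ _ _)
  map_smul' a b := Subtype.ext (mul_assoc _ _ _)

theorem toIdeal_coe {i : Fin n} (v : ideal k i) : toIdeal k i v.1 = v :=
  Subtype.ext (mem_ideal.1 v.2)

theorem coe_toIdeal {i : Fin n} (a : Zigzag k n) : (toIdeal k i a).1 = a * e k i := rfl

/-- The grading of `Â eᵢ`. -/
def idealDeg (k : Type u) [Field k] {n : ℕ} (i : Fin n) (d : ℤ) : Submodule k (ideal k i) :=
  (grade k n d).comap ((ideal k i).subtype.restrictScalars k)

theorem mem_idealDeg {i : Fin n} {d : ℤ} {a : ideal k i} :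
    a ∈ idealDeg k i d ↔ a.1 ∈ grade k n d := Iff.rfl

theorem isInternal_ideal (i : Fin n) : DirectSum.IsInternal (idealDeg k i) :=
  isInternal_of_retract (isInternal_grade k n)
    ((ideal k i).subtype.restrictScalars k) ((toIdeal k i).restrictScalars k)
    (fun v => toIdeal_coe v) (fun d m hm => by
      have := mul_mem_grade hm (e_mem_grade i)
      rwa [add_zero] at this)

/-- The projective module `Pᵢ = Â eᵢ`, with `eᵢ` in degree `0`. -/
def P (k : Type u) [Field k] {n : ℕ} (i : Fin n) : GrProj k n where
  carrier := ideal k i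
  deg := idealDeg k i
  isInternal := isInternal_ideal i
  smul_mem {_ _ a m} ha hm := by
    rw [mem_idealDeg] at hm ⊢
    exact mul_mem_grade ha hm
  finite := Module.Finite.of_surjective (toIdeal k i) fun v => ⟨v.1, toIdeal_coe v⟩
  projective := Module.Projective.of_split (ideal k i).subtype (toIdeal k i)
    (LinearMap.ext fun v => toIdeal_coe v)

/-! #### The functor `M ↦ Â eᵢ ⊗ₖ eᵢ M` -/

/-- The subspace `eᵢ M` of `M`. -/
def corner (i : Fin n) (M : GrProj k n) : Submodule k M where
  carrier := {m | e k i • m = m}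
  zero_mem' := smul_zero _
  add_mem' := fun {a b} ha hb => by
    simp only [Set.mem_ofPred_eq] at *
    rw [smul_add, ha, hb]
  smul_mem' := fun c a ha => by
    simp only [Set.mem_ofPred_eq] at *
    rw [smul_comm, ha]

theorem mem_corner {i : Fin n} {M : GrProj k n} {m : M} : m ∈ corner i M ↔ e k i • m = m := Iff.rfl

/-- An element `a` of `eᵢ Â` maps `M` into `eᵢ M`. -/
def toCorner (i : Fin n) (M : GrProj k n) (a : Zigzag k n) (ha : e k i * a = a) :
    M →ₗ[k] corner i M where
  toFun m := ⟨a • m, by rw [mem_corner, ← mul_smul, ha]⟩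
  map_add' x y := Subtype.ext (smul_add _ _ _)
  map_smul' c x := Subtype.ext (smul_comm _ _ _)

/-- The grading of `eᵢ M`. -/
def cornerDeg (i : Fin n) (M : GrProj k n) (d : ℤ) : Submodule k (corner i M) :=
  (M.deg d).comap (corner i M).subtype

theorem isInternal_corner (i : Fin n) (M : GrProj k n) : DirectSum.IsInternal (cornerDeg i M) :=
  isInternal_of_retract M.isInternal _ (toCorner i M (e k i) (by simp))
    (fun v => Subtype.ext v.2) (fun d m hm => by
      have := M.smul_mem (e_mem_grade i) hm
      rwa [zero_add] at this)

instance (M : GrProj k n) : Module.Finite k M := Module.Finite.trans (Zigzag k n) M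

/-- The graded module `Â eᵢ ⊗ₖ eᵢ M`, which is `(Â eᵢ ⊗ₖ eᵢ Â) ⊗_Â M`. -/
def tensorObj (i : Fin n) (M : GrProj k n) : GrProj k n where
  carrier := P k i ⊗[k] corner i M
  deg := tensorGrade (P k i).deg (cornerDeg i M)
  isInternal := isInternal_tensor (P k i).isInternal (isInternal_corner i M)
  smul_mem {c d a t} ha ht := by
    induction ht using Submodule.span_induction with
    | zero => simp
    | add x y _ _ hx hy => rw [smul_add]; exact add_mem hx hy
    | smul r x _ hx => rw [smul_comm]; exact Submodule.smul_mem _ _ hx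
    | mem t ht =>
      obtain ⟨p, q, rfl, m, hm, v, hv, rfl⟩ := ht
      rw [TensorProduct.smul_tmul']
      exact tmul_mem_tensorGrade (by ring) ((P k i).smul_mem ha hm) hv
  finite := Module.Finite.of_restrictScalars_finite k _ _
  projective := inferInstance

/-- The map `eᵢ M → eᵢ N` induced by a morphism. -/
def cornerMap (i : Fin n) {M N : GrProj k n} (f : M ⟶ N) : corner i M →ₗ[k] corner i N where
  toFun m := ⟨lin f m.1, by rw [mem_corner, ← map_smul, m.2]⟩
  map_add' x y := Subtype.ext (map_add _ _ _)
  map_smul' c x := Subtype.ext (LinearMap.map_smul_of_tower _ _ _)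

/-- The functor `M ↦ Â eᵢ ⊗ₖ eᵢ M`. -/
def tensor (i : Fin n) : GrProj k n ⥤ GrProj k n where
  obj := tensorObj i
  map {M N} f := mkHom (M := tensorObj i M) (N := tensorObj i N)
    (TensorProduct.AlgebraTensorModule.map LinearMap.id (cornerMap i f))
    fun d => map_mem_of_tensorGrade
      ((TensorProduct.AlgebraTensorModule.map (LinearMap.id (R := Zigzag k n) (M := P k i))
        (cornerMap i f)).restrictScalars k) _
      fun _ _ h _ hm _ hv => tmul_mem_tensorGrade h hm (lin_mem f hv)
  map_id M := by
    ext t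
    exact congrArg (fun φ => φ t) (TensorProduct.AlgebraTensorModule.map_id
      (R := k) (A := Zigzag k n) (M := P k i) (N := corner i M))
  map_comp {L M N} f g := by
    ext t
    exact congrArg (fun φ => φ t) (TensorProduct.AlgebraTensorModule.map_comp
      (LinearMap.id (R := Zigzag k n) (M := P k i)) LinearMap.id (cornerMap i g) (cornerMap i f))

instance (i : Fin n) : (tensor i : GrProj k n ⥤ GrProj k n).Additive where
  map_add {M N f g} := by
    ext t
    exact congrArg (fun φ => φ t) (TensorProduct.AlgebraTensorModule.map_add_right
      (LinearMap.id (R := Zigzag k n) (M := P k i)) (cornerMap i f) (cornerMap i g))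

/-! #### The natural transformations `fᵢ` and `gᵢ` -/

/-- The map `Â eᵢ ⊗ₖ eᵢ M ⟶ M`, `a ⊗ m ↦ a m`. -/
def evalLin (i : Fin n) (M : GrProj k n) : P k i ⊗[k] corner i M →ₗ[Zigzag k n] M :=
  TensorProduct.AlgebraTensorModule.lift
    { toFun := fun a =>
        { toFun := fun m => (show ideal k i from a).1 • m.1
          map_add' := fun _ _ => smul_add _ _ _
          map_smul' := fun _ _ => smul_comm _ _ _ }
      map_add' := fun _ _ => LinearMap.ext fun _ => add_smul _ _ _
      map_smul' := fun _ _ => LinearMap.ext fun _ => mul_smul _ _ _ }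

/-- The natural transformation induced by the bimodule map
`fᵢ : Â eᵢ ⊗ₖ eᵢ Â ⟶ Â`, `eᵢ ⊗ eᵢ ↦ eᵢ`. -/
def fNat (i : Fin n) : tensor i ⟶ 𝟭 (GrProj k n) where
  app M := mkHom (M := tensorObj i M) (evalLin i M) fun d =>
    map_mem_of_tensorGrade ((evalLin i M).restrictScalars k) _ fun a b h m hm v hv => by
      rw [← h]
      exact M.smul_mem (mem_idealDeg.1 hm) hv
  naturality M N φ := by
    ext t
    have : evalLin i N ∘ₗ
        (TensorProduct.AlgebraTensorModule.map LinearMap.id (cornerMap i φ)) =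
        lin φ ∘ₗ evalLin i M := by
      ext a m
      exact (map_smul (lin φ) _ _).symm
    exact congrArg (fun ψ => ψ t) this

/-- The loop `z` as an element of `Pᵢ`. -/
def zP (k : Type u) [Field k] {n : ℕ} (i : Fin n) : P k i := ⟨z k i, mem_ideal.2 (by simp)⟩

/-- The idempotent `eᵢ` as an element of `Pᵢ`. -/
def eP (k : Type u) [Field k] {n : ℕ} (i : Fin n) : P k i := ⟨e k i, mem_ideal.2 (by simp)⟩

/-- An arrow `j ⟶ i` as an element of `Pᵢ`. -/
def arrP (k : Type u) [Field k] {n : ℕ} (i j : Fin n) (c : Bool) : P k i :=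
  ⟨arr k j i c, mem_ideal.2 (by simp)⟩

/-- The map `m ↦ z ⊗ eᵢ m + eᵢ ⊗ z m + ∑ a* ⊗ a m`, where the sum is over all arrows `a` out of
the vertex `i`. -/
def coevalBase (i : Fin n) (M : GrProj k n) : M →ₗ[k] P k i ⊗[k] corner i M :=
  TensorProduct.mk k (P k i) (corner i M) (zP k i) ∘ₗ toCorner i M (e k i) (by simp) +
  TensorProduct.mk k (P k i) (corner i M) (eP k i) ∘ₗ toCorner i M (z k i) (by simp) +
  ∑ j : Fin n, ∑ c : Bool,
    TensorProduct.mk k (P k i) (corner i M) (arrP k i j c) ∘ₗ toCorner i M (arr k i j c) (by simp)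

/-- Auxiliary: the element `a eᵢ ⊗ eᵢ b m`. -/
def pure (i : Fin n) (M : GrProj k n) (m : M) (a b : Zigzag k n) : P k i ⊗[k] corner i M :=
  (show P k i from toIdeal k i a) ⊗ₜ[k]
    toCorner i M (e k i * b) (by rw [← mul_assoc, e_mul_self]) m

theorem coevalBase_apply (i : Fin n) (M : GrProj k n) (m : M) :
    coevalBase i M m = pure i M m (z k i) (e k i) + pure i M m (e k i) (z k i) +
      ∑ j : Fin n, ∑ c : Bool, pure i M m (arr k j i c) (arr k i j c) := by
  have h : ∀ (a b : Zigzag k n) (ha : a ∈ ideal k i) (hb : e k i * b = b),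
      (show P k i from ⟨a, ha⟩) ⊗ₜ[k] toCorner i M b hb m = pure i M m a b := by
    intro a b ha hb
    have h1 : toIdeal k i a = ⟨a, ha⟩ := Subtype.ext (mem_ideal.1 ha)
    have h2 : toCorner i M (e k i * b) (by rw [← mul_assoc, e_mul_self]) m =
        toCorner i M b hb m :=
      Subtype.ext (congrArg (· • m) hb)
    rw [pure, h1, h2]
  simp only [coevalBase, LinearMap.add_apply, LinearMap.sum_apply, LinearMap.comp_apply,
    TensorProduct.mk_apply]
  simp only [← h _ _ (mem_ideal.2 (z_mul_e i)) (e_mul_self i),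
    ← h _ _ (mem_ideal.2 (e_mul_self i)) (e_mul_z i),
    ← h _ _ (mem_ideal.2 (arr_mul_e _ i _)) (e_mul_arr i _ _)]
  rfl

theorem pure_smul_right (i : Fin n) (M : GrProj k n) (x : Zigzag k n) (m : M) (a b : Zigzag k n) :
    pure i M (x • m) a b = pure i M m a (b * x) := by
  unfold pure
  congr 1
  apply Subtype.ext
  change (e k i * b) • x • m = (e k i * (b * x)) • m
  rw [← mul_smul, mul_assoc]

theorem smul_pure (i : Fin n) (M : GrProj k n) (x : Zigzag k n) (m : M) (a b : Zigzag k n) :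
    x • pure i M m a b = pure i M m (x * a) b := by
  unfold pure
  rw [TensorProduct.smul_tmul']
  congr 1
  exact (map_smul (toIdeal k i) x a).symm

theorem pure_zero_left (i : Fin n) (M : GrProj k n) (m : M) (b : Zigzag k n) :
    pure i M m 0 b = 0 := by
  unfold pure
  rw [map_zero]
  exact TensorProduct.zero_tmul _ _

theorem pure_zero_right (i : Fin n) (M : GrProj k n) (m : M) (a : Zigzag k n) :
    pure i M m a 0 = 0 := by
  unfold pure
  have : toCorner i M (e k i * 0) (by rw [← mul_assoc, e_mul_self]) m = 0 := by
    apply Subtype.ext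
    change (e k i * 0) • m = 0
    rw [mul_zero, zero_smul]
  rw [this, TensorProduct.tmul_zero]

theorem coevalBase_smul (i : Fin n) (M : GrProj k n) (a : Zigzag k n) (m : M) :
    coevalBase i M (a • m) = a • coevalBase i M m := by
  induction a using Zigzag.induction generalizing m with
  | h0 r => rw [algebraMap_smul, map_smul, algebraMap_smul]
  | hm a b ha hb => rw [mul_smul, ha, hb, mul_smul]
  | ha a b ha hb => rw [add_smul, map_add, ha, hb, add_smul]
  | h1 s =>
    have H : ∀ (Q : Prop) [Decidable Q] (a b : Zigzag k n),
        pure i M m (if Q then a else 0) b = if Q then pure i M m a b else 0 := by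
      intro Q _ a b; split_ifs
      · rfl
      · exact pure_zero_left _ _ _ _
    have H' : ∀ (Q : Prop) [Decidable Q] (a b : Zigzag k n),
        pure i M m a (if Q then b else 0) = if Q then pure i M m a b else 0 := by
      intro Q _ a b; split_ifs
      · rfl
      · exact pure_zero_right _ _ _ _
    simp only [coevalBase_apply, smul_add, Finset.smul_sum, pure_smul_right, smul_pure]
    rcases s with l | l | ⟨p, q, h, c⟩
    · change pure i M m (z k i) (e k i * e k l) + pure i M m (e k i) (z k i * e k l) +
        ∑ j : Fin n, ∑ c : Bool, pure i M m (arr k j i c) (arr k i j c * e k l) =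
        pure i M m (e k l * z k i) (e k i) + pure i M m (e k l * e k i) (z k i) +
        ∑ j : Fin n, ∑ c : Bool, pure i M m (e k l * arr k j i c) (arr k i j c)
      simp only [e_mul_e', z_mul_e', arr_mul_e', e_mul_z', e_mul_arr', H, H']
      congr 1
      · congr 1 <;> by_cases hl : i = l <;> simp [hl, Ne.symm]
      · exact Finset.sum_congr rfl fun j _ => by simp [eq_comm]
    · change pure i M m (z k i) (e k i * z k l) + pure i M m (e k i) (z k i * z k l) +
        ∑ j : Fin n, ∑ c : Bool, pure i M m (arr k j i c) (arr k i j c * z k l) =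
        pure i M m (z k l * z k i) (e k i) + pure i M m (z k l * e k i) (z k i) +
        ∑ j : Fin n, ∑ c : Bool, pure i M m (z k l * arr k j i c) (arr k i j c)
      simp only [z_mul_e', arr_mul_z', e_mul_z', z_mul_arr', z_mul_z', H, H', pure_zero_left,
        pure_zero_right]
      by_cases hl : i = l
      · subst hl; simp
      · simp [hl, Ne.symm hl]
    · rw [gen_arr]
      simp only [z_mul_arr', arr_mul_e', e_mul_arr', arr_mul_z', arr_mul_arr', H, H',
        pure_zero_left, pure_zero_right, add_zero, zero_add]
      by_cases hip : i = p
      · subst hip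
        rw [Finset.sum_eq_zero (fun x _ => Finset.sum_eq_zero fun d _ => if_neg (by
            rintro ⟨rfl, rfl, h', -⟩; exact h' rfl)), if_pos rfl, if_neg (Ne.symm h), zero_add,
          add_zero, Finset.sum_eq_single q (fun x _ hx => Finset.sum_eq_zero fun d _ => if_neg (by
            rintro ⟨rfl, -⟩; exact hx rfl)) (by simp),
          Finset.sum_eq_single c (fun d _ hd => if_neg (by
            rintro ⟨-, -, -, rfl⟩; exact hd rfl)) (by simp), if_pos ⟨rfl, rfl, h, rfl⟩]
      · by_cases hiq : i = q
        · subst hiq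
          rw [Finset.sum_eq_single p (fun x _ hx => Finset.sum_eq_zero fun d _ => if_neg (by
              rintro ⟨rfl, -⟩; exact hx rfl)) (by simp),
            Finset.sum_eq_single c (fun d _ hd => if_neg (by
              rintro ⟨-, -, -, rfl⟩; exact hd rfl)) (by simp), if_neg hip,
            if_pos (show p = p ∧ i = i ∧ i ≠ p ∧ c = c from ⟨rfl, rfl, hip, rfl⟩), if_pos rfl,
            Finset.sum_eq_zero (fun x _ => Finset.sum_eq_zero fun d _ => if_neg (by
              rintro ⟨-, rfl, -⟩; exact h rfl))]
          simp
        · simp [hip, hiq, Ne.symm hip, Ne.symm hiq]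

/-- The `Â`-linear map `M ⟶ Â eᵢ ⊗ₖ eᵢ M` given by `coevalBase`. -/
def coevalLin (i : Fin n) (M : GrProj k n) : M →ₗ[Zigzag k n] P k i ⊗[k] corner i M where
  toFun := coevalBase i M
  map_add' := map_add _
  map_smul' := coevalBase_smul i M

/-- The natural transformation induced by the bimodule map
`gᵢ : Â ⟶ (Â eᵢ ⊗ₖ eᵢ Â)⟨1⟩`, `1 ↦ z ⊗ eᵢ + eᵢ ⊗ z + ∑ a* ⊗ a`. -/
def gNat (i : Fin n) : 𝟭 (GrProj k n) ⟶ tensor i ⋙ shift 1 where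
  app M := mkHom (N := shiftObj 1 (tensorObj i M)) (coevalLin i M) (by
    intro d m hm
    change coevalBase i M m ∈ tensorGrade (P k i).deg (cornerDeg i M) (1 + d)
    simp only [coevalBase, LinearMap.add_apply, LinearMap.sum_apply, LinearMap.comp_apply,
      TensorProduct.mk_apply]
    refine add_mem (add_mem ?_ ?_) (sum_mem fun j _ => sum_mem fun c _ => ?_)
    · exact tmul_mem_tensorGrade rfl (z_mem_grade i)
        (by
          have := M.smul_mem (e_mem_grade i) hm
          rw [zero_add] at this
          exact this)
    · exact tmul_mem_tensorGrade (zero_add _) (e_mem_grade i) (M.smul_mem (z_mem_grade i) hm)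
    · by_cases hij : i = j
      · subst hij
        have : arrP k i i c = 0 := Subtype.ext (arr_self i c)
        rw [this, TensorProduct.zero_tmul]
        exact zero_mem _
      · refine tmul_mem_tensorGrade ?_ (arr_mem_grade j i c) (M.smul_mem (arr_mem_grade i j c) hm)
        split_ifs <;> omega)
  naturality M N φ := by
    ext m
    change coevalBase i N (lin φ m) = TensorProduct.AlgebraTensorModule.map
      (LinearMap.id (R := Zigzag k n) (M := P k i)) (cornerMap i φ) (coevalBase i M m)
    simp only [coevalBase, LinearMap.add_apply, LinearMap.sum_apply, LinearMap.comp_apply,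
      TensorProduct.mk_apply, map_add, map_sum, TensorProduct.AlgebraTensorModule.map_tmul,
      LinearMap.id_apply]
    have h : ∀ (a : Zigzag k n) (ha : e k i * a = a),
        cornerMap i φ (toCorner i M a ha m) = toCorner i N a ha (lin φ m) :=
      fun a ha => Subtype.ext (map_smul (lin φ) a m)
    simp only [h]

end GrProj


/-! ### Cones of natural transformations -/

section Cone

variable {C : Type u} [Category.{v} C] [Preadditive C] [HasZeroObject C] [HasBinaryBiproducts C]
  {S T : C ⥤ C} [S.Additive] [T.Additive] (η : S ⟶ T)

/-- For a natural transformation `η : S ⟶ T` of additive functors, the functor which sends a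
complex `K` to the mapping cone of `η : S(K) ⟶ T(K)`. -/
def cone : CochainComplex C ℤ ⥤ CochainComplex C ℤ where
  obj K := CochainComplex.mappingCone
    ((NatTrans.mapHomologicalComplex η (ComplexShape.up ℤ)).app K)
  map φ := CochainComplex.mappingCone.map _ _
    ((S.mapHomologicalComplex (ComplexShape.up ℤ)).map φ)
    ((T.mapHomologicalComplex (ComplexShape.up ℤ)).map φ)
    ((NatTrans.mapHomologicalComplex η (ComplexShape.up ℤ)).naturality φ).symm
  map_id K := by
    simp only [CategoryTheory.Functor.map_id]
    exact CochainComplex.mappingCone.map_id _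
  map_comp φ ψ := by
    simp only [Functor.map_comp]
    exact CochainComplex.mappingCone.map_comp _ _ _ _ _ _ _ _ _

theorem cone_inverts : (HomologicalComplex.homotopyEquivalences C (ComplexShape.up ℤ)).IsInvertedBy
    (cone η ⋙ HomotopyCategory.quotient C (ComplexShape.up ℤ)) := by
  rintro K L φ ⟨h, rfl⟩
  let t := (HomotopyCategory.quotient C (ComplexShape.up ℤ)).mapTriangle.map
    (CochainComplex.mappingCone.triangleMap _ _ _ _
      ((NatTrans.mapHomologicalComplex η (ComplexShape.up ℤ)).naturality h.hom).symm)
  have h1 : IsIso t.hom₁ :=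
    ((HomotopyCategory.isoOfHomotopyEquiv (S.mapHomotopyEquiv h)).isIso_hom)
  have h2 : IsIso t.hom₂ :=
    ((HomotopyCategory.isoOfHomotopyEquiv (T.mapHomotopyEquiv h)).isIso_hom)
  exact Pretriangulated.isIso₃_of_isIso₁₂ t
    (HomotopyCategory.mappingCone_triangleh_distinguished _)
    (HomotopyCategory.mappingCone_triangleh_distinguished _) h1 h2

/-- The functor `cone η` on homotopy categories. -/
def coneK : HomotopyCategory C (ComplexShape.up ℤ) ⥤ HomotopyCategory C (ComplexShape.up ℤ) :=
  CategoryTheory.Quotient.lift _ (cone η ⋙ HomotopyCategory.quotient C (ComplexShape.up ℤ)) (by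
    rintro K L φ ψ ⟨h⟩
    exact h.map_eq_of_inverts_homotopyEquivalences (fun j => ⟨j - 1, by simp⟩) _ (cone_inverts η))

variable (C) in
/-- The bounded complexes. -/
def bounded : ObjectProperty (HomotopyCategory C (ComplexShape.up ℤ)) := fun K =>
  ∃ a b : ℤ, ∀ m : ℤ, m < a ∨ b < m → IsZero (K.as.X m)

theorem coneK_bounded (K : HomotopyCategory C (ComplexShape.up ℤ)) (hK : bounded C K) :
    bounded C ((coneK η).obj K) := by
  obtain ⟨a, b, h⟩ := hK
  refine ⟨a - 1, b, fun m hm => ?_⟩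
  change IsZero ((CochainComplex.mappingCone
    ((NatTrans.mapHomologicalComplex η (ComplexShape.up ℤ)).app K.as)).X m)
  rw [CochainComplex.mappingCone.isZero_X_iff]
  exact ⟨S.map_isZero (h _ (by omega)), T.map_isZero (h _ (by omega))⟩

/-- The functor `K ↦ Cone(η : S(K) ⟶ T(K))[-1]` on homotopy categories; in degree `m` this complex
is `S(Kᵐ) ⊕ T(Kᵐ⁻¹)`. -/
def coconeK : HomotopyCategory C (ComplexShape.up ℤ) ⥤ HomotopyCategory C (ComplexShape.up ℤ) :=
  CategoryTheory.Quotient.lift _ ((cone η ⋙ shiftFunctor (CochainComplex C ℤ) (-1 : ℤ)) ⋙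
      HomotopyCategory.quotient C (ComplexShape.up ℤ)) (by
    rintro K L φ ψ ⟨h⟩
    refine h.map_eq_of_inverts_homotopyEquivalences (fun j => ⟨j - 1, by simp⟩) _ ?_
    let e : (cone η ⋙ shiftFunctor (CochainComplex C ℤ) (-1 : ℤ)) ⋙
        HomotopyCategory.quotient C (ComplexShape.up ℤ) ≅
        (cone η ⋙ HomotopyCategory.quotient C (ComplexShape.up ℤ)) ⋙ shiftFunctor _ (-1 : ℤ) :=
      Functor.isoWhiskerLeft (cone η)
        ((HomotopyCategory.quotient C (ComplexShape.up ℤ)).commShiftIso (-1 : ℤ))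
    rw [MorphismProperty.IsInvertedBy.iff_of_iso _ e]
    intro K L φ hφ
    have := cone_inverts η φ hφ
    exact Functor.map_isIso (shiftFunctor _ (-1 : ℤ)) _)

theorem coconeK_bounded (K : HomotopyCategory C (ComplexShape.up ℤ)) (hK : bounded C K) :
    bounded C ((coconeK η).obj K) := by
  obtain ⟨a, b, h⟩ := hK
  refine ⟨a, b + 1, fun m hm => ?_⟩
  change IsZero ((CochainComplex.mappingCone
    ((NatTrans.mapHomologicalComplex η (ComplexShape.up ℤ)).app K.as)).X (m + (-1)))
  rw [CochainComplex.mappingCone.isZero_X_iff]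
  exact ⟨S.map_isZero (h _ (by omega)), T.map_isZero (h _ (by omega))⟩

end Cone

theorem single_bounded {C : Type u} [Category.{v} C] [Preadditive C] [HasZeroObject C] (X : C) : bounded C ((HomotopyCategory.quotient C (ComplexShape.up ℤ)).obj
    ((CochainComplex.singleFunctor C 0).obj X)) := by
  refine ⟨0, 0, fun m hm => ?_⟩
  exact HomologicalComplex.isZero_single_obj_X _ _ _ _ (by omega)



/-! ### The braid group and its Hurwitz action on tuples of group elements -/

/-- The relations of Artin's presentation of the braid group on `n` strands; the generators
`τ₁, …, τₙ₋₁` are indexed by `Fin (n - 1)`. -/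
def braidRels (n : ℕ) : Set (FreeGroup (Fin (n - 1))) :=
  {w | ∃ i j : Fin (n - 1), j.val = i.val + 1 ∧
      w = FreeGroup.of i * FreeGroup.of j * FreeGroup.of i *
        (FreeGroup.of j * FreeGroup.of i * FreeGroup.of j)⁻¹} ∪
  {w | ∃ i j : Fin (n - 1), i.val + 2 ≤ j.val ∧
      w = FreeGroup.of i * FreeGroup.of j * (FreeGroup.of j * FreeGroup.of i)⁻¹}

/-- The Artin braid group `Bₙ`. -/
abbrev BraidGroup (n : ℕ) : Type := PresentedGroup (braidRels n)

/-- The standard generators of the braid group. -/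
def braidGen {n : ℕ} (i : Fin (n - 1)) : BraidGroup n := PresentedGroup.of i

/-- The first of the two positions moved by the generator `τᵢ`. -/
def lo {n : ℕ} (i : Fin (n - 1)) : Fin n := ⟨i.val, by omega⟩

/-- The second of the two positions moved by the generator `τᵢ`. -/
def hi {n : ℕ} (i : Fin (n - 1)) : Fin n := ⟨i.val + 1, by omega⟩

section Hurwitz

variable {G : Type*} [Group G] {n : ℕ}

/-- `τᵢ (g₁, …, gₙ) = (g₁, …, gᵢ gᵢ₊₁ gᵢ⁻¹, gᵢ, …, gₙ)`. -/
def hurwitzMove (i : Fin (n - 1)) (x : Fin n → G) : Fin n → G := fun j =>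
  if j = lo i then x (lo i) * x (hi i) * (x (lo i))⁻¹ else if j = hi i then x (lo i) else x j

/-- The inverse of `hurwitzMove`. -/
def hurwitzMoveInv (i : Fin (n - 1)) (x : Fin n → G) : Fin n → G := fun j =>
  if j = lo i then x (hi i) else if j = hi i then (x (hi i))⁻¹ * x (lo i) * x (hi i) else x j

theorem hi_ne_lo (i : Fin (n - 1)) : hi i ≠ lo i := by
  simp [hi, lo, Fin.ext_iff]

/-- `hurwitzMove` as a permutation of the set of tuples. -/
def hurwitzPerm (i : Fin (n - 1)) : Equiv.Perm (Fin n → G) where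
  toFun := hurwitzMove i
  invFun := hurwitzMoveInv i
  left_inv x := by
    funext j
    have := hi_ne_lo i
    by_cases h1 : j = lo i
    · subst h1; simp [hurwitzMove, hurwitzMoveInv, this]
    · by_cases h2 : j = hi i
      · subst h2; simp [hurwitzMove, hurwitzMoveInv, this, mul_assoc]
      · simp [hurwitzMove, hurwitzMoveInv, h1, h2]
  right_inv x := by
    funext j
    have := hi_ne_lo i
    by_cases h1 : j = lo i
    · subst h1; simp [hurwitzMove, hurwitzMoveInv, this, mul_assoc]
    · by_cases h2 : j = hi i
      · subst h2; simp [hurwitzMove, hurwitzMoveInv, this]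
      · simp [hurwitzMove, hurwitzMoveInv, h1, h2]

theorem hurwitzPerm_rels (w : FreeGroup (Fin (n - 1))) (hw : w ∈ braidRels n) :
    FreeGroup.lift (fun i => hurwitzPerm (G := G) (n := n) i) w = 1 := by
  rcases hw with ⟨i, j, hij, rfl⟩ | ⟨i, j, hij, rfl⟩
  · rw [map_mul, map_inv, mul_inv_eq_one]
    simp only [map_mul, FreeGroup.lift_apply_of]
    ext x l
    have h1 : lo j = hi i := by simp [lo, hi, hij]
    have h2 : hi j ≠ hi i := by simp [hi, Fin.ext_iff, hij]
    have h3 : hi j ≠ lo i := by simp [lo, hi, Fin.ext_iff, hij]; omega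
    have h4 := hi_ne_lo i
    change hurwitzMove i (hurwitzMove j (hurwitzMove i x)) l =
      hurwitzMove j (hurwitzMove i (hurwitzMove j x)) l
    by_cases e1 : l = lo i
    · subst e1
      simp [hurwitzMove, h1, h2, h3, h3.symm, h4, h4.symm, mul_assoc]
    · by_cases e2 : l = hi i
      · subst e2
        simp [hurwitzMove, h1, h2, h3, h3.symm, h4, h4.symm, mul_assoc]
      · by_cases e3 : l = hi j
        · subst e3
          simp [hurwitzMove, h1, h2, h3, h3.symm, h4, h4.symm]
        · simp [hurwitzMove, h1, e1, e2, e3]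
  · rw [map_mul, map_inv, mul_inv_eq_one]
    simp only [map_mul, FreeGroup.lift_apply_of]
    ext x l
    have h1 : lo j ≠ lo i := by simp [lo, Fin.ext_iff]; omega
    have h2 : lo j ≠ hi i := by simp [lo, hi, Fin.ext_iff]; omega
    have h3 : hi j ≠ lo i := by simp [lo, hi, Fin.ext_iff]; omega
    have h4 : hi j ≠ hi i := by simp [hi, Fin.ext_iff]; omega
    change hurwitzMove i (hurwitzMove j x) l = hurwitzMove j (hurwitzMove i x) l
    by_cases e1 : l = lo i
    · subst e1; simp [hurwitzMove, h1.symm, h2.symm, h3.symm, h4.symm]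
    · by_cases e2 : l = hi i
      · subst e2; simp [hurwitzMove, h1.symm, h2.symm, h3.symm, h4.symm]
      · by_cases e3 : l = lo j
        · subst e3; simp [hurwitzMove, h1, h2, h3, h4]
        · by_cases e4 : l = hi j
          · subst e4; simp [hurwitzMove, h1, h2, h3, h4]
          · simp [hurwitzMove, e1, e2, e3, e4]

variable (G n) in
/-- The Hurwitz action of the braid group on `n`-tuples of elements of a group. -/
def hurwitz : BraidGroup n →* Equiv.Perm (Fin n → G) :=
  PresentedGroup.toGroup (f := fun i => hurwitzPerm (G := G) (n := n) i) hurwitzPerm_rels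

theorem hurwitz_gen (i : Fin (n - 1)) (x : Fin n → G) :
    hurwitz G n (braidGen i) x = hurwitzMove i x := by
  simp [hurwitz, braidGen, hurwitzPerm]

theorem prod_ofFn_congr (n i : ℕ) (h : i + 1 < n) (x y : Fin n → G)
    (hxy : ∀ j : Fin n, j.val ≠ i → j.val ≠ i + 1 → x j = y j)
    (hp : x ⟨i, by omega⟩ * x ⟨i + 1, h⟩ = y ⟨i, by omega⟩ * y ⟨i + 1, h⟩) :
    (List.ofFn x).prod = (List.ofFn y).prod := by
  induction n generalizing i with
  | zero => omega
  | succ n ih =>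
    cases i with
    | zero =>
      obtain ⟨n, rfl⟩ : ∃ m, n = m + 1 := ⟨n - 1, by omega⟩
      simp only [List.ofFn_succ, List.prod_cons, ← mul_assoc]
      congr 1
      refine congrArg List.prod (congrArg List.ofFn (funext fun j => hxy _ ?_ ?_))
      · simp
      · simp
    | succ i =>
      simp only [List.ofFn_succ, List.prod_cons]
      congr 1
      · exact hxy _ (by simp) (by simp)
      · exact ih i (by omega) _ _ (fun j h1 h2 => hxy _ (by simpa using h1) (by simpa using h2)) hp

end Hurwitz

/-! ### Minimal reflection expressions of the Coxeter element -/

/-- The Coxeter element `γ = σ₁ σ₂ ⋯ σₙ` of the free group. -/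
def coxeter (n : ℕ) : FreeGroup (Fin n) := (List.ofFn fun i : Fin n => FreeGroup.of i).prod

/-- A reflection of the free group: an element represented by a loop which follows a path from the
base point to a puncture, turns once counterclockwise around this puncture and returns along the
same path; equivalently, a conjugate of a standard generator. -/
def IsReflection {n : ℕ} (r : FreeGroup (Fin n)) : Prop :=
  ∃ (g : FreeGroup (Fin n)) (i : Fin n), r = g * FreeGroup.of i * g⁻¹

/-- The set of minimal (length `n`) reflection expressions of `γ`. -/
def Red (n : ℕ) : Set (Fin n → FreeGroup (Fin n)) :=
  {r | (∀ i, IsReflection (r i)) ∧ (List.ofFn r).prod = coxeter n}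

theorem isReflection_conj {n : ℕ} {r : FreeGroup (Fin n)} (h : IsReflection r)
    (g : FreeGroup (Fin n)) : IsReflection (g * r * g⁻¹) := by
  obtain ⟨g', i, rfl⟩ := h
  exact ⟨g * g', i, by group⟩

theorem hurwitzPerm_mem_iff {n : ℕ} (i : Fin (n - 1)) (r : Fin n → FreeGroup (Fin n)) :
    r ∈ Red n ↔ hurwitzMove i r ∈ Red n := by
  have hne := hi_ne_lo i
  have hl : hurwitzMove i r (lo i) = r (lo i) * r (hi i) * (r (lo i))⁻¹ := by simp [hurwitzMove]
  have hh : hurwitzMove i r (hi i) = r (lo i) := by simp [hurwitzMove, hne]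
  have ho : ∀ j, j ≠ lo i → j ≠ hi i → hurwitzMove i r j = r j := by
    intro j h1 h2; simp [hurwitzMove, h1, h2]
  have hprod : (List.ofFn (hurwitzMove i r)).prod = (List.ofFn r).prod := by
    refine prod_ofFn_congr n i.val (by omega) _ _ (fun j h1 h2 => ho j ?_ ?_) ?_
    · exact fun h => h1 (by simp [h, lo])
    · exact fun h => h2 (by simp [h, hi])
    · change hurwitzMove i r (lo i) * hurwitzMove i r (hi i) = r (lo i) * r (hi i)
      rw [hl, hh]; group
  change (_ ∧ _) ↔ (_ ∧ _)
  rw [hprod]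
  refine and_congr_left fun _ => ⟨fun h j => ?_, fun h j => ?_⟩
  · by_cases h1 : j = lo i
    · rw [h1, hl]; exact isReflection_conj (h _) _
    · by_cases h2 : j = hi i
      · rw [h2, hh]; exact h _
      · rw [ho j h1 h2]; exact h _
  · by_cases h1 : j = lo i
    · rw [h1, ← hh]; exact h _
    · by_cases h2 : j = hi i
      · have := isReflection_conj (h (lo i)) (r (lo i))⁻¹
        rw [hl] at this
        rw [h2]
        convert this using 1
        group
      · rw [← ho j h1 h2]; exact h _

theorem hurwitz_mem_iff {n : ℕ} (β : BraidGroup n) (r : Fin n → FreeGroup (Fin n)) :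
    r ∈ Red n ↔ hurwitz _ n β r ∈ Red n := by
  have h : β ∈ Subgroup.closure (Set.range (PresentedGroup.of (rels := braidRels n))) := by
    rw [PresentedGroup.closure_range_of]; trivial
  induction h using Subgroup.closure_induction generalizing r with
  | mem x hx =>
    obtain ⟨i, rfl⟩ := hx
    change _ ↔ hurwitz _ n (braidGen i) r ∈ _
    rw [hurwitz_gen]
    exact hurwitzPerm_mem_iff i r
  | one => simp
  | mul x y _ _ hx hy =>
    rw [map_mul, Equiv.Perm.mul_apply]
    exact (hy r).trans (hx _)
  | inv x _ hx =>
    have h := hx (hurwitz _ n x⁻¹ r)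
    rw [← Equiv.Perm.mul_apply, ← map_mul, mul_inv_cancel, map_one] at h
    exact h.symm

/-- The Hurwitz action of the braid group on minimal reflection expressions of `γ`. -/
def redAct {n : ℕ} (β : BraidGroup n) (r : Red n) : Red n :=
  ⟨hurwitz _ n β r.1, (hurwitz_mem_iff β r.1).1 r.2⟩

/-- The minimal reflection expression `(σ₁, …, σₙ)` of `γ`. -/
def stdRed (n : ℕ) : Red n := ⟨fun i => FreeGroup.of i, fun i => ⟨1, i, by simp⟩, rfl⟩


/-! ### The category `𝒟` and the action of the free group -/

section Action

variable (k : Type u) [Field k] (n : ℕ)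

/-- The category `𝒟`: the homotopy category of bounded complexes of finitely generated graded
projective `Â`-modules. -/
abbrev D : Type (u + 1) := (bounded (GrProj k n)).FullSubcategory

variable {n}

/-- The object `Pᵢ` of `𝒟`, a complex concentrated in degree `0`. -/
def projD (i : Fin n) : D k n := ⟨_, single_bounded (GrProj.P k i)⟩

/-- The functor `Σᵢ`: tensoring with the complex of bimodules
`Â ⟶ (Â eᵢ ⊗ₖ eᵢ Â)⟨1⟩`, where `Â` is in degree `0` and the differential is `gᵢ`. -/
def twistFunctor (i : Fin n) : D k n ⥤ D k n :=
  (bounded (GrProj k n)).lift ((bounded (GrProj k n)).ι ⋙ coconeK (GrProj.gNat i))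
    fun K => coconeK_bounded _ K.obj K.property

/-- The functor `Σᵢ⁻¹`: tensoring with the complex of bimodules
`Â eᵢ ⊗ₖ eᵢ Â ⟶ Â`, where `Â` is in degree `0` and the differential is `fᵢ`. -/
def twistInvFunctor (i : Fin n) : D k n ⥤ D k n :=
  (bounded (GrProj k n)).lift ((bounded (GrProj k n)).ι ⋙ coneK (GrProj.fNat i))
    fun K => coneK_bounded _ K.obj K.property

/-- The functor attached to a word in the letters `σᵢ` (written `(i, true)`) and
`σᵢ⁻¹` (written `(i, false)`). -/
def wordFunctor : List (Fin n × Bool) → (D k n ⥤ D k n)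
  | [] => 𝟭 _
  | (i, true) :: w => wordFunctor w ⋙ twistFunctor k i
  | (i, false) :: w => wordFunctor w ⋙ twistInvFunctor k i

/-- The functor `Ψ_g` for an element `g` of the free group. -/
def Psi (g : FreeGroup (Fin n)) : D k n ⥤ D k n := wordFunctor k g.toWord

/-- The spherical twist `Φ_E ≅ Ψ_g Σ_j Ψ_g⁻¹` in the spherical object `E = Ψ_g(P_j)`. -/
def sphericalTwist (g : FreeGroup (Fin n)) (j : Fin n) : D k n ⥤ D k n :=
  Psi k g⁻¹ ⋙ twistFunctor k j ⋙ Psi k g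

variable (n)

/-- Isomorphism classes of objects of `𝒟`. -/
abbrev IsoClass : Type (u + 1) := Quotient (isIsomorphicSetoid (D k n))

variable {k n}

/-- The isomorphism class of an object of `𝒟`. -/
def isoClass (X : D k n) : IsoClass k n := Quotient.mk (isIsomorphicSetoid (D k n)) X

variable (k n)

/-- Isomorphism classes of spherical objects, i.e. of objects of the form `Ψ_g(P_j)`. -/
def Spherical : Type (u + 1) :=
  {X : IsoClass k n // ∃ (g : FreeGroup (Fin n)) (j : Fin n), X = isoClass ((Psi k g).obj (projD k j))}

/-- Ordered spherical collections of length `n`; objects are considered up to isomorphism. -/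
abbrev SphericalCollection : Type (u + 1) := Fin n → Spherical k n

/-- The spherical collection `(P₁, …, Pₙ)`. -/
def stdCollection : SphericalCollection k n := fun i =>
  ⟨isoClass (projD k i), 1, i, by simp [Psi, wordFunctor]⟩

variable {k n}

/-- An action of the braid group on ordered spherical collections is the Hurwitz action if
`τᵢ (E₁, …, Eₙ) = (E₁, …, Φ_{Eᵢ}(Eᵢ₊₁), Eᵢ, …, Eₙ)` for all `i`; here the twist `Φ_{Eᵢ}` may be
computed from any presentation `Eᵢ ≅ Ψ_g(P_j)`. -/
def IsHurwitzAction (act : BraidGroup n →* Equiv.Perm (SphericalCollection k n)) : Prop :=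
  ∀ (i : Fin (n - 1)) (E : SphericalCollection k n),
    (∀ (g : FreeGroup (Fin n)) (j : Fin n) (Y : D k n),
      (E (lo i)).1 = isoClass ((Psi k g).obj (projD k j)) → (E (hi i)).1 = isoClass Y →
        (act (braidGen i) E (lo i)).1 = isoClass ((sphericalTwist k g j).obj Y)) ∧
    act (braidGen i) E (hi i) = E (lo i) ∧
    ∀ l, l ≠ lo i → l ≠ hi i → act (braidGen i) E l = E l

/-- The orbit of `(P₁, …, Pₙ)`. -/
def orbit (act : BraidGroup n →* Equiv.Perm (SphericalCollection k n)) :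
    Set (SphericalCollection k n) :=
  Set.range fun β : BraidGroup n => act β (stdCollection k n)

/-- The map `F` from minimal reflection expressions of `γ` to the orbit of `(P₁, …, Pₙ)` sends
`(σ₁, …, σₙ)` to `(P₁, …, Pₙ)` and intertwines the actions of the braid group. -/
def IsEquivariantExtension (act : BraidGroup n →* Equiv.Perm (SphericalCollection k n))
    (F : Red n → orbit act) : Prop :=
  (F (stdRed n)).1 = stdCollection k n ∧
    ∀ (β : BraidGroup n) (r : Red n), (F (redAct β r)).1 = act β (F r).1

end Action

end ZigzagFree

end

noncomputable section

open CategoryTheory Limits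
open scoped TensorProduct

universe u v

namespace ZigzagFree

/-! ### Faithfulness of the Hurwitz action -/

section Faithful

/-! The proof transports the problem to the free group by an invariant: a map t from spherical
objects to reflections. The twists Σ_i and Σ_i⁻¹ are mutually inverse on isomorphism classes, so F_n
acts on these classes, and Φ_E acts there as gσ_jg⁻¹ when E = Ψ_g(P_j). Suppose this reflection t(E)
depends only on E. Then t(gE) = g t(E) g⁻¹, and for any map with this property the moves (x, y) ↦
(t(x)y, x) satisfy the braid relations. Applying t entrywise turns this action into the Hurwitz
action on tuples in F_n and sends (P_1, …, P_n) to (σ_1, …, σ_n). As B_n acts simply transitively on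
`Red n`, it acts freely on the orbit, and r = β(σ_1, …, σ_n) ↦ β(P_1, …, P_n) is the only
equivariant map; t inverts it.

Four results carry the argument.

`hurwitz_faithful`: the stabiliser of (σ_1, …, σ_n) is trivial. A braid is combed into a braid on
the first strands, a pure braid of the last strand (a word w in a free group) and one of finitely
many coset representatives. A braid fixing the free generators fixes every tuple in every group, so
tuples in ℤ, in a free group and in the wreath product ℤ ≀ F detect the three factors in turn.

`exists_redAct_eq`: the action on `Red n` is transitive. The entries are written g σ_a g⁻¹ and the
total length of the conjugators g is minimised. If no Hurwitz move and no rewriting shortens it,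
then nothing cancels between the central letters in the product, whose length is n only if every
conjugator is trivial.

`nonempty_twistInv_twist_iso` and `nonempty_twist_twistInv_iso`: since e_iÂe_i is spanned by e_i and
z_i, the double tensor P_i ⊗ e_iP_i ⊗ e_iM splits into two copies of P_i ⊗ e_iM, up to grading
shifts. The splittings identify the composite cones with shifts of the identity.

`conj_eq_of_iso`: the reflection is well defined. To a complex with total module V and differential
D one attaches the numbers m_j = dim H(z_jV), which count the copies of P_j in a minimal complex. A
twist at l, of either sign, keeps m_j for j ≠ l and replaces m_l by m_l + 2∑_{j≠l} m_j − 2r, where r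
≤ m_l is the rank of a connecting map. This rank does not increase when the same twist is repeated.
A ping-pong argument on reduced words then shows that Ψ_g(P_j) has the multiplicities of an
indecomposable projective only if g is a power of σ_j. -/

/-- The generator `τᵢ` of the braid group indexed by a natural number, with value `1` out of range. -/
def braidTau (N i : ℕ) : BraidGroup N := if h : i < N - 1 then braidGen ⟨i, h⟩ else 1

theorem braidTau_of_lt {N i : ℕ} (h : i < N - 1) : braidTau N i = braidGen ⟨i, h⟩ := dif_pos h

theorem braidTau_braid {N i : ℕ} (h : i + 1 < N - 1) :
    braidTau N i * braidTau N (i + 1) * braidTau N i =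
      braidTau N (i + 1) * braidTau N i * braidTau N (i + 1) := by
  rw [braidTau_of_lt h, braidTau_of_lt (by omega : i < N - 1), ← mul_inv_eq_one]
  exact PresentedGroup.one_of_mem (rels := braidRels N)
    (Or.inl ⟨⟨i, by omega⟩, ⟨i + 1, h⟩, rfl, rfl⟩)

theorem braidTau_comm {N i j : ℕ} (h : i + 2 ≤ j) :
    braidTau N i * braidTau N j = braidTau N j * braidTau N i := by
  by_cases hj : j < N - 1
  · rw [braidTau_of_lt hj, braidTau_of_lt (by omega : i < N - 1), ← mul_inv_eq_one]
    exact PresentedGroup.one_of_mem (rels := braidRels N)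
      (Or.inr ⟨⟨i, by omega⟩, ⟨j, hj⟩, h, rfl⟩)
  · simp [braidTau, hj]

theorem closure_braidTau (N : ℕ) : Subgroup.closure (Set.range (braidTau N)) = ⊤ := by
  rw [eq_top_iff, ← PresentedGroup.closure_range_of, Subgroup.closure_le]
  rintro _ ⟨i, rfl⟩
  exact Subgroup.subset_closure ⟨i.1, braidTau_of_lt i.2⟩

variable {G K : Type*} [Group G] [Group K]

/-- Naturality in the group: what happens to the free generators determines what happens to every
tuple, and a braid can be tested after mapping to a convenient group. -/
theorem hurwitz_map {N : ℕ} (f : G →* K) (β : BraidGroup N) (x : Fin N → G) :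
    hurwitz K N β (f ∘ x) = f ∘ hurwitz G N β x := by
  have h : β ∈ Subgroup.closure (Set.range (PresentedGroup.of (rels := braidRels N))) := by
    rw [PresentedGroup.closure_range_of]; trivial
  induction h using Subgroup.closure_induction generalizing x with
  | mem b hb =>
    obtain ⟨i, rfl⟩ := hb
    change hurwitz K N (braidGen i) _ = f ∘ hurwitz G N (braidGen i) x
    rw [hurwitz_gen, hurwitz_gen]
    funext j
    simp only [hurwitzMove, Function.comp_apply]
    split_ifs <;> simp
  | one => simp
  | mul a b _ _ ha hb => simp only [map_mul, Equiv.Perm.mul_apply, hb, ha]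
  | inv a _ ha =>
    rw [map_inv, map_inv, Equiv.Perm.inv_eq_iff_eq, ha]
    simp

/-! ### Combing a braid along its last strand. -/

variable (n : ℕ)

/-- The braid `τₙ₋₁ ⋯ τⱼ`, which moves the strand `j` to the last position. -/
def combStrand (j : ℕ) : BraidGroup (n + 1) :=
  ((List.range' j (n - j)).map (braidTau (n + 1))).reverse.prod

variable {n}

theorem combStrand_of_le {j : ℕ} (h : n ≤ j) : combStrand n j = 1 := by
  simp [combStrand, Nat.sub_eq_zero_of_le h]

theorem combStrand_eq {j : ℕ} (h : j < n) :
    combStrand n j = combStrand n (j + 1) * braidTau (n + 1) j := by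
  obtain ⟨m, hm⟩ : ∃ m, n - j = m + 1 := ⟨n - j - 1, by omega⟩
  have hm' : n - (j + 1) = m := by omega
  simp [combStrand, hm, hm', List.range'_succ]

theorem combStrand_comm {i j : ℕ} (h : i + 1 < j) :
    combStrand n j * braidTau (n + 1) i = braidTau (n + 1) i * combStrand n j := by
  obtain hj | hj := le_or_gt n j
  · simp [combStrand_of_le hj]
  · have ih := combStrand_comm (i := i) (j := j + 1) (by omega)
    rw [combStrand_eq hj, mul_assoc, ← braidTau_comm (by omega), ← mul_assoc, ih, mul_assoc]
termination_by n - j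

/-- The braid relation is needed only where the moving strand crosses the strands i + 1 and i + 2;
elsewhere the generators commute. The index drops by one because the strand j leaves its place below
them. -/
theorem combStrand_shift {i j : ℕ} (hji : j ≤ i) (hi : i + 1 < n) :
    combStrand n j * braidTau (n + 1) (i + 1) = braidTau (n + 1) i * combStrand n j := by
  obtain rfl | hlt := hji.eq_or_lt
  · rw [combStrand_eq (by omega : j < n), combStrand_eq (by omega : j + 1 < n), mul_assoc,
      mul_assoc, ← mul_assoc (braidTau _ (j + 1)), ← braidTau_braid (by omega), ← mul_assoc,
      ← mul_assoc, combStrand_comm (by omega)]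
    simp only [mul_assoc]
  · have ih := combStrand_shift (i := i) (j := j + 1) hlt hi
    rw [combStrand_eq (by omega : j < n), mul_assoc, braidTau_comm (by omega), ← mul_assoc, ih,
      mul_assoc]
termination_by n - j

variable (n) in
/-- The pure braid in which the last strand turns once around the strand `j`. -/
def pureStrand (j : ℕ) : BraidGroup (n + 1) :=
  combStrand n (j + 1) * braidTau (n + 1) j ^ 2 * (combStrand n (j + 1))⁻¹

/-- With s = τ_j and t = τ_{j+1} this is s t s² t⁻¹ s⁻¹ = t², conjugated by a braid commuting with
s. -/
theorem pureStrand_succ {j : ℕ} (h : j + 1 < n) :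
    pureStrand n (j + 1) = braidTau (n + 1) j * pureStrand n j * (braidTau (n + 1) j)⁻¹ := by
  have hb := braidTau_braid (N := n + 1) (i := j) (by omega)
  have hc := combStrand_comm (n := n) (i := j) (j := j + 2) (by omega)
  have he := combStrand_eq h
  unfold pureStrand
  rw [he, show j + 1 + 1 = j + 2 from rfl]
  generalize braidTau (n + 1) j = s at *
  generalize braidTau (n + 1) (j + 1) = t at *
  generalize combStrand n (j + 2) = c at *
  have h1 : s * t * s ^ 2 * t⁻¹ * s⁻¹ = t ^ 2 := by
    rw [mul_inv_eq_iff_eq_mul, mul_inv_eq_iff_eq_mul, pow_two, ← mul_assoc, hb, pow_two]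
    simp only [mul_assoc] at hb ⊢
    rw [hb]
  rw [← h1]
  have hc' : s * c = c * s := hc.symm
  have hc'' : c⁻¹ * s⁻¹ = s⁻¹ * c⁻¹ := by rw [← mul_inv_rev, hc', mul_inv_rev]
  rw [mul_inv_rev]
  simp only [mul_assoc]
  rw [hc'']
  simp only [← mul_assoc]
  rw [hc']

/-- The one conjugate of a pure generator by a positive letter that is not again a pure generator.
It reduces to s t² s⁻¹ = t⁻¹ s² t. -/
theorem conj_pureStrand_succ {j : ℕ} (h : j + 1 < n) :
    braidTau (n + 1) j * pureStrand n (j + 1) * (braidTau (n + 1) j)⁻¹ =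
      (pureStrand n (j + 1))⁻¹ * pureStrand n j * pureStrand n (j + 1) := by
  have hb := braidTau_braid (N := n + 1) (i := j) (by omega)
  have hc := combStrand_comm (n := n) (i := j) (j := j + 2) (by omega)
  have he := combStrand_eq h
  unfold pureStrand
  rw [he, show j + 1 + 1 = j + 2 from rfl]
  generalize braidTau (n + 1) j = s at *
  generalize braidTau (n + 1) (j + 1) = t at *
  generalize combStrand n (j + 2) = c at *
  have h1 : s * t ^ 2 * s⁻¹ = t⁻¹ * s ^ 2 * t := by
    rw [mul_inv_eq_iff_eq_mul, mul_assoc, mul_assoc, eq_inv_mul_iff_mul_eq, pow_two, pow_two]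
    simp only [← mul_assoc] at hb ⊢
    rw [← hb, mul_assoc s s t, mul_assoc s (s * t)]
    calc s * t * s * t = s * (t * s * t) := by simp only [mul_assoc]
      _ = _ := by rw [hb]
  have hc' : s * c = c * s := hc.symm
  have hc'' : c⁻¹ * s⁻¹ = s⁻¹ * c⁻¹ := by rw [← mul_inv_rev, hc', mul_inv_rev]
  calc s * (c * t ^ 2 * c⁻¹) * s⁻¹ = (s * c) * t ^ 2 * (c⁻¹ * s⁻¹) := by group
    _ = c * (s * t ^ 2 * s⁻¹) * c⁻¹ := by rw [hc', hc'']; group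
    _ = _ := by rw [h1]; group

/-- Moving τ_i past the conjugating braid turns it into τ_i (if i + 1 < j) or τ_{i+1} (if j < i),
and either one commutes with τ_j. -/
theorem pureStrand_comm {i j : ℕ} (h : i + 1 < j ∨ (j < i ∧ i + 1 < n)) :
    braidTau (n + 1) i * pureStrand n j = pureStrand n j * braidTau (n + 1) i := by
  have key : ∀ s s' c t : BraidGroup (n + 1), s * c = c * s' → s' * t = t * s' →
      s * (c * t ^ 2 * c⁻¹) = c * t ^ 2 * c⁻¹ * s := by
    intro s s' c t h1 h2
    have hs : s = c * s' * c⁻¹ := by rw [← h1]; group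
    have h3 : s' * t ^ 2 = t ^ 2 * s' := ((show Commute s' t from h2).pow_right 2).eq
    calc s * (c * t ^ 2 * c⁻¹) = c * (s' * t ^ 2) * c⁻¹ := by rw [hs]; group
      _ = c * t ^ 2 * c⁻¹ * s := by rw [h3, hs]; group
  rcases h with h | ⟨h, h'⟩
  · exact key _ _ _ _ (combStrand_comm (by omega)).symm (braidTau_comm (by omega))
  · exact key _ _ _ _ (combStrand_shift h h').symm (braidTau_comm (by omega)).symm

variable (n) in
/-- The subgroup generated by the pure braids of the last strand. -/
def pureSubgroup : Subgroup (BraidGroup (n + 1)) :=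
  (FreeGroup.lift fun j : Fin n => pureStrand n j).range

theorem pureStrand_mem {j : ℕ} (h : j < n) : pureStrand n j ∈ pureSubgroup n :=
  ⟨FreeGroup.of ⟨j, h⟩, by simp⟩

theorem conj_mem_pureSubgroup {b : BraidGroup (n + 1)}
    (hb : ∀ j < n, b * pureStrand n j * b⁻¹ ∈ pureSubgroup n) {x : BraidGroup (n + 1)}
    (hx : x ∈ pureSubgroup n) : b * x * b⁻¹ ∈ pureSubgroup n := by
  obtain ⟨w, rfl⟩ := hx
  have h : ∀ w, (MulAut.conj b).toMonoidHom.comp (FreeGroup.lift fun j : Fin n => pureStrand n j) w ∈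
      pureSubgroup n := by
    intro w
    induction w using FreeGroup.induction_on with
    | C1 => simp
    | of i => simpa using hb i i.2
    | inv_of i h => rw [map_inv]; exact inv_mem h
    | mul x y hx hy => rw [map_mul]; exact mul_mem hx hy
  exact h w

/-- Both signs are needed: a subgroup mapped into itself by one conjugation need not be preserved by
the inverse conjugation. -/
theorem braidTau_conj_mem {i : ℕ} (hi : i + 1 < n) {x : BraidGroup (n + 1)}
    (hx : x ∈ pureSubgroup n) :
    braidTau (n + 1) i * x * (braidTau (n + 1) i)⁻¹ ∈ pureSubgroup n ∧
      (braidTau (n + 1) i)⁻¹ * x * braidTau (n + 1) i ∈ pureSubgroup n := by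
  have hA := pureStrand_mem (show i < n by omega)
  have hB := pureStrand_mem hi
  have h1 := pureStrand_succ hi
  have h2 := conj_pureStrand_succ hi
  constructor
  · refine conj_mem_pureSubgroup (fun j hj => ?_) hx
    by_cases h : i + 1 < j ∨ (j < i ∧ i + 1 < n)
    · rw [pureStrand_comm h, mul_inv_cancel_right]; exact pureStrand_mem hj
    · obtain rfl | rfl : j = i ∨ j = i + 1 := by omega
      · rw [← h1]; exact hB
      · rw [h2]; exact mul_mem (mul_mem (inv_mem hB) hA) hB
  · have : (braidTau (n + 1) i)⁻¹ * x * (braidTau (n + 1) i)⁻¹⁻¹ ∈ pureSubgroup n := by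
      refine conj_mem_pureSubgroup (fun j hj => ?_) hx
      rw [inv_inv]
      by_cases h : i + 1 < j ∨ (j < i ∧ i + 1 < n)
      · rw [mul_assoc, ← pureStrand_comm h, inv_mul_cancel_left]; exact pureStrand_mem hj
      · obtain rfl | rfl : j = i ∨ j = i + 1 := by omega
        · have h3 : (braidTau (n + 1) j)⁻¹ * pureStrand n j * braidTau (n + 1) j =
              pureStrand n j * pureStrand n (j + 1) * (pureStrand n j)⁻¹ := by
            -- Solve `h2` for the generator at j. Conjugating the result by τ_j⁻¹ gives the missing
            -- conjugate, because τ_j⁻¹ takes the generator at j + 1 to the one at j.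
            have h4 : pureStrand n j = pureStrand n (j + 1) * (braidTau (n + 1) j *
                pureStrand n (j + 1) * (braidTau (n + 1) j)⁻¹) * (pureStrand n (j + 1))⁻¹ := by
              rw [h2]; group
            have h5 : pureStrand n j = (braidTau (n + 1) j)⁻¹ * pureStrand n (j + 1) *
                braidTau (n + 1) j := by rw [h1]; group
            calc _ = (braidTau (n + 1) j)⁻¹ * (pureStrand n (j + 1) * (braidTau (n + 1) j *
                pureStrand n (j + 1) * (braidTau (n + 1) j)⁻¹) * (pureStrand n (j + 1))⁻¹) *
                braidTau (n + 1) j := by rw [← h4]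
              _ = ((braidTau (n + 1) j)⁻¹ * pureStrand n (j + 1) * braidTau (n + 1) j) *
                pureStrand n (j + 1) * ((braidTau (n + 1) j)⁻¹ * pureStrand n (j + 1) *
                braidTau (n + 1) j)⁻¹ := by group
              _ = _ := by rw [← h5]
          rw [h3]; exact mul_mem (mul_mem hA hB) (inv_mem hA)
        · have h3 : (braidTau (n + 1) i)⁻¹ * pureStrand n (i + 1) * braidTau (n + 1) i =
              pureStrand n i := by rw [h1]; group
          rw [h3]; exact hA
    rwa [inv_inv] at this

variable (n) in
/-- The homomorphism from the braid group which adds a last strand. -/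
def addStrand : BraidGroup n →* BraidGroup (n + 1) :=
  PresentedGroup.toGroup (f := fun i : Fin (n - 1) => braidTau (n + 1) i) (by
    rintro w (⟨i, j, hij, rfl⟩ | ⟨i, j, hij, rfl⟩)
    · rw [map_mul, map_inv, mul_inv_eq_one]
      simp only [map_mul, FreeGroup.lift_apply_of, hij]
      exact braidTau_braid (by omega)
    · rw [map_mul, map_inv, mul_inv_eq_one]
      simp only [map_mul, FreeGroup.lift_apply_of]
      exact braidTau_comm hij)

theorem addStrand_gen (i : Fin (n - 1)) : addStrand n (braidGen i) = braidTau (n + 1) i := by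
  simp [addStrand, braidGen]

theorem addStrand_induction {p : BraidGroup (n + 1) → Prop} (h1 : p 1)
    (hm : ∀ i, i + 1 < n → ∀ b, p b → p (b * braidTau (n + 1) i))
    (hi : ∀ i, i + 1 < n → ∀ b, p b → p (b * (braidTau (n + 1) i)⁻¹)) (b : BraidGroup n) :
    p (addStrand n b) := by
  have h : b ∈ Subgroup.closure (Set.range (PresentedGroup.of (rels := braidRels n))) := by
    rw [PresentedGroup.closure_range_of]; trivial
  induction h using Subgroup.closure_induction_right with
  | one => simpa using h1
  | mul_right x _ y hy ih =>
    obtain ⟨i, rfl⟩ := hy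
    rw [map_mul, show addStrand n (PresentedGroup.of i) = _ from addStrand_gen i]
    exact hm _ (by omega) _ ih
  | mul_inv_cancel x _ y hy ih =>
    obtain ⟨i, rfl⟩ := hy
    rw [map_mul, map_inv, show addStrand n (PresentedGroup.of i) = _ from addStrand_gen i]
    exact hi _ (by omega) _ ih

theorem addStrand_conj_mem (b : BraidGroup n) {x : BraidGroup (n + 1)}
    (hx : x ∈ pureSubgroup n) : (addStrand n b)⁻¹ * x * addStrand n b ∈ pureSubgroup n := by
  refine addStrand_induction (p := fun c => c⁻¹ * x * c ∈ pureSubgroup n) (by simpa using hx)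
    (fun i hi b hb => ?_) (fun i hi b hb => ?_) b
  · have := (braidTau_conj_mem hi hb).2
    simpa [mul_assoc] using this
  · have := (braidTau_conj_mem hi hb).1
    simpa [mul_assoc] using this

theorem braidTau_mem_range {i : ℕ} (h : i + 1 < n) :
    braidTau (n + 1) i ∈ (addStrand n).range :=
  ⟨braidGen ⟨i, by omega⟩, addStrand_gen _⟩

/-- Every braid is the product of a braid on the other strands, a pure braid of the last
strand and one of the braids `τₙ₋₁ ⋯ τⱼ`. -/
theorem exists_combing (b : BraidGroup (n + 1)) :
    ∃ h : BraidGroup n, ∃ x ∈ pureSubgroup n, ∃ j ≤ n, b = addStrand n h * x * combStrand n j := by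
  -- A new factor is absorbed by moving the pure part to the right of the braid on the other
  -- strands, which normalises the pure subgroup.
  have step : ∀ (h : BraidGroup n) (x), x ∈ pureSubgroup n → ∀ (c : BraidGroup (n + 1)),
      (∃ h' : BraidGroup n, ∃ x' ∈ pureSubgroup n, ∃ j ≤ n,
        c = addStrand n h' * x' * combStrand n j) →
      ∃ h' : BraidGroup n, ∃ x' ∈ pureSubgroup n, ∃ j ≤ n,
        addStrand n h * x * c = addStrand n h' * x' * combStrand n j := by
    rintro h x hx _ ⟨h', x', hx', j, hj, rfl⟩
    refine ⟨h * h', ((addStrand n h')⁻¹ * x * addStrand n h') * x',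
      mul_mem (addStrand_conj_mem h' hx) hx', j, hj, ?_⟩
    rw [map_mul]; group
  -- Right multiplication by a generator permutes the cosets. If i is neither j nor j − 1, the
  -- letter slides through; otherwise j moves by one, and for one of the two signs a pure generator
  -- appears.
  have tau : ∀ j ≤ n, ∀ i < n,
      (∃ h' : BraidGroup n, ∃ x' ∈ pureSubgroup n, ∃ l ≤ n,
        combStrand n j * braidTau (n + 1) i = addStrand n h' * x' * combStrand n l) ∧
      (∃ h' : BraidGroup n, ∃ x' ∈ pureSubgroup n, ∃ l ≤ n,
        combStrand n j * (braidTau (n + 1) i)⁻¹ = addStrand n h' * x' * combStrand n l) := by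
    intro j hj i hi
    have comm : ∀ l, l + 1 < n → combStrand n j * braidTau (n + 1) i =
        braidTau (n + 1) l * combStrand n j →
      (∃ h' : BraidGroup n, ∃ x' ∈ pureSubgroup n, ∃ l ≤ n,
        combStrand n j * braidTau (n + 1) i = addStrand n h' * x' * combStrand n l) ∧
      (∃ h' : BraidGroup n, ∃ x' ∈ pureSubgroup n, ∃ l ≤ n,
        combStrand n j * (braidTau (n + 1) i)⁻¹ = addStrand n h' * x' * combStrand n l) := by
      intro l hl h
      obtain ⟨g, hg⟩ := braidTau_mem_range hl
      refine ⟨⟨g, 1, one_mem _, j, hj, by rw [h, hg, mul_one]⟩,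
        ⟨g⁻¹, 1, one_mem _, j, hj, ?_⟩⟩
      rw [map_inv, hg, mul_one, eq_inv_mul_iff_mul_eq, ← mul_assoc, ← h, mul_inv_cancel_right]
    rcases lt_trichotomy i j with hij | rfl | hij
    · by_cases h : i + 1 < j
      · exact comm i (by omega) (combStrand_comm h)
      · obtain rfl : j = i + 1 := by omega
        refine ⟨⟨1, 1, one_mem _, i, hi.le, by rw [combStrand_eq hi]; simp⟩,
          ⟨1, (pureStrand n i)⁻¹, inv_mem (pureStrand_mem hi), i, hi.le, ?_⟩⟩
        rw [combStrand_eq hi, pureStrand]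
        simp [pow_two, mul_assoc]
    · refine ⟨⟨1, pureStrand n i, pureStrand_mem hi, i + 1, hi, ?_⟩,
        ⟨1, 1, one_mem _, i + 1, hi, by rw [combStrand_eq hi]; simp⟩⟩
      rw [combStrand_eq hi, pureStrand]
      simp [pow_two, mul_assoc]
    · obtain ⟨i, rfl⟩ : ∃ m, i = m + 1 := ⟨i - 1, by omega⟩
      exact comm i hi (combStrand_shift (by omega) hi)
  have hb : b ∈ Subgroup.closure (Set.range (braidTau (n + 1))) := by
    rw [closure_braidTau]; trivial
  induction hb using Subgroup.closure_induction_right with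
  | one => exact ⟨1, 1, one_mem _, n, le_rfl, by simp [combStrand_of_le]⟩
  | mul_right b _ y hy ih =>
    obtain ⟨h, x, hx, j, hj, rfl⟩ := ih
    obtain ⟨i, rfl⟩ := hy
    by_cases hi : i < n
    · rw [mul_assoc _ (combStrand n j)]; exact step _ _ hx _ (tau j hj i hi).1
    · exact ⟨h, x, hx, j, hj, by simp [braidTau, hi]⟩
  | mul_inv_cancel b _ y hy ih =>
    obtain ⟨h, x, hx, j, hj, rfl⟩ := ih
    obtain ⟨i, rfl⟩ := hy
    by_cases hi : i < n
    · rw [mul_assoc _ (combStrand n j)]; exact step _ _ hx _ (tau j hj i hi).2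
    · exact ⟨h, x, hx, j, hj, by simp [braidTau, hi]⟩

/-! The action on tuples. -/

theorem hurwitz_braidTau {N i : ℕ} (h : i + 1 < N) (x : Fin N → G) (l : Fin N) :
    hurwitz G N (braidTau N i) x l =
      if l.val = i then x ⟨i, by omega⟩ * x ⟨i + 1, h⟩ * (x ⟨i, by omega⟩)⁻¹
      else if l.val = i + 1 then x ⟨i, by omega⟩ else x l := by
  rw [braidTau_of_lt (by omega), hurwitz_gen]
  simp [hurwitzMove, lo, hi, Fin.ext_iff]

theorem hurwitz_combStrand_last {j : ℕ} (hj : j ≤ n) (x : Fin (n + 1) → G) :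
    hurwitz G (n + 1) (combStrand n j) x (Fin.last n) = x ⟨j, by omega⟩ := by
  obtain rfl | hlt := hj.eq_or_lt
  · simp [combStrand_of_le]; rfl
  · rw [combStrand_eq hlt, map_mul, Equiv.Perm.mul_apply, hurwitz_combStrand_last (j := j + 1) hlt,
      hurwitz_braidTau (by omega)]
    simp
termination_by n - j

theorem hurwitz_combStrand_of_lt {j : ℕ} (x : Fin (n + 1) → G) (l : Fin (n + 1))
    (h : l.val < j) : hurwitz G (n + 1) (combStrand n j) x l = x l := by
  obtain hj | hlt := le_or_gt n j
  · simp [combStrand_of_le hj]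
  · rw [combStrand_eq hlt, map_mul, Equiv.Perm.mul_apply, hurwitz_combStrand_of_lt (j := j + 1) _ _
      (by omega), hurwitz_braidTau (by omega), if_neg (by omega), if_neg (by omega)]
termination_by n - j

theorem hurwitz_pureStrand_last {j : ℕ} (hj : j < n) (x : Fin (n + 1) → G) :
    hurwitz G (n + 1) (pureStrand n j) x (Fin.last n) =
      x ⟨j, by omega⟩ * x (Fin.last n) * (x ⟨j, by omega⟩)⁻¹ := by
  -- Writing the tuple as an image of the conjugating braid cancels one half of the conjugation and
  -- leaves τ_j² acting on adjacent entries.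
  obtain ⟨y, rfl⟩ := (hurwitz G (n + 1) (combStrand n (j + 1))).surjective x
  rw [← Equiv.Perm.mul_apply, ← map_mul, pureStrand, inv_mul_cancel_right, map_mul,
    Equiv.Perm.mul_apply, hurwitz_combStrand_last hj, hurwitz_combStrand_last hj,
    hurwitz_combStrand_of_lt _ _ (by simp), pow_two, map_mul, Equiv.Perm.mul_apply,
    hurwitz_braidTau (by omega), if_neg (by simp), if_pos rfl, hurwitz_braidTau (by omega),
    if_pos rfl]

/-- A full turn conjugates both entries by their product, hence is invisible if they commute. This
makes pure braids disappear when the group is commutative or the last entry is 1. -/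
theorem hurwitz_pureStrand_of_commute {j : ℕ} (hj : j < n) (x : Fin (n + 1) → G)
    (h : Commute (x ⟨j, by omega⟩) (x (Fin.last n))) :
    hurwitz G (n + 1) (pureStrand n j) x = x := by
  obtain ⟨y, rfl⟩ := (hurwitz G (n + 1) (combStrand n (j + 1))).surjective x
  rw [hurwitz_combStrand_last hj, hurwitz_combStrand_of_lt _ _ (by simp)] at h
  rw [← Equiv.Perm.mul_apply, ← map_mul, pureStrand, inv_mul_cancel_right, map_mul,
    Equiv.Perm.mul_apply]
  congr 1
  have h1 := h.eq
  funext l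
  rw [pow_two, map_mul, Equiv.Perm.mul_apply]
  simp only [hurwitz_braidTau (show j + 1 < n + 1 by omega)]
  have h2 : y ⟨j, by omega⟩ * y ⟨j + 1, by omega⟩ * (y ⟨j, by omega⟩)⁻¹ = y ⟨j + 1, by omega⟩ := by
    rw [h1, mul_inv_cancel_right]
  by_cases e1 : l.val = j
  · rw [show l = ⟨j, by omega⟩ from Fin.ext e1]
    simp [h2, ← h1]
  · by_cases e2 : l.val = j + 1
    · rw [show l = ⟨j + 1, by omega⟩ from Fin.ext e2]
      simp [h2]
    · simp [e1, e2]

theorem hurwitz_addStrand (b : BraidGroup n) (x : Fin (n + 1) → G) :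
    hurwitz G (n + 1) (addStrand n b) x =
      Fin.snoc (α := fun _ => G) (hurwitz G n b (Fin.init x)) (x (Fin.last n)) := by
  have h : b ∈ Subgroup.closure (Set.range (PresentedGroup.of (rels := braidRels n))) := by
    rw [PresentedGroup.closure_range_of]; trivial
  induction h using Subgroup.closure_induction generalizing x with
  | mem b hb =>
    obtain ⟨i, rfl⟩ := hb
    change hurwitz G (n + 1) (addStrand n (braidGen i)) x =
      Fin.snoc (α := fun _ => G) (hurwitz G n (braidGen i) (Fin.init x)) (x (Fin.last n))
    rw [addStrand_gen, hurwitz_gen]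
    funext l
    have hi' := i.2
    rw [hurwitz_braidTau (by omega)]
    induction l using Fin.lastCases with
    | last =>
      rw [Fin.snoc_last, if_neg (by simp; omega), if_neg (by simp; omega)]
    | cast l =>
      rw [Fin.snoc_castSucc]
      simp only [hurwitzMove, lo, hi, Fin.ext_iff, Fin.val_castSucc]
      rfl
  | one => simp
  | mul a b _ _ ha hb => simp [map_mul, Equiv.Perm.mul_apply, hb, ha]
  | inv a _ ha =>
    rw [map_inv, map_inv, map_inv, Equiv.Perm.inv_eq_iff_eq, ha]
    simp

theorem hurwitz_pure_of_commGroup {H : Type*} [CommGroup H] {b : BraidGroup (n + 1)}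
    (hb : b ∈ pureSubgroup n) (x : Fin (n + 1) → H) : hurwitz H (n + 1) b x = x := by
  obtain ⟨w, rfl⟩ := hb
  induction w using FreeGroup.induction_on generalizing x with
  | C1 => simp
  | of i => simpa using hurwitz_pureStrand_of_commute i.2 x (Commute.all _ _)
  | inv_of i h => rw [map_inv, map_inv, Equiv.Perm.inv_eq_iff_eq, h]
  | mul a b ha hb => rw [map_mul, map_mul, Equiv.Perm.mul_apply, hb, ha]

theorem hurwitz_pure_of_last {b : BraidGroup (n + 1)} (hb : b ∈ pureSubgroup n)
    (x : Fin (n + 1) → G) (hx : x (Fin.last n) = 1) : hurwitz G (n + 1) b x = x := by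
  obtain ⟨w, rfl⟩ := hb
  induction w using FreeGroup.induction_on with
  | C1 => simp
  | of i => simpa using hurwitz_pureStrand_of_commute i.2 x (by rw [hx]; exact Commute.one_right _)
  | inv_of i h => rw [map_inv, map_inv, Equiv.Perm.inv_eq_iff_eq, h]
  | mul a b ha hb => rw [map_mul, map_mul, Equiv.Perm.mul_apply, hb, ha]

/-- If the last entry of a tuple lies in the commutative kernel of a homomorphism, pure braids of
the last strand conjugate it by the corresponding word in the other entries. -/
theorem hurwitz_pure_last {Q : Type*} [Group Q] (p : G →* Q)
    (hp : ∀ a b : G, p a = 1 → p b = 1 → a * b = b * a) (w : FreeGroup (Fin n))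
    (x : Fin (n + 1) → G) (hx : p (x (Fin.last n)) = 1) :
    hurwitz G (n + 1) (FreeGroup.lift (fun j : Fin n => pureStrand n j) w) x (Fin.last n) =
      FreeGroup.lift (fun j : Fin n => x j.castSucc) w * x (Fin.last n) *
        (FreeGroup.lift (fun j : Fin n => x j.castSucc) w)⁻¹ := by
  -- Conjugation on the commutative kernel of p depends only on the image under p.
  have hconj : ∀ a b v : G, p a = p b → p v = 1 → a * v * a⁻¹ = b * v * b⁻¹ := by
    intro a b v hab hv
    have := hp (b⁻¹ * a) v (by simp [hab]) hv
    have h1 : a * v = b * (b⁻¹ * a * v) := by group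
    rw [h1, this]; group
  -- Modulo the kernel the last entry is trivial, so pure braids fix the tuple there. The other
  -- entries may change, but only by elements that do not affect the conjugation.
  have hmod : ∀ (w : FreeGroup (Fin n)) (y : Fin (n + 1) → G), p (y (Fin.last n)) = 1 →
      ∀ l, p (hurwitz G (n + 1) (FreeGroup.lift (fun j : Fin n => pureStrand n j) w) y l) =
        p (y l) := by
    intro w y hy l
    have := hurwitz_map p (FreeGroup.lift (fun j : Fin n => pureStrand n j) w) y
    rw [hurwitz_pure_of_last ⟨w, rfl⟩ (p ∘ y) hy] at this
    exact (congrFun this l).symm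
  have hlift : ∀ (w : FreeGroup (Fin n)) (y y' : Fin (n + 1) → G), (∀ l, p (y l) = p (y' l)) →
      p (FreeGroup.lift (fun j : Fin n => y j.castSucc) w) =
        p (FreeGroup.lift (fun j : Fin n => y' j.castSucc) w) := by
    intro w y y' h
    have h1 : ∀ y : Fin (n + 1) → G, p (FreeGroup.lift (fun j : Fin n => y j.castSucc) w) =
        FreeGroup.lift (fun j : Fin n => p (y j.castSucc)) w := by
      intro y
      induction w using FreeGroup.induction_on with
      | C1 => simp
      | of => simp
      | inv_of => simp
      | mul _ _ h h' => simp only [map_mul, h, h']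
    rw [h1, h1]; simp only [h]
  induction w using FreeGroup.induction_on generalizing x with
  | C1 => simp
  | of i =>
    rw [FreeGroup.lift_apply_of, FreeGroup.lift_apply_of]
    exact hurwitz_pureStrand_last i.2 x
  | inv_of i _ =>
    set b := FreeGroup.lift (fun j : Fin n => pureStrand n j) (FreeGroup.of i)⁻¹ with hb
    set y := hurwitz G (n + 1) b x with hy
    have hyl : p (y (Fin.last n)) = 1 := by rw [hy, hb, hmod _ _ hx, hx]
    have hxy : x = hurwitz G (n + 1) (pureStrand n i) y := by
      rw [hy, ← Equiv.Perm.mul_apply, ← map_mul, hb]; simp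
    have h1 := hurwitz_pureStrand_last i.2 y
    rw [← hxy] at h1
    rw [hconj _ (y i.castSucc)⁻¹ _ ?_ hx, h1]
    · change _ = (y i.castSucc)⁻¹ * (y i.castSucc * y (Fin.last n) * (y i.castSucc)⁻¹) *
        (y i.castSucc)⁻¹⁻¹
      group
    · have := hmod (FreeGroup.of i)⁻¹ x hx i.castSucc
      simp only [map_inv, FreeGroup.lift_apply_of, inv_inj, hy, hb] at this ⊢
      exact this.symm
  | mul a b ha hb =>
    rw [map_mul, map_mul, Equiv.Perm.mul_apply, ha _ (by rw [hmod _ _ hx, hx]), hb x hx, map_mul]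
    rw [hconj _ (FreeGroup.lift (fun j : Fin n => x j.castSucc) a) _
      (hlift _ _ _ fun l => hmod b x hx l)]
    · group
    · simp [hx]

open RegularWreathProduct in
/-- The Hurwitz action on the standard generators of the free group is free. -/
theorem hurwitz_faithful (n : ℕ) (b : BraidGroup n)
    (hb : hurwitz (FreeGroup (Fin n)) n b (fun i => FreeGroup.of i) = fun i => FreeGroup.of i) :
    b = 1 := by
  induction n with
  | zero =>
    have h : b ∈ Subgroup.closure (Set.range (PresentedGroup.of (rels := braidRels 0))) := by
      rw [PresentedGroup.closure_range_of]; trivial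
    have : IsEmpty (Fin (0 - 1)) := Fin.isEmpty
    rwa [Set.range_eq_empty, Subgroup.closure_empty, Subgroup.mem_bot] at h
  | succ n ih =>
    -- Every tuple is the image of the free generators under a homomorphism.
    have hfix : ∀ {H : Type} [Group H] (y : Fin (n + 1) → H), hurwitz H (n + 1) b y = y := by
      intro H _ y
      have := hurwitz_map (FreeGroup.lift y) b (fun i => FreeGroup.of i)
      rw [hb] at this
      simpa [Function.comp_def] using this
    obtain ⟨h, x, hx, j, hj, rfl⟩ := exists_combing b
    -- In a commutative group the action only permutes entries. Marking the last entry shows that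
    -- the last strand ends in its own place.
    obtain rfl : j = n := by
      by_contra hne
      have := congrFun (hfix (H := Multiplicative ℤ) fun l =>
        if l = Fin.last n then Multiplicative.ofAdd 1 else 1) (Fin.last n)
      rw [map_mul, map_mul, Equiv.Perm.mul_apply, Equiv.Perm.mul_apply, hurwitz_addStrand,
        Fin.snoc_last, hurwitz_pure_of_commGroup hx, hurwitz_combStrand_last hj] at this
      rw [if_neg (by simp [Fin.ext_iff, hne]), if_pos rfl] at this
      exact absurd this (by decide)
    rw [combStrand_of_le le_rfl, mul_one] at hfix ⊢
    have hh : h = 1 := by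
      refine ih h ?_
      -- With last entry 1 the pure part acts trivially, and the induction hypothesis applies to the
      -- remaining strands.
      have := hfix (Fin.snoc (α := fun _ => FreeGroup (Fin j)) (fun i => FreeGroup.of i) 1)
      rw [map_mul, Equiv.Perm.mul_apply, hurwitz_pure_of_last hx _ (by simp), hurwitz_addStrand]
        at this
      have := congrArg Fin.init this
      simpa using this
    subst hh
    rw [map_one, one_mul] at hfix ⊢
    obtain ⟨w, rfl⟩ := hx
    suffices hw : w = 1 by rw [hw, map_one]
    -- The last entry is the delta function at 1 in the commutative base group. The pure braid of w
    -- translates it to the delta function at w, so w = 1.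
    let y : Fin (j + 1) → Multiplicative ℤ ≀ᵣ FreeGroup (Fin j) :=
      Fin.snoc (α := fun _ => Multiplicative ℤ ≀ᵣ FreeGroup (Fin j))
        (fun i => inl (FreeGroup.of i)) ⟨fun q => if q = 1 then Multiplicative.ofAdd 1 else 1, 1⟩
    have hl := hurwitz_pure_last (rightHom : Multiplicative ℤ ≀ᵣ FreeGroup (Fin j) →* _) (by
      intro a b ha hb
      change a.right = 1 at ha
      change b.right = 1 at hb
      ext q
      · simp [ha, hb, mul_comm]
      · simp [ha, hb]) w y (by simp [y])
    rw [hfix y] at hl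
    have hinl : FreeGroup.lift (fun i : Fin j => y i.castSucc) w = inl w := by
      have : FreeGroup.lift (fun i : Fin j => y i.castSucc) =
          (inl : FreeGroup (Fin j) →* Multiplicative ℤ ≀ᵣ FreeGroup (Fin j)) := by
        ext i <;> simp [y]
      rw [this]
    rw [hinl] at hl
    have h1 := congrFun (congrArg RegularWreathProduct.left hl) w
    by_contra hne
    simp [y, hne] at h1
    exact absurd h1 (by decide)

end Faithful

/-! ### Transitivity of the Hurwitz action on reflection expressions -/

section Transitive

open FreeGroup

variable {α : Type*}

theorem toWord_mul_of_isReduced [DecidableEq α] {g h : FreeGroup α} (H : IsReduced (g.toWord ++ h.toWord)) :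
    (g * h).toWord = g.toWord ++ h.toWord := by
  rw [toWord_mul, H.reduce_eq]

/-- Two reduced words can be concatenated if the last letter of the first one and the first letter
of the second one do not cancel. -/
theorem isReduced_append_iff {l l' : List (α × Bool)} (h : IsReduced l) (h' : IsReduced l') :
    IsReduced (l ++ l') ↔ ∀ x ∈ l.getLast?, ∀ y ∈ l'.head?, x.1 = y.1 → x.2 = y.2 := by
  unfold FreeGroup.IsReduced at *
  rw [List.isChain_append]
  exact ⟨fun H => H.2.2, fun H => ⟨h, h', H⟩⟩

variable [DecidableEq α]

theorem head?_toWord_inv (g : FreeGroup α) :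
    g⁻¹.toWord.head? = g.toWord.getLast?.map fun x => (x.1, !x.2) := by
  rw [toWord_inv, invRev, List.head?_reverse, List.getLast?_map]

theorem getLast?_toWord_inv (g : FreeGroup α) :
    g⁻¹.toWord.getLast? = g.toWord.head?.map fun x => (x.1, !x.2) := by
  rw [toWord_inv, invRev, List.getLast?_reverse, List.head?_map]

theorem norm_mul_lt_of_mem_getLast? {g : FreeGroup α} {a : α} {c : Bool}
    (h : (a, c) ∈ g.toWord.getLast?) :
    FreeGroup.norm (g * mk [(a, !c)]) < FreeGroup.norm g := by
  obtain ⟨l, hl⟩ : ∃ l, g.toWord = l ++ [(a, c)] := by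
    rw [Option.mem_def, List.getLast?_eq_some_iff] at h
    exact h
  have h1 : g * mk [(a, !c)] = mk l := by
    rw [← mk_toWord (x := g), hl, mul_mk, List.append_assoc]
    exact Quot.sound (by simpa using Red.Step.not (L₁ := l) (L₂ := []) (x := a) (b := c))
  rw [h1, FreeGroup.norm, FreeGroup.norm, hl]
  exact lt_of_le_of_lt norm_mk_le (by simp)

theorem norm_mul_lt_of_mem_head? {g : FreeGroup α} {a : α} {c : Bool}
    (h : (a, c) ∈ g.toWord.head?) :
    FreeGroup.norm (mk [(a, !c)] * g) < FreeGroup.norm g := by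
  have := norm_mul_lt_of_mem_getLast? (g := g⁻¹) (a := a) (c := !c)
    (by rw [getLast?_toWord_inv]; simpa using h)
  rw [norm_inv_eq, ← norm_inv_eq, mul_inv_rev, inv_inv] at this
  simpa [inv_mk, invRev] using this

variable {n : ℕ}

/-- The reflection `g σₐ g⁻¹`. -/
def reflection (p : FreeGroup (Fin n) × Fin n) : FreeGroup (Fin n) := p.1 * of p.2 * p.1⁻¹

/-- No cancellation takes place at the central letter of the reflection `g σₐ g⁻¹`. -/
def IsTight (p : FreeGroup (Fin n) × Fin n) : Prop := ∀ c, (p.2, c) ∉ p.1.toWord.getLast?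

/-- The central letters of two reflections survive in their product. -/
def Separated (p q : FreeGroup (Fin n) × Fin n) : Prop :=
  (p.2, false) ∉ (p.1⁻¹ * q.1).toWord.head? ∧ (q.2, false) ∉ (p.1⁻¹ * q.1).toWord.getLast?

/-- Removing the first conjugator leaves the word σ_p · (p⁻¹q) · (rest), whose three pieces join
without cancellation: the rest begins with the positive letter σ_q, and `Separated` excludes the
inverse letters next to it and to σ_p. Each factor therefore contributes its central letter, and any
further length comes from conjugators. Tracking the first letter keeps the induction going. -/
theorem norm_prod_reflection (p : FreeGroup (Fin n) × Fin n) (L : List (FreeGroup (Fin n) × Fin n))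
    (ht : ∀ q ∈ p :: L, IsTight q) (hc : List.IsChain Separated (p :: L)) :
    (p.2, true) ∈ (p.1⁻¹ * ((p :: L).map reflection).prod).toWord.head? ∧
    (p :: L).length ≤ FreeGroup.norm (p.1⁻¹ * ((p :: L).map reflection).prod) ∧
    (FreeGroup.norm (p.1⁻¹ * ((p :: L).map reflection).prod) = (p :: L).length → ∀ q ∈ p :: L, q.1 = 1) := by
  induction L generalizing p with
  | nil =>
    have h1 : p.1⁻¹ * ([p].map reflection).prod = of p.2 * p.1⁻¹ := by
      simp [reflection, mul_assoc]
    have h2 : (of p.2 * p.1⁻¹).toWord = [(p.2, true)] ++ p.1⁻¹.toWord := by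
      rw [← toWord_of]
      refine toWord_mul_of_isReduced ((isReduced_append_iff isReduced_toWord isReduced_toWord).2 ?_)
      rintro x hx y hy hxy
      rw [toWord_of] at hx
      simp only [List.getLast?_singleton, Option.mem_def, Option.some.injEq] at hx
      subst hx
      rw [head?_toWord_inv] at hy
      simp only [Option.mem_def, Option.map_eq_some_iff] at hy
      obtain ⟨z, hz, rfl⟩ := hy
      exact absurd (show (p.2, z.2) ∈ p.1.toWord.getLast? by
        rw [show p.2 = z.1 from hxy]; exact hz) (ht p (by simp) _)
    rw [h1]
    refine ⟨by rw [h2]; simp, by rw [FreeGroup.norm, h2]; simp, fun h => ?_⟩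
    rw [FreeGroup.norm, h2] at h
    have h3 : p.1⁻¹.toWord = [] := List.length_eq_zero_iff.1 (by simpa only [List.length_append, List.length_cons,
      List.length_nil, zero_add, Nat.add_eq_left] using h)
    simpa using toWord_eq_nil_iff.1 h3
  | cons q L ih =>
    obtain ⟨h1, h2, h3⟩ := ih q (fun q' hq' => ht q' (by simp_all)) hc.tail
    set w := q.1⁻¹ * ((q :: L).map reflection).prod with hw
    have hs : Separated p q := by simpa using (List.isChain_cons_cons.1 hc).1
    set u := p.1⁻¹ * q.1 with hu
    have e1 : p.1⁻¹ * ((p :: q :: L).map reflection).prod = of p.2 * (u * w) := by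
      rw [List.map_cons, List.prod_cons, reflection, hu, hw]; group
    have huw : (u * w).toWord = u.toWord ++ w.toWord := by
      refine toWord_mul_of_isReduced ((isReduced_append_iff isReduced_toWord isReduced_toWord).2 ?_)
      rintro ⟨x, b⟩ hx y hy hxy
      rw [Option.mem_unique hy h1] at hxy ⊢
      cases b
      · rw [show x = q.2 from hxy] at hx
        exact absurd hx hs.2
      · rfl
    have hauw : (of p.2 * (u * w)).toWord = [(p.2, true)] ++ (u.toWord ++ w.toWord) := by
      rw [← toWord_of, ← huw]
      refine toWord_mul_of_isReduced ((isReduced_append_iff isReduced_toWord isReduced_toWord).2 ?_)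
      rintro x hx ⟨y, b⟩ hy hxy
      rw [toWord_of] at hx
      simp only [List.getLast?_singleton, Option.mem_def, Option.some.injEq] at hx
      subst hx
      cases b
      · exfalso
        rw [huw, List.head?_append] at hy
        rcases hu' : u.toWord.head? with _ | z
        · rw [hu', Option.none_or] at hy
          have := Option.mem_unique hy h1
          simp at this
        · rw [hu', Option.some_or, Option.mem_some_iff] at hy
          subst hy
          exact hs.1 (by rw [hu', show p.2 = y from hxy]; simp)
      · rfl
    rw [e1]
    have hn : FreeGroup.norm (of p.2 * (u * w)) = 1 + (FreeGroup.norm u + FreeGroup.norm w) := by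
      rw [FreeGroup.norm, hauw]; simp [FreeGroup.norm]; omega
    refine ⟨by rw [hauw]; simp, by rw [hn]; simp at h2 ⊢; omega, fun h => ?_⟩
    rw [hn] at h
    simp only [List.length_cons] at h h2 h3
    have hall := h3 (by omega)
    have hu0 : u = 1 := norm_eq_zero.1 (by omega)
    intro q' hq'
    rcases List.mem_cons.1 hq' with rfl | hq'
    · have hq1 := hall q (by simp)
      rw [hu, hq1, mul_one, inv_eq_one] at hu0
      exact hu0
    · exact hall q' hq'

/-- The Coxeter element has length at most n. Tightness of the first entry also makes its conjugator
add to the length, so the lower bound n is attained and every conjugator is trivial. -/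
theorem eq_one_of_separated (p : Fin n → FreeGroup (Fin n) × Fin n)
    (hp : (List.ofFn fun i => reflection (p i)).prod = coxeter n)
    (ht : ∀ i, IsTight (p i))
    (hs : ∀ i : ℕ, ∀ h : i + 1 < n, Separated (p ⟨i, by omega⟩) (p ⟨i + 1, h⟩)) (i : Fin n) :
    (p i).1 = 1 := by
  have hcox : FreeGroup.norm (coxeter n) ≤ n := by
    have : ∀ L : List (Fin n), FreeGroup.norm (L.map (of (α := Fin n))).prod ≤ L.length := by
      intro L
      induction L with
      | nil => simp
      | cons a L ih =>
        rw [List.map_cons, List.prod_cons, List.length_cons]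
        exact (FreeGroup.norm_mul_le _ _).trans (by rw [norm_of]; omega)
    have := this (List.ofFn id)
    rw [List.map_ofFn] at this
    simpa [coxeter] using this
  obtain ⟨q, L, hL⟩ : ∃ q L, List.ofFn p = q :: L := by
    rcases h : List.ofFn p with _ | ⟨q, L⟩
    · have := congrArg List.length h
      simp only [List.length_ofFn, List.length_nil] at this
      exact absurd i.2 (by omega)
    · exact ⟨q, L, rfl⟩
  have hlen : (q :: L).length = n := by rw [← hL]; simp
  have ht' : ∀ q' ∈ q :: L, IsTight q' := by
    rw [← hL]
    intro q' hq'
    obtain ⟨j, rfl⟩ := (List.mem_ofFn' _ _).1 hq'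
    exact ht j
  have hc : List.IsChain Separated (q :: L) := by
    rw [← hL, List.isChain_ofFn]
    exact hs
  obtain ⟨h1, h2, h3⟩ := norm_prod_reflection q L ht' hc
  have hprod : ((q :: L).map reflection).prod = coxeter n := by
    rw [← hL, List.map_ofFn]; exact hp
  rw [hprod] at h1 h2 h3
  have hadd : FreeGroup.norm (q.1 * (q.1⁻¹ * coxeter n)) = FreeGroup.norm q.1 + FreeGroup.norm (q.1⁻¹ * coxeter n) := by
    rw [FreeGroup.norm, toWord_mul_of_isReduced ((isReduced_append_iff isReduced_toWord isReduced_toWord).2 ?_),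
      List.length_append]
    · rfl
    rintro ⟨x, b⟩ hx y hy hxy
    rw [Option.mem_unique hy h1] at hxy ⊢
    rw [show x = q.2 from hxy] at hx
    exact absurd hx (ht' q (by simp) _)
  rw [mul_inv_cancel_left] at hadd
  refine h3 (by omega) _ ?_
  rw [← hL]
  exact (List.mem_ofFn' _ _).2 ⟨i, rfl⟩

/-- A product of positive generators is already a reduced word, from which its letters can be read
off. -/
theorem index_eq_of_prod_eq (a : Fin n → Fin n)
    (h : (List.ofFn fun i => of (a i)).prod = coxeter n) (i : Fin n) : a i = i := by
  have key : ∀ L : List (Fin n), (L.map (of (α := Fin n))).prod.toWord = L.map fun x => (x, true) := by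
    intro L
    have h1 : (L.map (of (α := Fin n))).prod = mk (L.map fun x => (x, true)) := by
      induction L with
      | nil => rfl
      | cons a L ih => rw [List.map_cons, List.prod_cons, ih]; rfl
    rw [h1, toWord_mk]
    apply IsReduced.reduce_eq
    unfold FreeGroup.IsReduced
    rw [List.isChain_map]
    exact List.Pairwise.isChain (List.pairwise_of_forall (by simp))
  have h1 := congrArg toWord h
  have e1 := key (List.ofFn a)
  have e2 := key (List.ofFn id)
  rw [List.map_ofFn, List.map_ofFn] at e1 e2
  change (List.ofFn fun i => of (a i)).prod.toWord = _ at e1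
  change (coxeter n).toWord = _ at e2
  rw [e1, e2] at h1
  have := congrFun (List.ofFn_injective h1) i
  simpa using this

/-- Induction on the total length of the conjugators. The conjugators are part of the data, since
the same reflection has many of them. -/
theorem exists_hurwitz_eq (p : Fin n → FreeGroup (Fin n) × Fin n)
    (hp : (List.ofFn fun i => reflection (p i)).prod = coxeter n) :
    ∃ β : BraidGroup n, hurwitz _ n β (fun i => of i) = fun i => reflection (p i) := by
  induction hN : ∑ i, FreeGroup.norm (p i).1 using Nat.strong_induction_on generalizing p with
  | h N ih =>
  subst hN
  have hmove : ∀ (i : Fin (n - 1)) (x : Fin n → FreeGroup (Fin n)),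
      (List.ofFn (hurwitzMove i x)).prod = (List.ofFn x).prod := by
    intro i x
    have hne := hi_ne_lo i
    refine prod_ofFn_congr n i.val (by omega) _ _ (fun j h1 h2 => ?_) ?_
    · have h1' : j ≠ lo i := fun h => h1 (by rw [h]; rfl)
      have h2' : j ≠ hi i := fun h => h2 (by rw [h]; rfl)
      simp [hurwitzMove, h1', h2']
    · change hurwitzMove i x (lo i) * hurwitzMove i x (hi i) = x (lo i) * x (hi i)
      simp [hurwitzMove, hne]
  by_cases ht : ∀ i, IsTight (p i)
  swap
  · push Not at ht
    obtain ⟨i, hi⟩ := ht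
    unfold IsTight at hi
    push Not at hi
    obtain ⟨c, hc⟩ := hi
    have hlt := norm_mul_lt_of_mem_getLast? hc
    -- A final letter σ_a^{±1} of the conjugator commutes with the central letter σ_a and can be
    -- deleted.
    let p' := Function.update p i ((p i).1 * mk [((p i).2, !c)], (p i).2)
    have hr : (fun j => reflection (p' j)) = fun j => reflection (p j) := by
      funext j
      by_cases hj : j = i
      · subst hj
        simp only [p', Function.update_self, reflection]
        cases c
        · change _ * of (p j).2 * of (p j).2 * (_ * of (p j).2)⁻¹ = _
          group
        · change _ * (of (p j).2)⁻¹ * of (p j).2 * (_ * (of (p j).2)⁻¹)⁻¹ = _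
          group
      · simp [p', hj]
    rw [← hr]
    refine ih _ ?_ p' (by rw [hr]; exact hp) rfl
    refine Finset.sum_lt_sum (fun j _ => ?_) ⟨i, Finset.mem_univ _, by simpa [p'] using hlt⟩
    by_cases hj : j = i
    · subst hj; simpa [p'] using hlt.le
    · simp [p', hj]
  by_cases hs : ∀ i : ℕ, ∀ h : i + 1 < n, Separated (p ⟨i, by omega⟩) (p ⟨i + 1, h⟩)
  · have h1 := eq_one_of_separated p hp ht hs
    have h2 : (fun i => reflection (p i)) = fun i => of (p i).2 := by
      funext i; simp [reflection, h1]
    rw [h2] at hp ⊢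
    refine ⟨1, ?_⟩
    simp [index_eq_of_prod_eq _ hp]
  push Not at hs
  obtain ⟨i, hi, hs⟩ := hs
  set l : Fin (n - 1) := ⟨i, by omega⟩ with hl
  have hne := hi_ne_lo l
  have sum_eq : ∀ q : Fin n → FreeGroup (Fin n) × Fin n, (∀ j, j ≠ lo l → j ≠ ZigzagFree.hi l → q j = p j) →
      FreeGroup.norm (q (lo l)).1 + FreeGroup.norm (q (ZigzagFree.hi l)).1 <
        FreeGroup.norm (p (lo l)).1 + FreeGroup.norm (p (ZigzagFree.hi l)).1 →
      ∑ j, FreeGroup.norm (q j).1 < ∑ j, FreeGroup.norm (p j).1 := by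
    intro q hq hlt
    have hmem : ZigzagFree.hi l ∈ Finset.univ.erase (lo l) := by simp [hne]
    rw [← Finset.add_sum_erase _ _ (Finset.mem_univ (lo l)), ← Finset.add_sum_erase _ _ hmem,
      ← Finset.add_sum_erase _ (fun j => FreeGroup.norm (p j).1) (Finset.mem_univ (lo l)),
      ← Finset.add_sum_erase _ (fun j => FreeGroup.norm (p j).1) hmem]
    rw [Finset.sum_congr rfl fun j hj => by
      simp only [Finset.mem_erase, Finset.mem_univ, and_true] at hj
      rw [hq j hj.2 hj.1]]
    omega
  change ¬ Separated (p (lo l)) (p (ZigzagFree.hi l)) at hs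
  set P := p (lo l) with hP
  set Q := p (ZigzagFree.hi l) with hQ
  unfold Separated at hs
  rw [not_and_or, not_not, not_not] at hs
  rcases hs with hs | hs
  -- Here P⁻¹Q begins with σ_P⁻¹. Since P is tight, Q = P · (P⁻¹Q) is reduced, so conjugating the
  -- second reflection by the first shortens Q by turning it into Pσ_P(P⁻¹Q).
  · have hadd : FreeGroup.norm Q.1 = FreeGroup.norm P.1 + FreeGroup.norm (P.1⁻¹ * Q.1) := by
      conv_lhs => rw [← mul_inv_cancel_left P.1 Q.1]
      rw [FreeGroup.norm, toWord_mul_of_isReduced ((isReduced_append_iff isReduced_toWord isReduced_toWord).2 ?_),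
        List.length_append]
      · rfl
      rintro ⟨x, b⟩ hx y hy hxy
      rw [Option.mem_unique hy hs] at hxy ⊢
      rw [show x = P.2 from hxy] at hx
      exact absurd hx (ht _ _)
    have hlt := norm_mul_lt_of_mem_head? hs
    let q : Fin n → FreeGroup (Fin n) × Fin n := fun j =>
      if j = lo l then (P.1 * of P.2 * (P.1⁻¹ * Q.1), Q.2) else
        if j = ZigzagFree.hi l then P else p j
    have hq : (fun j => reflection (q j)) = hurwitzMove l (fun j => reflection (p j)) := by
      funext j
      simp only [q, hurwitzMove]
      split_ifs with h1 h2
      · change _ = reflection P * reflection Q * (reflection P)⁻¹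
        simp only [reflection]; group
      · rfl
      · rfl
    have hsum := sum_eq q (fun j h1 h2 => by simp [q, h1, h2]) (by
      simp only [q, if_true, if_neg hne]
      have := FreeGroup.norm_mul_le P.1 (of P.2 * (P.1⁻¹ * Q.1))
      rw [← mul_assoc] at this
      change FreeGroup.norm (of P.2 * _) < _ at hlt
      omega)
    obtain ⟨β, hβ⟩ := ih _ hsum q (by rw [hq, hmove, hp]) rfl
    refine ⟨(braidGen l)⁻¹ * β, ?_⟩
    rw [_root_.map_mul, Equiv.Perm.mul_apply, hβ, _root_.map_inv, Equiv.Perm.inv_eq_iff_eq,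
      hurwitz_gen, hq]
  -- The mirror case: P begins with Qσ_Q, and the inverse move shortens P.
  · have hadd : FreeGroup.norm P.1 = FreeGroup.norm Q.1 + FreeGroup.norm (P.1⁻¹ * Q.1) := by
      conv_lhs => rw [← mul_inv_cancel_left Q.1 P.1]
      rw [show FreeGroup.norm (P.1⁻¹ * Q.1) = FreeGroup.norm (Q.1⁻¹ * P.1) by rw [← norm_inv_eq]; simp,
        FreeGroup.norm, toWord_mul_of_isReduced ((isReduced_append_iff isReduced_toWord isReduced_toWord).2 ?_),
        List.length_append]
      · rfl
      rintro ⟨x, b⟩ hx y hy hxy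
      have h' : (Q.2, true) ∈ (Q.1⁻¹ * P.1).toWord.head? := by
        rw [show Q.1⁻¹ * P.1 = (P.1⁻¹ * Q.1)⁻¹ by simp, head?_toWord_inv, hs]
        simp
      rw [Option.mem_unique hy h'] at hxy ⊢
      rw [show x = Q.2 from hxy] at hx
      exact absurd hx (ht _ _)
    have hlt := norm_mul_lt_of_mem_getLast? hs
    let q : Fin n → FreeGroup (Fin n) × Fin n := fun j =>
      if j = lo l then Q else
        if j = ZigzagFree.hi l then (Q.1 * (of Q.2)⁻¹ * (Q.1⁻¹ * P.1), P.2) else p j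
    have hq : hurwitzMove l (fun j => reflection (q j)) = (fun j => reflection (p j)) := by
      funext j
      simp only [q, hurwitzMove]
      split_ifs with h1 h2
      · subst h1
        change _ = reflection P
        simp only [reflection]; group
      · subst h2; rfl
      · rfl
    have hsum := sum_eq q (fun j h1 h2 => by simp [q, h1, h2]) (by
      simp only [q, if_true, if_neg hne]
      have := FreeGroup.norm_mul_le Q.1 ((of Q.2)⁻¹ * (Q.1⁻¹ * P.1))
      rw [← mul_assoc] at this
      have h5 : FreeGroup.norm ((of Q.2)⁻¹ * (Q.1⁻¹ * P.1)) =
          FreeGroup.norm (P.1⁻¹ * Q.1 * of Q.2) := by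
        rw [← norm_inv_eq]; simp [mul_assoc]
      change FreeGroup.norm (_ * of Q.2) < _ at hlt
      omega)
    obtain ⟨β, hβ⟩ := ih _ hsum q (by rw [← hmove l, hq, hp]) rfl
    refine ⟨braidGen l * β, ?_⟩
    rw [_root_.map_mul, Equiv.Perm.mul_apply, hβ, hurwitz_gen, hq]

/-- The Hurwitz action on minimal reflection expressions of the Coxeter element is transitive. -/
theorem exists_redAct_eq (r : Red n) : ∃ β : BraidGroup n, redAct β (stdRed n) = r := by
  choose g a h using r.2.1
  obtain ⟨β, hβ⟩ := exists_hurwitz_eq (fun i => (g i, a i)) (by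
    have := r.2.2
    rwa [show r.1 = fun i => reflection (g i, a i) from funext h] at this)
  exact ⟨β, Subtype.ext (hβ.trans (funext h).symm)⟩

theorem redAct_mul (β β' : BraidGroup n) (r : Red n) : redAct (β * β') r = redAct β (redAct β' r) :=
  Subtype.ext (by simp [redAct])

end Transitive

/-! ### Cones of mutually inverse twists -/

section

variable {𝒞 : Type*} [Category 𝒞]

theorem comp_map_comp_app {S : 𝒞 ⥤ 𝒞} (f : S ⟶ 𝟭 𝒞) {A B : 𝒞} (a : A ⟶ B) (s : A ⟶ S.obj A)
    (h : s ≫ f.app A = 𝟙 A) : (s ≫ S.map a) ≫ f.app B = a := by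
  rw [Category.assoc, f.naturality, ← Category.assoc, h]
  exact Category.id_comp _

theorem app_comp_map_comp {L : 𝒞 ⥤ 𝒞} (g : 𝟭 𝒞 ⟶ L) {A B : 𝒞} (a : A ⟶ B) (r : L.obj B ⟶ B)
    (h : g.app B ≫ r = 𝟙 B) : g.app A ≫ L.map a ≫ r = a := by
  rw [← Category.assoc, ← g.naturality, Category.assoc, h]
  exact Category.comp_id _

theorem comp_id_eq_inv_comp {A B E : 𝒞} {φ : A ⟶ B} [i : IsIso φ] {a : B ⟶ E} {b : A ⟶ E}
    (h : φ ≫ a = b) : a ≫ 𝟙 E = inv φ ≫ b := by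
  rw [Category.comp_id, ← h, IsIso.inv_hom_id_assoc]

theorem comp_map_inv_comp_map_hom {𝒟 : Type*} [Category 𝒟] (F : 𝒞 ⥤ 𝒟) {X Y : 𝒞} {Z : 𝒟}
    (a : Z ⟶ F.obj Y) (e : X ≅ Y) : (a ≫ F.map e.inv) ≫ F.map e.hom = a := by
  rw [Category.assoc, ← Functor.map_comp, e.inv_hom_id, CategoryTheory.Functor.map_id,
    Category.comp_id]

end

/-! ### Split triangles. -/

section Triangles

open Pretriangulated

variable {𝒯 : Type*} [Category 𝒯] [HasZeroObject 𝒯] [HasShift 𝒯 ℤ] [Preadditive 𝒯]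
  [∀ n : ℤ, (shiftFunctor 𝒯 n).Additive] [Pretriangulated 𝒯]

/-- The hypotheses exhibit the middle term as the direct sum of the first term and X, so the cone of
the split inclusion is X. The inverse is the factorisation of p through the cone. -/
theorem isIso_comp_mor₂ {T : Triangle 𝒯} (hT : T ∈ distTriang 𝒯) {X : 𝒯}
    (s : X ⟶ T.obj₂) (r : T.obj₂ ⟶ T.obj₁) (p : T.obj₂ ⟶ X)
    (h1 : T.mor₁ ≫ r = 𝟙 _) (h2 : T.mor₁ ≫ p = 0) (h3 : s ≫ p = 𝟙 _)
    (h4 : r ≫ T.mor₁ + p ≫ s = 𝟙 _) : IsIso (s ≫ T.mor₂) := by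
  have hm : Mono T.mor₁ := (IsSplitMono.mk' ⟨r, h1⟩).mono
  have he : Epi T.mor₂ := T.epi₂ hT (T.mor₃_eq_zero_of_mono₁ hT hm)
  obtain ⟨p', hp'⟩ := T.yoneda_exact₂ hT p h2
  refine ⟨p', by rw [Category.assoc, ← hp', h3], ?_⟩
  rw [← cancel_epi T.mor₂, ← Category.assoc, ← hp', ← Category.assoc, Category.comp_id]
  rw [← eq_sub_iff_add_eq'] at h4
  rw [h4, Preadditive.sub_comp, Category.assoc, comp_distTriang_mor_zero₁₂ _ hT]
  simp

/-- The dual statement: the fibre of a split projection is the complementary summand. -/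
theorem isIso_mor₁_comp {T : Triangle 𝒯} (hT : T ∈ distTriang 𝒯) {X : 𝒯}
    (r : T.obj₂ ⟶ X) (t : X ⟶ T.obj₂) (s : T.obj₃ ⟶ T.obj₂)
    (h1 : s ≫ T.mor₂ = 𝟙 _) (h2 : t ≫ T.mor₂ = 0) (h3 : t ≫ r = 𝟙 _)
    (h4 : r ≫ t + T.mor₂ ≫ s = 𝟙 _) : IsIso (T.mor₁ ≫ r) := by
  have he : Epi T.mor₂ := (IsSplitEpi.mk' ⟨s, h1⟩).epi
  have hm : Mono T.mor₁ := T.mono₁ hT (T.mor₃_eq_zero_of_epi₂ hT he)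
  obtain ⟨t', ht'⟩ := T.coyoneda_exact₂ hT t h2
  refine ⟨t', ?_, by rw [← Category.assoc, ← ht', h3]⟩
  rw [← cancel_mono T.mor₁, Category.assoc, ← ht', Category.id_comp, Category.assoc]
  rw [← eq_sub_iff_add_eq] at h4
  rw [h4, Preadditive.comp_sub, ← Category.assoc, comp_distTriang_mor_zero₁₂ _ hT]
  simp

/-- Two morphisms which agree up to an isomorphism have isomorphic cones. -/
theorem nonempty_iso_obj₃ {T T' : Triangle 𝒯} (hT : T ∈ distTriang 𝒯) (hT' : T' ∈ distTriang 𝒯)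
    (e₁ : T.obj₁ ≅ T'.obj₁) (e₂ : T.obj₂ ≅ T'.obj₂) (h : T.mor₁ ≫ e₂.hom = e₁.hom ≫ T'.mor₁) :
    Nonempty (T.obj₃ ≅ T'.obj₃) :=
  ⟨Triangle.π₃.mapIso (isoTriangleOfIso₁₂ T T' hT hT' e₁ e₂ h)⟩

theorem distinguished_of_iso_obj₁ {T : Triangle 𝒯} (hT : T ∈ distTriang 𝒯) {X : 𝒯}
    (e : X ≅ T.obj₁) :
    Triangle.mk (e.hom ≫ T.mor₁) T.mor₂ (T.mor₃ ≫ (shiftFunctor 𝒯 (1 : ℤ)).map e.inv) ∈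
      distTriang 𝒯 :=
  isomorphic_distinguished _ hT _ (Triangle.isoMk _ _ e (Iso.refl _) (Iso.refl _)
    (Category.comp_id _) ((Category.comp_id _).trans (Category.id_comp _).symm)
    ((comp_map_inv_comp_map_hom _ _ _).trans (Category.id_comp _).symm))

end Triangles

/-! ### Composites of cones of natural transformations. -/

section InverseCones

open Pretriangulated HomotopyCategory CochainComplex

variable {C : Type u} [Category.{v} C] [Preadditive C]

/-- A natural transformation evaluated on a complex. -/
def natApp {S T : C ⥤ C} [S.Additive] [T.Additive] (η : S ⟶ T) (K : CochainComplex C ℤ) :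
    (S.mapHomologicalComplex (ComplexShape.up ℤ)).obj K ⟶
      (T.mapHomologicalComplex (ComplexShape.up ℤ)).obj K :=
  (NatTrans.mapHomologicalComplex η (ComplexShape.up ℤ)).app K

theorem quotient_map_comp_eq {K L M : CochainComplex C ℤ} (a : K ⟶ L) (b : L ⟶ M) (c : K ⟶ M)
    (h : ∀ i, a.f i ≫ b.f i = c.f i) :
    (quotient C (ComplexShape.up ℤ)).map a ≫ (quotient C (ComplexShape.up ℤ)).map b =
      (quotient C (ComplexShape.up ℤ)).map c := by
  rw [← Functor.map_comp]
  congr 1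
  ext i
  exact h i

theorem quotient_map_comp_eq_id {K L : CochainComplex C ℤ} (a : K ⟶ L) (b : L ⟶ K)
    (h : ∀ i, a.f i ≫ b.f i = 𝟙 _) :
    (quotient C (ComplexShape.up ℤ)).map a ≫ (quotient C (ComplexShape.up ℤ)).map b = 𝟙 _ :=
  (quotient_map_comp_eq a b (𝟙 K) h).trans (CategoryTheory.Functor.map_id _ _)

theorem quotient_map_comp_eq_zero {K L M : CochainComplex C ℤ} (a : K ⟶ L) (b : L ⟶ M)
    (h : ∀ i, a.f i ≫ b.f i = 0) :
    (quotient C (ComplexShape.up ℤ)).map a ≫ (quotient C (ComplexShape.up ℤ)).map b = 0 :=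
  (quotient_map_comp_eq a b 0 h).trans (Functor.map_zero _ _ _)

theorem quotient_map_comp_add_eq_id {K L M : CochainComplex C ℤ} (a : K ⟶ L) (b : L ⟶ K)
    (c : K ⟶ M) (d : M ⟶ K) (h : ∀ i, a.f i ≫ b.f i + c.f i ≫ d.f i = 𝟙 _) :
    (quotient C (ComplexShape.up ℤ)).map a ≫ (quotient C (ComplexShape.up ℤ)).map b +
      (quotient C (ComplexShape.up ℤ)).map c ≫ (quotient C (ComplexShape.up ℤ)).map d = 𝟙 _ := by
  rw [← Functor.map_comp, ← Functor.map_comp, ← Functor.map_add,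
    ← CategoryTheory.Functor.map_id]
  congr 1
  ext i
  exact h i

variable [HasZeroObject C] [HasBinaryBiproducts C]

/-- The functor `cone η` commutes with the shift, up to isomorphism. -/
theorem nonempty_coneK_shift_iso {S T : C ⥤ C} [S.Additive] [T.Additive] (η : S ⟶ T)
    (K : CochainComplex C ℤ) (a : ℤ) :
    Nonempty ((coneK η).obj ((quotient C (ComplexShape.up ℤ)).obj (K⟦a⟧)) ≅
      (quotient C (ComplexShape.up ℤ)).obj (((cone η).obj K)⟦a⟧)) := by
  have h := mappingCone_triangleh_distinguished (natApp η (K⟦a⟧))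
  have h' := mappingCone_triangleh_distinguished ((natApp η K)⟦a⟧')
  -- Both commutation isomorphisms are identities in each degree.
  have hcomm : (quotient C (ComplexShape.up ℤ)).map (natApp η (K⟦a⟧)) ≫
      (quotient C (ComplexShape.up ℤ)).map
        (((T.mapHomologicalComplex (ComplexShape.up ℤ)).commShiftIso a).app K).hom =
      (quotient C (ComplexShape.up ℤ)).map
        (((S.mapHomologicalComplex (ComplexShape.up ℤ)).commShiftIso a).app K).hom ≫
      (quotient C (ComplexShape.up ℤ)).map ((natApp η K)⟦a⟧') := by
    rw [← Functor.map_comp, ← Functor.map_comp]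
    congr 1
    ext i
    exact (Category.comp_id _).trans (Category.id_comp _).symm
  obtain ⟨e⟩ := nonempty_iso_obj₃ h h'
    ((quotient C (ComplexShape.up ℤ)).mapIso
      (((S.mapHomologicalComplex (ComplexShape.up ℤ)).commShiftIso a).app K))
    ((quotient C (ComplexShape.up ℤ)).mapIso
      (((T.mapHomologicalComplex (ComplexShape.up ℤ)).commShiftIso a).app K)) hcomm
  exact ⟨e ≪≫ (quotient C (ComplexShape.up ℤ)).mapIso (mappingCone.shiftIso (natApp η K) a).symm⟩

variable {S L : C ⥤ C} [S.Additive] [L.Additive] (f : S ⟶ 𝟭 C) (g : 𝟭 C ⟶ L)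

/-- Apply S to the triangle K ⟶ LK ⟶ Z, where Z is the cone of g. The splitting identifies SZ with
LK, and since s is a section of f, the map f on Z becomes LK ⟶ Z. Its cone is K[1] by rotation. -/
theorem nonempty_coneK_cone_iso (s : L ⟶ L ⋙ S) (r : L ⋙ S ⟶ S) (p : L ⋙ S ⟶ L)
    (h0 : ∀ M, s.app M ≫ f.app (L.obj M) = 𝟙 _)
    (h1 : ∀ M, S.map (g.app M) ≫ r.app M = 𝟙 _) (h2 : ∀ M, S.map (g.app M) ≫ p.app M = 0)
    (h3 : ∀ M, s.app M ≫ p.app M = 𝟙 _)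
    (h4 : ∀ M, (r.app M ≫ S.map (g.app M) : S.obj (L.obj M) ⟶ S.obj (L.obj M)) +
      (p.app M ≫ s.app M : S.obj (L.obj M) ⟶ S.obj (L.obj M)) = 𝟙 (S.obj (L.obj M))) (K : CochainComplex C ℤ) :
    Nonempty ((coneK f).obj ((quotient C (ComplexShape.up ℤ)).obj ((cone g).obj K)) ≅
      ((quotient C (ComplexShape.up ℤ)).obj K)⟦(1 : ℤ)⟧) := by
  let Q := quotient C (ComplexShape.up ℤ)
  let SC := S.mapHomologicalComplex (ComplexShape.up ℤ)
  let LC := L.mapHomologicalComplex (ComplexShape.up ℤ)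
  let φ : K ⟶ LC.obj K := natApp g K
  let sK : LC.obj K ⟶ SC.obj (LC.obj K) := natApp s K
  let rK : SC.obj (LC.obj K) ⟶ SC.obj K := natApp r K
  let pK : SC.obj (LC.obj K) ⟶ LC.obj K := natApp p K
  have hT := mappingCone_triangleh_distinguished φ
  have hST := (S.mapHomotopyCategory (ComplexShape.up ℤ)).map_distinguished _ hT
  have hiso : IsIso (Q.map sK ≫
      ((S.mapHomotopyCategory (ComplexShape.up ℤ)).mapTriangle.obj (mappingCone.triangleh φ)).mor₂) := by
    refine isIso_comp_mor₂ hST (Q.map sK) (Q.map rK) (Q.map pK) ?_ ?_ ?_ ?_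
    · exact quotient_map_comp_eq_id (SC.map φ) rK fun i => h1 (K.X i)
    · exact quotient_map_comp_eq_zero (SC.map φ) pK fun i => h2 (K.X i)
    · exact quotient_map_comp_eq_id sK pK fun i => h3 (K.X i)
    · exact quotient_map_comp_add_eq_id rK (SC.map φ) pK sK fun i => h4 (K.X i)
  have hZ := mappingCone_triangleh_distinguished (natApp f (mappingCone φ))
  refine nonempty_iso_obj₃ hZ (rot_of_distTriang _ hT) (@asIso _ _ _ _ _ hiso).symm (Iso.refl _) ?_
  refine comp_id_eq_inv_comp (i := hiso) (quotient_map_comp_eq (sK ≫ SC.map (mappingCone.inr φ))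
    (natApp f (mappingCone φ)) (mappingCone.inr φ) fun i => ?_)
  exact comp_map_comp_app f _ _ (h0 (K.X i))

/-- Dually, let Y ⟶ SK ⟶ K be the triangle ending in f. The splitting identifies LY with SK, and
since r retracts g, the map g on Y becomes Y ⟶ SK, whose cone is K. -/
theorem nonempty_coneK_cone_shift_iso (r : S ⋙ L ⟶ S) (t : S ⟶ S ⋙ L) (s : L ⟶ S ⋙ L)
    (h0 : ∀ M, g.app (S.obj M) ≫ r.app M = 𝟙 _)
    (h1 : ∀ M, s.app M ≫ L.map (f.app M) = 𝟙 _) (h2 : ∀ M, t.app M ≫ L.map (f.app M) = 0)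
    (h3 : ∀ M, t.app M ≫ r.app M = 𝟙 _)
    (h4 : ∀ M, (r.app M ≫ t.app M : L.obj (S.obj M) ⟶ L.obj (S.obj M)) +
      (L.map (f.app M) ≫ s.app M : L.obj (S.obj M) ⟶ L.obj (S.obj M)) = 𝟙 (L.obj (S.obj M))) (K : CochainComplex C ℤ) :
    Nonempty ((coneK g).obj ((quotient C (ComplexShape.up ℤ)).obj (((cone f).obj K)⟦(-1 : ℤ)⟧)) ≅
      (quotient C (ComplexShape.up ℤ)).obj K) := by
  let Q := quotient C (ComplexShape.up ℤ)
  let SC := S.mapHomologicalComplex (ComplexShape.up ℤ)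
  let LC := L.mapHomologicalComplex (ComplexShape.up ℤ)
  let φ : SC.obj K ⟶ K := natApp f K
  let sK : LC.obj K ⟶ LC.obj (SC.obj K) := natApp s K
  let rK : LC.obj (SC.obj K) ⟶ SC.obj K := natApp r K
  let tK : SC.obj K ⟶ LC.obj (SC.obj K) := natApp t K
  obtain ⟨ε, hε⟩ : ∃ ε : Q.obj ((mappingCone φ)⟦(-1 : ℤ)⟧) ⟶ Q.obj (SC.obj K),
      ∃ δ, Triangle.mk ε (Q.map φ) δ ∈ distTriang (HomotopyCategory C (ComplexShape.up ℤ)) := by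
    have := inv_rot_of_distTriang _ (mappingCone_triangleh_distinguished φ)
    let e : Q.obj ((mappingCone φ)⟦(-1 : ℤ)⟧) ≅ (Q.obj (mappingCone φ))⟦(-1 : ℤ)⟧ :=
      (Q.commShiftIso (-1 : ℤ)).app _
    exact ⟨_, _, distinguished_of_iso_obj₁ this e⟩
  obtain ⟨δ, hT⟩ := hε
  -- A chain map representing the morphism is chosen so that naturality of g can be used degree by
  -- degree.
  obtain ⟨ε', rfl⟩ := Q.map_surjective ε
  have hLT := (L.mapHomotopyCategory (ComplexShape.up ℤ)).map_distinguished _ hT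
  have hiso := isIso_mor₁_comp hLT (Q.map rK) (Q.map tK) (Q.map sK) 
    (quotient_map_comp_eq_id sK (LC.map φ) fun i => h1 (K.X i))
    (quotient_map_comp_eq_zero tK (LC.map φ) fun i => h2 (K.X i))
    (quotient_map_comp_eq_id tK rK fun i => h3 (K.X i))
    (quotient_map_comp_add_eq_id rK tK (LC.map φ) sK fun i => h4 (K.X i))
  have hY := mappingCone_triangleh_distinguished (natApp g ((mappingCone φ)⟦(-1 : ℤ)⟧))
  refine nonempty_iso_obj₃ hY hT (Iso.refl _) (@asIso _ _ _ _ _ hiso) ?_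
  refine (quotient_map_comp_eq (natApp g _) (LC.map ε' ≫ rK) ε' fun i => ?_).trans
    (Category.id_comp _).symm
  exact app_comp_map_comp g _ _ (h0 (K.X i))

end InverseCones

/-! ### Coefficients of elements of the zigzag algebra -/

namespace Zigzag

variable {k : Type u} [Field k] {n : ℕ}

variable (k) in
/-- The vector space underlying a model of the representation `Â e_l`: the coordinates are the
coefficients of `e_l`, of `z_l`, and of the arrows `j ⟶ l`. -/
abbrev Model (n : ℕ) : Type u := k × k × (Fin n → Bool → k)

/-- The action of the generators on the model of `Â e_l`. -/
def modelGen (l : Fin n) : Gen n → Module.End k (Model k n)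
  | .e i =>
    { toFun := fun v => (if i = l then v.1 else 0, if i = l then v.2.1 else 0,
        fun j c => if i = j then v.2.2 j c else 0)
      map_add' := fun v w => by
        ext <;> simp <;> split_ifs <;> simp
      map_smul' := fun r v => by ext <;> simp }
  | .z i =>
    { toFun := fun v => (0, if i = l then v.1 else 0, 0)
      map_add' := fun v w => by
        ext <;> simp; split_ifs <;> simp
      map_smul' := fun r v => by ext <;> simp }
  | .arr i j _ c =>
    { toFun := fun v => (0, if i = l then v.2.2 j c else 0,
        fun i' c' => if i' = i ∧ c' = c ∧ j = l then v.1 else 0)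
      map_add' := fun v w => by
        ext <;> simp <;> split_ifs <;> simp
      map_smul' := fun r v => by ext <;> simp }

/-- The model of the representation `Â e_l`. -/
def model (l : Fin n) : Zigzag k n →ₐ[k] Module.End k (Model k n) :=
  RingQuot.liftAlgHom k ⟨FreeAlgebra.lift k (modelGen l), by
    intro a b h
    induction h with
    | sum_e =>
      simp only [map_sum, FreeAlgebra.lift_ι_apply, map_one]
      refine LinearMap.ext fun v => ?_
      rw [LinearMap.sum_apply]
      refine Prod.ext ?_ (Prod.ext ?_ ?_)
      · simp [modelGen, Prod.fst_sum]
      · simp [modelGen, Prod.snd_sum, Prod.fst_sum]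
      · funext j c
        simp [modelGen, Prod.snd_sum, Finset.sum_apply]
    | _ =>
      simp only [map_mul, FreeAlgebra.lift_ι_apply, map_zero]
      refine LinearMap.ext fun v => ?_
      refine Prod.ext ?_ (Prod.ext ?_ (funext fun j' => funext fun c' => ?_)) <;>
      simp [modelGen] <;> grind⟩


/-- The coefficient of `e_l`. -/
def eCoeff (l : Fin n) : Zigzag k n →ₗ[k] k where
  toFun a := (model l a (1, 0, 0)).1
  map_add' a b := by simp
  map_smul' r a := by simp

/-- The coefficient of `z_l`. -/
def zCoeff (l : Fin n) : Zigzag k n →ₗ[k] k where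
  toFun a := (model l a (1, 0, 0)).2.1
  map_add' a b := by simp
  map_smul' r a := by simp

theorem model_gen (l : Fin n) (s : Gen n) : model l (gen k n s) = modelGen l s := by
  have h : model l (gen k n s) = FreeAlgebra.lift k (modelGen l) (FreeAlgebra.ι k s) :=
    RingQuot.liftAlgHom_mkAlgHom_apply _ _ _ _
  rw [h, FreeAlgebra.lift_ι_apply]

theorem eCoeff_e (l i : Fin n) : eCoeff l (e k i) = if i = l then 1 else 0 := by
  simp [eCoeff, e, model_gen, modelGen]

theorem eCoeff_z (l i : Fin n) : eCoeff l (z k i) = 0 := by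
  simp [eCoeff, z, model_gen, modelGen]

theorem eCoeff_arr (l i j : Fin n) (c : Bool) : eCoeff l (arr k i j c) = 0 := by
  unfold arr
  split_ifs
  · simp [eCoeff, model_gen, modelGen]
  · simp

theorem zCoeff_e (l i : Fin n) : zCoeff l (e k i) = 0 := by
  simp [zCoeff, e, model_gen, modelGen]

theorem zCoeff_z (l i : Fin n) : zCoeff l (z k i) = if i = l then 1 else 0 := by
  simp [zCoeff, z, model_gen, modelGen]

theorem zCoeff_arr (l i j : Fin n) (c : Bool) : zCoeff l (arr k i j c) = 0 := by
  unfold arr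
  split_ifs
  · simp [zCoeff, model_gen, modelGen]
  · simp

theorem z_ne_zero (l : Fin n) : z k l ≠ 0 := by
  intro h
  have := zCoeff_z (k := k) l l
  rw [h, map_zero, if_pos rfl] at this
  exact zero_ne_one this

/-- Linear maps out of the zigzag algebra agree if they agree on paths of length at most one. -/
theorem linearMap_ext {X : Type*} [AddCommGroup X] [Module k X] {φ ψ : Zigzag k n →ₗ[k] X}
    (he : ∀ i, φ (e k i) = ψ (e k i)) (hz : ∀ i, φ (z k i) = ψ (z k i))
    (ha : ∀ i j c, φ (arr k i j c) = ψ (arr k i j c)) : φ = ψ := by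
  refine LinearMap.ext_on (span_basisSet (k := k) (n := n)) ?_
  rintro _ ((⟨i, rfl⟩ | ⟨i, rfl⟩) | ⟨⟨i, j, c⟩, rfl⟩)
  exacts [he i, hz i, ha i j c]

/-- The endomorphism algebra of P_l has basis e_l, z_l; this two-dimensionality is the source of the
splittings below. -/
theorem e_mul_mul_e (l : Fin n) (a : Zigzag k n) :
    e k l * a * e k l = eCoeff l a • e k l + zCoeff l a • z k l := by
  have : LinearMap.mulRight k (e k l) ∘ₗ LinearMap.mulLeft k (e k l) =
      (eCoeff l).smulRight (e k l) + (zCoeff l).smulRight (z k l) := by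
    refine linearMap_ext (fun i => ?_) (fun i => ?_) fun i j c => ?_
    · by_cases h : i = l
      · subst h; simp [eCoeff_e, zCoeff_e]
      · simp [e_mul_e', eCoeff_e, zCoeff_e, h, Ne.symm h]
    · simp [e_mul_z', eCoeff_z, zCoeff_z]
      split_ifs <;> simp_all
    · simp only [LinearMap.comp_apply, LinearMap.mulLeft_apply, LinearMap.mulRight_apply,
        e_mul_arr', LinearMap.add_apply, LinearMap.smulRight_apply, eCoeff_arr, zCoeff_arr]
      by_cases h : l = i
      · subst h
        by_cases h : j = l
        · subst h; simp
        · simp [arr_mul_e', h]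
      · simp [h]
  exact LinearMap.congr_fun this a

/-- A functional supported on paths of degree d₀ is homogeneous: composed with the coaction it lands
in the component d₀, as can be checked on short paths. -/
theorem apply_eq_zero_of_mem_grade {φ : Zigzag k n →ₗ[k] k} {d₀ d : ℤ}
    (he : 0 ≠ d₀ → ∀ i, φ (e k i) = 0) (hz : 1 ≠ d₀ → ∀ i, φ (z k i) = 0)
    (ha : ∀ i j c, φ (arr k i j c) = 0) {a : Zigzag k n} (had : a ∈ grade k n d) (hd : d ≠ d₀) :
    φ a = 0 := by
  let c : Zigzag k n →ₗ[k] (ℤ →₀ Zigzag k n) :=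
    { toFun := fun a => (coaction k n a).coeff
      map_add' := fun a b => by rw [map_add]; rfl
      map_smul' := fun r a => by rw [map_smul]; rfl }
  have hc : ∀ {d a}, a ∈ grade k n d → c a = Finsupp.single d a := fun {d a} h => by
    change (coaction k n a).coeff = _
    rw [coaction_of_mem h]; rfl
  have hs : ∀ (d : ℤ) (x : k), (d ≠ d₀ → x = 0) → Finsupp.single d x = Finsupp.single d₀ x := by
    intro d x h
    by_cases hd : d = d₀
    · rw [hd]
    · rw [h hd, Finsupp.single_zero, Finsupp.single_zero]
  have : Finsupp.mapRange.linearMap φ ∘ₗ c = Finsupp.lsingle d₀ ∘ₗ φ := by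
    refine linearMap_ext (fun i => ?_) (fun i => ?_) fun i j c => ?_
    · simpa [hc (e_mem_grade i)] using hs _ _ fun h => he h i
    · simpa [hc (z_mem_grade i)] using hs _ _ fun h => hz h i
    · simp [hc (arr_mem_grade i j _), ha]
  have := LinearMap.congr_fun this a
  simp only [LinearMap.comp_apply, hc had, Finsupp.mapRange.linearMap_apply,
    Finsupp.mapRange_single, Finsupp.lsingle_apply] at this
  simpa [hd] using DFunLike.congr_fun this d

theorem eCoeff_eq_zero {l : Fin n} {a : Zigzag k n} {d : ℤ} (ha : a ∈ grade k n d) (hd : d ≠ 0) :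
    eCoeff l a = 0 :=
  apply_eq_zero_of_mem_grade (fun h => absurd rfl h) (fun _ => eCoeff_z l) (eCoeff_arr l) ha hd

theorem zCoeff_eq_zero {l : Fin n} {a : Zigzag k n} {d : ℤ} (ha : a ∈ grade k n d) (hd : d ≠ 1) :
    zCoeff l a = 0 :=
  apply_eq_zero_of_mem_grade (fun _ => zCoeff_e l) (fun h => absurd rfl h) (zCoeff_arr l) ha hd

end Zigzag

/-! ### The natural transformations witnessing that the twists are invertible -/

namespace GrProj

open Zigzag

variable {k : Type u} [Field k] {n : ℕ}

section TensorMap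

variable (i : Fin n) {X Y Z : Type u} [AddCommGroup X] [Module k X] [AddCommGroup Y] [Module k Y]
  [AddCommGroup Z] [Module k Z]

/-- The linear map `Pᵢ ⊗ X ⟶ Pᵢ ⊗ Y` induced by a map `X ⟶ Y`. -/
abbrev tmap (φ : X →ₗ[k] Y) : P k i ⊗[k] X →ₗ[Zigzag k n] P k i ⊗[k] Y :=
  TensorProduct.AlgebraTensorModule.map (LinearMap.id (R := Zigzag k n) (M := P k i)) φ

theorem tmap_tmap (φ : X →ₗ[k] Y) (ψ : Y →ₗ[k] Z) (t : P k i ⊗[k] X) :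
    tmap i ψ (tmap i φ t) = tmap i (ψ ∘ₗ φ) t :=
  (LinearMap.congr_fun (TensorProduct.AlgebraTensorModule.map_comp
    (LinearMap.id (R := Zigzag k n) (M := P k i)) LinearMap.id ψ φ) t).symm

theorem tmap_id (t : P k i ⊗[k] X) : tmap i (LinearMap.id (R := k)) t = t :=
  LinearMap.congr_fun (TensorProduct.AlgebraTensorModule.map_id
    (R := k) (A := Zigzag k n) (M := P k i) (N := X)) t

theorem tmap_add (φ ψ : X →ₗ[k] Y) (t : P k i ⊗[k] X) :
    tmap i φ t + tmap i ψ t = tmap i (φ + ψ) t :=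
  (LinearMap.congr_fun (TensorProduct.AlgebraTensorModule.map_add_right
    (LinearMap.id (R := Zigzag k n) (M := P k i)) φ ψ) t).symm

theorem tmap_zero (t : P k i ⊗[k] X) : tmap i (0 : X →ₗ[k] Y) t = 0 := by
  induction t using TensorProduct.induction_on with
  | zero => exact map_zero _
  | tmul a x => exact TensorProduct.tmul_zero _ _
  | add x y hx hy => rw [map_add, hx, hy, add_zero]

variable (X) in
/-- The map `Pᵢ ⊗ X ⟶ X` which takes the coefficient of `eᵢ`. -/
def eProj : P k i ⊗[k] X →ₗ[k] X :=
  (TensorProduct.lid k X).toLinearMap ∘ₗ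
    TensorProduct.map (eCoeff i ∘ₗ (ideal k i).subtype.restrictScalars k) LinearMap.id

variable (X) in
/-- The map `Pᵢ ⊗ X ⟶ X` which takes the coefficient of `zᵢ`. -/
def zProj : P k i ⊗[k] X →ₗ[k] X :=
  (TensorProduct.lid k X).toLinearMap ∘ₗ
    TensorProduct.map (zCoeff i ∘ₗ (ideal k i).subtype.restrictScalars k) LinearMap.id

theorem eProj_tmul (a : P k i) (x : X) : eProj i X (a ⊗ₜ x) = eCoeff i a.1 • x := rfl

theorem zProj_tmul (a : P k i) (x : X) : zProj i X (a ⊗ₜ x) = zCoeff i a.1 • x := rfl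

/-- The decomposition of e_iP_i ⊗ X into a part at e_i and a part at z_i, which reduces later
identities to a comparison of two coefficients. -/
theorem e_smul_eq (w : P k i ⊗[k] X) :
    e k i • w = eP k i ⊗ₜ eProj i X w + zP k i ⊗ₜ zProj i X w := by
  induction w using TensorProduct.induction_on with
  | zero => simp
  | add x y hx hy => rw [smul_add, hx, hy]; simp only [map_add, TensorProduct.tmul_add]; abel
  | tmul a x =>
    rw [eProj_tmul, zProj_tmul, TensorProduct.smul_tmul', ← TensorProduct.smul_tmul,
      ← TensorProduct.smul_tmul, ← TensorProduct.add_tmul]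
    congr 1
    refine Subtype.ext ?_
    change e k i * a.1 = _
    have := e_mul_mul_e i a.1
    rwa [mul_assoc, mem_ideal.1 a.2] at this

theorem z_smul_eq (w : P k i ⊗[k] X) : z k i • w = zP k i ⊗ₜ eProj i X w := by
  have h : z k i • w = z k i • e k i • w := by rw [← mul_smul, z_mul_e]
  rw [h, e_smul_eq, smul_add, TensorProduct.smul_tmul', TensorProduct.smul_tmul']
  have h1 : z k i • eP k i = zP k i := Subtype.ext (z_mul_e i)
  have h2 : z k i • zP k i = 0 := Subtype.ext (z_mul_z i)
  rw [h1, h2, TensorProduct.zero_tmul, add_zero]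

theorem eProj_eP (x : X) : eProj i X (eP k i ⊗ₜ x) = x := by
  rw [eProj_tmul]; simp [eP, eCoeff_e]

theorem eProj_zP (x : X) : eProj i X (zP k i ⊗ₜ x) = 0 := by
  rw [eProj_tmul]; simp [zP, eCoeff_z]

theorem zProj_eP (x : X) : zProj i X (eP k i ⊗ₜ x) = 0 := by
  rw [zProj_tmul]; simp [eP, zCoeff_e]

theorem zProj_zP (x : X) : zProj i X (zP k i ⊗ₜ x) = x := by
  rw [zProj_tmul]; simp [zP, zCoeff_z]

theorem eProj_tmap (φ : X →ₗ[k] Y) (w : P k i ⊗[k] X) :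
    eProj i Y (tmap i φ w) = φ (eProj i X w) := by
  induction w using TensorProduct.induction_on with
  | zero => simp
  | add x y hx hy => simp only [map_add, hx, hy]
  | tmul a x => exact (map_smul φ _ _).symm

theorem zProj_tmap (φ : X →ₗ[k] Y) (w : P k i ⊗[k] X) :
    zProj i Y (tmap i φ w) = φ (zProj i X w) := by
  induction w using TensorProduct.induction_on with
  | zero => simp
  | add x y hx hy => simp only [map_add, hx, hy]
  | tmul a x => exact (map_smul φ _ _).symm

/-- P_i is generated by e_i as a left module. -/
theorem linearMap_ext_tmul {N : Type*} [AddCommGroup N] [Module (Zigzag k n) N] [Module k N]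
    [IsScalarTower k (Zigzag k n) N] {φ ψ : P k i ⊗[k] X →ₗ[Zigzag k n] N}
    (h : ∀ x, φ (eP k i ⊗ₜ x) = ψ (eP k i ⊗ₜ x)) : φ = ψ := by
  refine TensorProduct.AlgebraTensorModule.ext fun a x => ?_
  have ha : a ⊗ₜ[k] x = (show ideal k i from a).1 • (eP k i ⊗ₜ[k] x) := by
    rw [TensorProduct.smul_tmul']
    congr 1
    exact Subtype.ext (mem_ideal.1 a.2).symm
  rw [ha, map_smul, map_smul, h]

end TensorMap

variable (i : Fin n) (M : GrProj k n)

/-- Multiplication by `zᵢ` on `eᵢ M`. -/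
def zCorner : corner i M →ₗ[k] corner i M := toCorner i M (z k i) (by simp) ∘ₗ (corner i M).subtype

/-- The map `eᵢ M ⟶ eᵢ (Pᵢ ⊗ eᵢ M)`, `m ↦ eᵢ ⊗ m`. -/
def cornerUnit : corner i M →ₗ[k] corner i (tensorObj i M) :=
  LinearMap.codRestrict _ (TensorProduct.mk k (P k i) (corner i M) (eP k i)) fun m => by
    change e k i • (eP k i ⊗ₜ[k] m) = _
    rw [TensorProduct.smul_tmul']
    congr 1
    exact Subtype.ext (e_mul_self i)

/-- The map `eᵢ M ⟶ eᵢ (Pᵢ ⊗ eᵢ M)`, `m ↦ zᵢ ⊗ m`. -/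
def cornerLoop : corner i M →ₗ[k] corner i (tensorObj i M) :=
  LinearMap.codRestrict _ (TensorProduct.mk k (P k i) (corner i M) (zP k i)) fun m => by
    change e k i • (zP k i ⊗ₜ[k] m) = _
    rw [TensorProduct.smul_tmul']
    congr 1
    exact Subtype.ext (e_mul_z i)

/-- The map `eᵢ (Pᵢ ⊗ eᵢ M) ⟶ eᵢ M` which takes the coefficient of `eᵢ`. -/
def cornerECoeff : corner i (tensorObj i M) →ₗ[k] corner i M :=
  eProj i (corner i M) ∘ₗ (corner i (tensorObj i M)).subtype

/-- The map `eᵢ (Pᵢ ⊗ eᵢ M) ⟶ eᵢ M` which takes the coefficient of `zᵢ`. -/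
def cornerZCoeff : corner i (tensorObj i M) →ₗ[k] corner i M :=
  zProj i (corner i M) ∘ₗ (corner i (tensorObj i M)).subtype

theorem cornerECoeff_comp_unit : cornerECoeff i M ∘ₗ cornerUnit i M = LinearMap.id :=
  LinearMap.ext fun m => eProj_eP (k := k) i m

theorem cornerZCoeff_comp_unit : cornerZCoeff i M ∘ₗ cornerUnit i M = 0 :=
  LinearMap.ext fun m => zProj_eP (k := k) i m

theorem cornerZCoeff_comp_loop : cornerZCoeff i M ∘ₗ cornerLoop i M = LinearMap.id :=
  LinearMap.ext fun m => zProj_zP (k := k) i m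

theorem evalLin_corner (w : corner i (tensorObj i M)) :
    evalLin i M w.1 = (cornerECoeff i M w + zCorner i M (cornerZCoeff i M w)).1 := by
  have h : (w.1 : P k i ⊗[k] corner i M) =
      eP k i ⊗ₜ cornerECoeff i M w + zP k i ⊗ₜ cornerZCoeff i M w :=
    w.2.symm.trans (e_smul_eq i w.1)
  refine (congrArg (evalLin i M) h).trans ((map_add (evalLin i M) _ _).trans ?_)
  exact congrArg (· + _) (cornerECoeff i M w).2

/-- On e_iM the sum over arrows vanishes, because an arrow from i to another vertex is killed by e_i
on the right. -/
theorem coevalBase_corner (m : corner i M) :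
    coevalBase i M m.1 = zP k i ⊗ₜ m + eP k i ⊗ₜ zCorner i M m := by
  have h1 : ∀ j c, toCorner i M (arr k i j c) (by simp) m.1 = 0 := by
    intro j c
    refine Subtype.ext ?_
    change arr k i j c • m.1 = 0
    rw [← mem_corner.1 m.2, ← mul_smul, arr_mul_e']
    split_ifs with h
    · subst h; simp
    · simp
  have h2 : toCorner i M (e k i) (by simp) m.1 = m := Subtype.ext m.2
  simp only [coevalBase, LinearMap.add_apply, LinearMap.sum_apply, LinearMap.comp_apply,
    TensorProduct.mk_apply, h1, h2, TensorProduct.tmul_zero, Finset.sum_const_zero, add_zero]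
  rfl

/-! #### Degrees -/

theorem cornerUnit_mem {d : ℤ} {m : corner i M} (h : m ∈ cornerDeg i M d) :
    (cornerUnit i M m).1 ∈ (tensorObj i M).deg d :=
  tmul_mem_tensorGrade (zero_add _) (e_mem_grade i) h

theorem cornerLoop_mem {d : ℤ} {m : corner i M} (h : m ∈ cornerDeg i M d) :
    (cornerLoop i M m).1 ∈ (tensorObj i M).deg (1 + d) :=
  tmul_mem_tensorGrade rfl (z_mem_grade i) h

theorem cornerECoeff_mem {d : ℤ} {w : corner i (tensorObj i M)}
    (h : w.1 ∈ (tensorObj i M).deg d) : cornerECoeff i M w ∈ cornerDeg i M d := by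
  refine map_mem_of_tensorGrade (eProj i (corner i M)) (cornerDeg i M d) ?_ _ h
  intro a b hab m hm v hv
  rw [eProj_tmul]
  by_cases ha : a = 0
  · subst ha
    rw [zero_add] at hab
    exact Submodule.smul_mem _ _ (hab ▸ hv)
  · rw [eCoeff_eq_zero (mem_idealDeg.1 hm) ha, zero_smul]
    exact zero_mem _

theorem cornerZCoeff_mem {d : ℤ} {w : corner i (tensorObj i M)}
    (h : w.1 ∈ (tensorObj i M).deg (1 + d)) : cornerZCoeff i M w ∈ cornerDeg i M d := by
  refine map_mem_of_tensorGrade (zProj i (corner i M)) (cornerDeg i M d) ?_ _ h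
  intro a b hab m hm v hv
  rw [zProj_tmul]
  by_cases ha : a = 1
  · subst ha
    rw [add_right_inj] at hab
    exact Submodule.smul_mem _ _ (hab ▸ hv)
  · rw [zCoeff_eq_zero (mem_idealDeg.1 hm) ha, zero_smul]
    exact zero_mem _

theorem zCorner_mem {d : ℤ} {m : corner i M} (h : m ∈ cornerDeg i M d) :
    zCorner i M m ∈ cornerDeg i M (1 + d) :=
  M.smul_mem (z_mem_grade i) h

theorem tmap_mem {X Y : Type u} [AddCommGroup X] [Module k X] [AddCommGroup Y] [Module k Y]
    (𝒳 : ℤ → Submodule k X) (𝒴 : ℤ → Submodule k Y) (φ : X →ₗ[k] Y) {a b : ℤ}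
    (h : ∀ d, ∀ x ∈ 𝒳 (a + d), φ x ∈ 𝒴 (b + d)) {d : ℤ} {t : P k i ⊗[k] X}
    (ht : t ∈ tensorGrade (P k i).deg 𝒳 (a + d)) :
    tmap i φ t ∈ tensorGrade (P k i).deg 𝒴 (b + d) :=
  map_mem_of_tensorGrade ((tmap i φ).restrictScalars k) _ (fun p q hpq m hm v hv =>
    tmul_mem_tensorGrade (show p + (b + (q - a)) = b + d by omega) hm
      (h (q - a) v (by rwa [add_sub_cancel]))) t ht

theorem tmap_mem_zero_left {X Y : Type u} [AddCommGroup X] [Module k X] [AddCommGroup Y]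
    [Module k Y] (𝒳 : ℤ → Submodule k X) (𝒴 : ℤ → Submodule k Y) (φ : X →ₗ[k] Y) {b : ℤ}
    (h : ∀ d, ∀ x ∈ 𝒳 d, φ x ∈ 𝒴 (b + d)) {d : ℤ} {t : P k i ⊗[k] X}
    (ht : t ∈ tensorGrade (P k i).deg 𝒳 d) : tmap i φ t ∈ tensorGrade (P k i).deg 𝒴 (b + d) :=
  tmap_mem i 𝒳 𝒴 φ (a := 0) (fun d x hx => h d x (by rwa [zero_add] at hx)) (by rwa [zero_add])

theorem tmap_mem_zero_right {X Y : Type u} [AddCommGroup X] [Module k X] [AddCommGroup Y]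
    [Module k Y] (𝒳 : ℤ → Submodule k X) (𝒴 : ℤ → Submodule k Y) (φ : X →ₗ[k] Y) {a : ℤ}
    (h : ∀ d, ∀ x ∈ 𝒳 (a + d), φ x ∈ 𝒴 d) {d : ℤ} {t : P k i ⊗[k] X}
    (ht : t ∈ tensorGrade (P k i).deg 𝒳 (a + d)) : tmap i φ t ∈ tensorGrade (P k i).deg 𝒴 d := by
  have := tmap_mem i 𝒳 𝒴 φ (b := 0) (fun d x hx => by rw [zero_add]; exact h d x hx) ht
  rwa [zero_add] at this

theorem zCorner_cornerMap {M N : GrProj k n} (φ : M ⟶ N) (m : corner i M) :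
    zCorner i N (cornerMap i φ m) = cornerMap i φ (zCorner i M m) :=
  Subtype.ext (map_smul (lin φ) _ _).symm

/-- The map `b ⊗ m ↦ χ(b) m - ε(b) z m`, where `χ` and `ε` are the coefficients of `eᵢ` and
of `zᵢ`. -/
def cornerDiff : corner i (tensorObj i M) →ₗ[k] corner i M :=
  cornerECoeff i M - zCorner i M ∘ₗ cornerZCoeff i M

/-- The map `m ↦ z ⊗ m - e ⊗ z m`. -/
def cornerCodiff : corner i M →ₗ[k] corner i (tensorObj i M) :=
  cornerLoop i M - cornerUnit i M ∘ₗ zCorner i M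

theorem cornerDiff_comp_unit : cornerDiff i M ∘ₗ cornerUnit i M = LinearMap.id := by
  rw [cornerDiff, LinearMap.sub_comp, LinearMap.comp_assoc, cornerZCoeff_comp_unit,
    cornerECoeff_comp_unit, LinearMap.comp_zero, sub_zero]

theorem cornerZCoeff_comp_codiff : cornerZCoeff i M ∘ₗ cornerCodiff i M = LinearMap.id := by
  rw [cornerCodiff, LinearMap.comp_sub, ← LinearMap.comp_assoc, cornerZCoeff_comp_unit,
    cornerZCoeff_comp_loop, LinearMap.zero_comp, sub_zero]

theorem eq_unit_add_loop (w : corner i (tensorObj i M)) :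
    (w.1 : P k i ⊗[k] corner i M) =
      eP k i ⊗ₜ cornerECoeff i M w + zP k i ⊗ₜ cornerZCoeff i M w :=
  w.2.symm.trans (e_smul_eq i w.1)

/-- Coevaluation sends m to z ⊗ m + e ⊗ zm. It accounts for the coefficient at z but contributes zm
at e; `cornerDiff` subtracts that contribution. -/
theorem coeval_add_unit_diff (w : corner i (tensorObj i M)) :
    coevalBase i M (cornerZCoeff i M w).1 + eP k i ⊗ₜ cornerDiff i M w = w.1 := by
  rw [coevalBase_corner]
  refine Eq.trans ?_ (eq_unit_add_loop i M w).symm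
  change _ + eP k i ⊗ₜ (cornerECoeff i M w - zCorner i M (cornerZCoeff i M w)) = _
  rw [TensorProduct.tmul_sub]
  abel

/-- The two terms of coevaluation on e ⊗ m give z ⊗ (e ⊗ m) and e ⊗ (z ⊗ m). The inner coefficient
at z keeps only the second. -/
theorem coeval_loop_aux (m : corner i M) :
    tmap i (cornerZCoeff i M) (zP k i ⊗ₜ cornerUnit i M m) +
      tmap i (cornerZCoeff i M) (eP k i ⊗ₜ zCorner i (tensorObj i M) (cornerUnit i M m)) =
      eP k i ⊗ₜ m := by
  have h1 : zCorner i (tensorObj i M) (cornerUnit i M m) = cornerLoop i M m := by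
    refine Subtype.ext ?_
    change z k i • (eP k i ⊗ₜ[k] m) = zP k i ⊗ₜ[k] m
    rw [z_smul_eq, eProj_eP]
  rw [h1]
  change zP k i ⊗ₜ[k] (cornerZCoeff i M (cornerUnit i M m)) +
    eP k i ⊗ₜ[k] (cornerZCoeff i M (cornerLoop i M m)) = _
  have h2 : cornerZCoeff i M (cornerUnit i M m) = 0 := zProj_eP (k := k) i m
  have h3 : cornerZCoeff i M (cornerLoop i M m) = m := zProj_zP (k := k) i m
  rw [h2, h3, TensorProduct.tmul_zero, zero_add]

/-- Evaluation identifies z ⊗ m with e ⊗ zm, so their difference spans its kernel on this corner. -/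
theorem evalLin_codiff (m : corner i M) : evalLin i M (cornerCodiff i M m).1 = 0 := by
  refine (map_sub (evalLin i M) (zP k i ⊗ₜ m) (eP k i ⊗ₜ zCorner i M m)).trans ?_
  change z k i • m.1 - e k i • (z k i • m.1) = 0
  rw [← mul_smul, e_mul_z, sub_self]

theorem codiff_add_unit_eval (w : corner i (tensorObj i M)) :
    (zP k i ⊗ₜ[k] cornerZCoeff i M w - eP k i ⊗ₜ[k] zCorner i M (cornerZCoeff i M w)) +
      eP k i ⊗ₜ[k] (show corner i M from cornerMap i ((fNat i).app M) w) = w.1 := by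
  refine Eq.trans ?_ (eq_unit_add_loop i M w).symm
  have h : (show corner i M from cornerMap i ((fNat i).app M) w) =
      cornerECoeff i M w + zCorner i M (cornerZCoeff i M w) :=
    Subtype.ext (evalLin_corner i M w)
  rw [h]
  rw [TensorProduct.tmul_add]
  abel

/-! #### The splittings of `Pᵢ ⊗ eᵢ Pᵢ ⊗ eᵢ M` -/

/-- The natural transformation `a ⊗ m ↦ a ⊗ e ⊗ m`. -/
def unitOut (i : Fin n) :
    (tensor i ⋙ shift 1 : GrProj k n ⥤ GrProj k n) ⟶ (tensor i ⋙ shift 1) ⋙ tensor i where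
  app M := mkHom (M := shiftObj 1 (tensorObj i M)) (N := tensorObj i (shiftObj 1 (tensorObj i M)))
    (tmap i (cornerUnit i M)) fun _ _ => tmap_mem_zero_right i (cornerDeg i M)
      (cornerDeg i (shiftObj 1 (tensorObj i M))) _ fun _ _ hm => cornerUnit_mem i M hm
  naturality M N φ := by
    ext t
    refine (tmap_tmap i _ _ t).trans (Eq.trans ?_ (tmap_tmap i _ _ t).symm)
    rfl

/-- The natural transformation `a ⊗ b ⊗ m ↦ ε(b) a ⊗ m`. -/
def loopCoeffOut (i : Fin n) :
    (tensor i ⋙ shift 1 : GrProj k n ⥤ GrProj k n) ⋙ tensor i ⟶ tensor i where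
  app M := mkHom (M := tensorObj i (shiftObj 1 (tensorObj i M))) (N := tensorObj i M)
    (tmap i (cornerZCoeff i M)) fun d t ht => by
      have := tmap_mem_zero_left i (cornerDeg i (shiftObj 1 (tensorObj i M))) (cornerDeg i M)
        (cornerZCoeff i M) (b := 0)
        (fun _ _ hm => by rw [zero_add]; exact cornerZCoeff_mem i M hm) ht
      rwa [zero_add] at this
  naturality M N φ := by
    ext t
    refine (tmap_tmap i _ _ t).trans (Eq.trans ?_ (tmap_tmap i _ _ t).symm)
    refine congrArg (fun ψ => tmap i ψ t) (LinearMap.ext fun w => ?_)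
    exact zProj_tmap i (cornerMap i φ) w.1

/-- The natural transformation `a ⊗ b ⊗ m ↦ χ(b) a ⊗ m - ε(b) a ⊗ z m`. -/
def diffOut (i : Fin n) :
    (tensor i ⋙ shift 1 : GrProj k n ⥤ GrProj k n) ⋙ tensor i ⟶ tensor i ⋙ shift 1 where
  app M := mkHom (M := tensorObj i (shiftObj 1 (tensorObj i M))) (N := shiftObj 1 (tensorObj i M))
    (tmap i (cornerDiff i M)) fun _ _ => tmap_mem_zero_left i
        (cornerDeg i (shiftObj 1 (tensorObj i M))) (cornerDeg i M)
        (cornerDiff i M) fun _ _ hm => sub_mem (cornerECoeff_mem i M hm)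
          (zCorner_mem i M (cornerZCoeff_mem i M hm))
  naturality M N φ := by
    ext t
    refine (tmap_tmap i _ _ t).trans (Eq.trans ?_ (tmap_tmap i _ _ t).symm)
    refine congrArg (fun ψ => tmap i ψ t) (LinearMap.ext fun w => ?_)
    refine (congrArg₂ (· - ·) (eProj_tmap i (cornerMap i φ) w.1)
      ((congrArg (zCorner i N) (zProj_tmap i (cornerMap i φ) w.1)).trans
        (zCorner_cornerMap i φ _))).trans (map_sub (cornerMap i φ) _ _).symm

/-- The natural transformation `a ⊗ m ↦ a ⊗ e ⊗ m`. -/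
def unitIn (i : Fin n) :
    (tensor i ⋙ shift 1 : GrProj k n ⥤ GrProj k n) ⟶ tensor i ⋙ tensor i ⋙ shift 1 where
  app M := mkHom (M := shiftObj 1 (tensorObj i M)) (N := shiftObj 1 (tensorObj i (tensorObj i M)))
    (tmap i (cornerUnit i M)) fun _ _ => tmap_mem i (cornerDeg i M)
      (cornerDeg i (tensorObj i M)) _ fun _ _ hm => cornerUnit_mem i M hm
  naturality M N φ := by
    ext t
    refine (tmap_tmap i _ _ t).trans (Eq.trans ?_ (tmap_tmap i _ _ t).symm)
    rfl

/-- The natural transformation `a ⊗ b ⊗ m ↦ ε(b) a ⊗ m`. -/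
def loopCoeffIn (i : Fin n) :
    (tensor i : GrProj k n ⥤ GrProj k n) ⋙ tensor i ⋙ shift 1 ⟶ tensor i where
  app M := mkHom (M := shiftObj 1 (tensorObj i (tensorObj i M))) (N := tensorObj i M)
    (tmap i (cornerZCoeff i M)) fun _ _ => tmap_mem_zero_right i
      (cornerDeg i (tensorObj i M)) (cornerDeg i M) _ fun _ _ hm => cornerZCoeff_mem i M hm
  naturality M N φ := by
    ext t
    refine (tmap_tmap i _ _ t).trans (Eq.trans ?_ (tmap_tmap i _ _ t).symm)
    refine congrArg (fun ψ => tmap i ψ t) (LinearMap.ext fun w => ?_)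
    exact zProj_tmap i (cornerMap i φ) w.1

/-- The natural transformation `a ⊗ m ↦ a ⊗ z ⊗ m - a ⊗ e ⊗ z m`. -/
def codiffIn (i : Fin n) :
    (tensor i : GrProj k n ⥤ GrProj k n) ⟶ tensor i ⋙ tensor i ⋙ shift 1 where
  app M := mkHom (M := tensorObj i M) (N := shiftObj 1 (tensorObj i (tensorObj i M)))
    (tmap i (cornerCodiff i M)) fun _ _ => tmap_mem_zero_left i (cornerDeg i M)
      (cornerDeg i (tensorObj i M)) _ fun _ _ hm => sub_mem (cornerLoop_mem i M hm)
        (cornerUnit_mem i M (zCorner_mem i M hm))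
  naturality M N φ := by
    ext t
    refine (tmap_tmap i _ _ t).trans (Eq.trans ?_ (tmap_tmap i _ _ t).symm)
    refine congrArg (fun ψ => tmap i ψ t) (LinearMap.ext fun m => Subtype.ext ?_)
    refine Eq.trans ?_ (map_sub (tmap i (cornerMap i φ)) _ _).symm
    exact congrArg (fun x => _ - eP k i ⊗ₜ[k] x) (zCorner_cornerMap i φ m)

/-! #### The identities -/

/-- This and the next four identities are the hypotheses of `nonempty_coneK_cone_iso` for S = P_i ⊗
e_i(−) and L = S⟨1⟩. -/
theorem unitOut_comp_eval :
    (unitOut i).app M ≫ (fNat i).app ((tensor i ⋙ shift 1).obj M) = 𝟙 _ := by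
  ext t
  refine LinearMap.congr_fun (f := evalLin i (shiftObj 1 (tensorObj i M)) ∘ₗ tmap i (cornerUnit i M))
    (g := LinearMap.id) (linearMap_ext_tmul i fun m => ?_) t
  exact (cornerUnit i M m).2

theorem coeval_comp_loopCoeffOut :
    (tensor i).map ((gNat i).app M) ≫ (loopCoeffOut i).app M = 𝟙 _ := by
  ext t
  refine (tmap_tmap i _ _ t).trans (Eq.trans ?_ (tmap_id i t))
  refine congrArg (fun ψ => tmap i ψ t) (LinearMap.ext fun m => ?_)
  refine (congrArg (zProj i (corner i M)) (coevalBase_corner i M m)).trans ?_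
  rw [map_add, zProj_zP, zProj_eP, add_zero]
  rfl

theorem coeval_comp_diffOut :
    (tensor i).map ((gNat i).app M) ≫ (diffOut i).app M = 0 := by
  ext t
  refine (tmap_tmap i _ _ t).trans (Eq.trans ?_ (tmap_zero i t))
  refine congrArg (fun ψ => tmap i ψ t) (LinearMap.ext fun m => ?_)
  refine (congrArg (fun w => eProj i (corner i M) w - zCorner i M (zProj i (corner i M) w))
    (coevalBase_corner i M m)).trans ?_
  rw [map_add, map_add, zProj_zP, zProj_eP, eProj_eP, eProj_zP, add_zero, zero_add, sub_self]
  rfl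

theorem unitOut_comp_diffOut : (unitOut i).app M ≫ (diffOut i).app M = 𝟙 _ := by
  ext t
  refine (tmap_tmap i _ _ t).trans (Eq.trans ?_ (tmap_id i t))
  exact congrArg (fun ψ => tmap i ψ t) (cornerDiff_comp_unit i M)

theorem coeval_splittingOut :
    ((loopCoeffOut i).app M ≫ (tensor i).map ((gNat i).app M) :
      (tensor i).obj ((tensor i ⋙ shift 1).obj M) ⟶ (tensor i).obj ((tensor i ⋙ shift 1).obj M)) +
      ((diffOut i).app M ≫ (unitOut i).app M : (tensor i).obj ((tensor i ⋙ shift 1).obj M) ⟶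
        (tensor i).obj ((tensor i ⋙ shift 1).obj M)) = 𝟙 _ := by
  ext t
  refine (congrArg₂ (· + ·) (tmap_tmap i _ _ t) (tmap_tmap i _ _ t)).trans
    ((tmap_add i _ _ t).trans (Eq.trans ?_ (tmap_id i t)))
  refine congrArg (fun ψ => tmap i ψ t) (LinearMap.ext fun w => Subtype.ext ?_)
  exact coeval_add_unit_diff i M w

/-- This and the next four identities are the hypotheses of `nonempty_coneK_cone_shift_iso`. Being
Â-linear, the composite need only be computed on the elements e_i ⊗ m. -/
theorem coeval_comp_loopCoeffIn :
    (gNat i).app ((tensor i).obj M) ≫ (loopCoeffIn i).app M = 𝟙 _ := by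
  ext t
  refine LinearMap.congr_fun (f := tmap i (cornerZCoeff i M) ∘ₗ coevalLin i (tensorObj i M))
    (g := LinearMap.id) (linearMap_ext_tmul i fun m => ?_) t
  refine (congrArg (tmap i (cornerZCoeff i M))
    (coevalBase_corner i (tensorObj i M) (cornerUnit i M m))).trans ?_
  rw [map_add]
  exact coeval_loop_aux i M m

theorem unitIn_comp_eval :
    (unitIn i).app M ≫ (tensor i ⋙ shift 1).map ((fNat i).app M) = 𝟙 _ := by
  ext t
  refine (tmap_tmap i _ _ t).trans (Eq.trans ?_ (tmap_id i t))
  refine congrArg (fun ψ => tmap i ψ t) (LinearMap.ext fun m => Subtype.ext ?_)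
  exact m.2

theorem codiffIn_comp_eval :
    (codiffIn i).app M ≫ (tensor i ⋙ shift 1).map ((fNat i).app M) = 0 := by
  ext t
  refine (tmap_tmap i _ _ t).trans (Eq.trans ?_ (tmap_zero i t))
  refine congrArg (fun ψ => tmap i ψ t) (LinearMap.ext fun m => Subtype.ext ?_)
  exact evalLin_codiff i M m

theorem codiffIn_comp_loopCoeffIn : (codiffIn i).app M ≫ (loopCoeffIn i).app M = 𝟙 _ := by
  ext t
  refine (tmap_tmap i _ _ t).trans (Eq.trans ?_ (tmap_id i t))
  exact congrArg (fun ψ => tmap i ψ t) (cornerZCoeff_comp_codiff i M)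

theorem eval_splittingIn :
    ((loopCoeffIn i).app M ≫ (codiffIn i).app M :
      (tensor i ⋙ shift 1).obj ((tensor i).obj M) ⟶ (tensor i ⋙ shift 1).obj ((tensor i).obj M)) +
      ((tensor i ⋙ shift 1).map ((fNat i).app M) ≫ (unitIn i).app M :
        (tensor i ⋙ shift 1).obj ((tensor i).obj M) ⟶
        (tensor i ⋙ shift 1).obj ((tensor i).obj M)) = 𝟙 _ := by
  ext t
  refine (congrArg₂ (· + ·) (tmap_tmap i _ _ t) (tmap_tmap i _ _ t)).trans
    ((tmap_add i _ _ t).trans (Eq.trans ?_ (tmap_id i t)))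
  refine congrArg (fun ψ => tmap i ψ t) (LinearMap.ext fun w => Subtype.ext ?_)
  exact codiff_add_unit_eval i M w

end GrProj

/-! ### The twists are invertible on isomorphism classes -/

section Inverse

open HomotopyCategory

variable {k : Type u} [Field k] {n : ℕ}

/-- The shift by −1 in the cocone cancels the [1] that appears when one cone is applied to the
other. -/
theorem nonempty_coneK_coconeK_iso (i : Fin n)
    (X : HomotopyCategory (GrProj k n) (ComplexShape.up ℤ)) :
    Nonempty ((coneK (GrProj.fNat i)).obj ((coconeK (GrProj.gNat i)).obj X) ≅ X) := by
  obtain ⟨e₁⟩ := nonempty_coneK_shift_iso (GrProj.fNat i)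
    ((cone (GrProj.gNat i)).obj X.as) (-1 : ℤ)
  obtain ⟨e₂⟩ := nonempty_coneK_cone_iso (GrProj.fNat i) (GrProj.gNat i) (GrProj.unitOut i)
    (GrProj.loopCoeffOut i) (GrProj.diffOut i) (GrProj.unitOut_comp_eval i)
    (GrProj.coeval_comp_loopCoeffOut i) (GrProj.coeval_comp_diffOut i)
    (GrProj.unitOut_comp_diffOut i) (GrProj.coeval_splittingOut i) X.as
  exact ⟨e₁ ≪≫ ((quotient _ (ComplexShape.up ℤ)).commShiftIso (-1 : ℤ)).app _ ≪≫
    (shiftFunctor _ (-1 : ℤ)).mapIso e₂ ≪≫ shiftShiftNeg _ (1 : ℤ)⟩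

theorem nonempty_coconeK_coneK_iso (i : Fin n)
    (X : HomotopyCategory (GrProj k n) (ComplexShape.up ℤ)) :
    Nonempty ((coconeK (GrProj.gNat i)).obj ((coneK (GrProj.fNat i)).obj X) ≅ X) := by
  obtain ⟨e₁⟩ := nonempty_coneK_shift_iso (GrProj.gNat i)
    ((cone (GrProj.fNat i)).obj X.as) (-1 : ℤ)
  obtain ⟨e₂⟩ := nonempty_coneK_cone_shift_iso (GrProj.fNat i) (GrProj.gNat i)
    (GrProj.loopCoeffIn i) (GrProj.codiffIn i) (GrProj.unitIn i) (GrProj.coeval_comp_loopCoeffIn i)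
    (GrProj.unitIn_comp_eval i) (GrProj.codiffIn_comp_eval i)
    (GrProj.codiffIn_comp_loopCoeffIn i) (GrProj.eval_splittingIn i) X.as
  exact ⟨e₁.symm ≪≫ e₂⟩

theorem nonempty_twistInv_twist_iso (i : Fin n) (X : D k n) :
    Nonempty ((twistInvFunctor k i).obj ((twistFunctor k i).obj X) ≅ X) := by
  obtain ⟨e⟩ := nonempty_coneK_coconeK_iso i X.obj
  exact ⟨(bounded (GrProj k n)).fullyFaithfulι.preimageIso e⟩

theorem nonempty_twist_twistInv_iso (i : Fin n) (X : D k n) :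
    Nonempty ((twistFunctor k i).obj ((twistInvFunctor k i).obj X) ≅ X) := by
  obtain ⟨e⟩ := nonempty_coconeK_coneK_iso i X.obj
  exact ⟨(bounded (GrProj k n)).fullyFaithfulι.preimageIso e⟩

end Inverse

/-! ### Exactness properties of projective modules -/

section Exactness

open Zigzag

variable {k : Type u} [Field k] {n : ℕ}

namespace Zigzag

theorem exists_e_mul_eq (l : Fin n) (a : Zigzag k n) :
    ∃ (x y : k) (c : Fin n → Bool → k),
      e k l * a = x • e k l + y • z k l + ∑ j, ∑ b, c j b • arr k l j b := by
  have ha : a ∈ Submodule.span k (basisSet k n) := by rw [span_basisSet]; trivial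
  induction ha using Submodule.span_induction with
  | zero => exact ⟨0, 0, 0, by simp⟩
  | add a b _ _ ha hb =>
    obtain ⟨x, y, c, h⟩ := ha
    obtain ⟨x', y', c', h'⟩ := hb
    refine ⟨x + x', y + y', c + c', ?_⟩
    rw [mul_add, h, h']
    simp only [add_smul, Pi.add_apply, Finset.sum_add_distrib]
    abel
  | smul r a _ ha =>
    obtain ⟨x, y, c, h⟩ := ha
    refine ⟨r * x, r * y, fun j b => r * c j b, ?_⟩
    rw [mul_smul_comm, h]
    simp only [smul_add, Finset.smul_sum, mul_smul]
  | mem a ha =>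
    obtain (⟨i, rfl⟩ | ⟨i, rfl⟩) | ⟨⟨p, q, d⟩, rfl⟩ := ha
    · refine ⟨if l = i then 1 else 0, 0, 0, ?_⟩
      rw [e_mul_e']
      split_ifs with h
      · subst h; simp
      · simp
    · refine ⟨0, if l = i then 1 else 0, 0, ?_⟩
      rw [e_mul_z']
      split_ifs with h
      · subst h; simp
      · simp
    · refine ⟨0, 0, fun j b => if l = p ∧ j = q ∧ b = d then 1 else 0, ?_⟩
      rw [e_mul_arr', Finset.sum_eq_single q (by
        intro j _ hj
        simp [hj]) (by simp), Finset.sum_eq_single d (by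
        intro b _ hb
        simp [hb]) (by simp)]
      by_cases h : l = p
      · subst h; simp
      · simp [h]

theorem exists_eq_of_z_mul_eq_zero {l : Fin n} {a : Zigzag k n} (he : e k l * a = a)
    (hz : z k l * a = 0) :
    ∃ (y : k) (c : Fin n → Bool → k), a = y • z k l + ∑ j, ∑ b, c j b • arr k l j b := by
  obtain ⟨x, y, c, h⟩ := exists_e_mul_eq l a
  rw [he] at h
  refine ⟨y, c, ?_⟩
  rw [h] at hz
  simp only [mul_add, mul_smul_comm, Finset.mul_sum, z_mul_e, z_mul_z, z_mul_arr, smul_zero,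
    Finset.sum_const_zero, add_zero] at hz
  rw [smul_eq_zero, or_iff_left (z_ne_zero l)] at hz
  rw [h, hz, zero_smul, zero_add]

/-- Multiplication by an arrow picks out the coefficient of its dual, so the arrows j ⟶ l separate
the arrows starting at l. -/
theorem arr_mul_eq {j l : Fin n} (hj : j ≠ l) (b : Bool) (y : k) (c : Fin n → Bool → k) :
    arr k j l b * (y • z k l + ∑ j, ∑ b, c j b • arr k l j b) = c j b • z k j := by
  simp only [mul_add, mul_smul_comm, Finset.mul_sum, arr_mul_z, arr_mul_arr, smul_zero, zero_add]
  rw [Finset.sum_eq_single j (fun i _ hi => Finset.sum_eq_zero fun d _ => by simp [hi.symm])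
    (by simp), Finset.sum_eq_single b (fun d _ hd => by simp [hd.symm]) (by simp)]
  simp [hj]

end Zigzag

variable (k n) in
/-- The exactness properties of projective `Â`-modules at the vertex `l`. -/
structure ExactAt (l : Fin n) (V : Type*) [AddCommGroup V] [Module (Zigzag k n) V] : Prop where
  arr_smul_mem : ∀ r : V, e k l • r = r → z k l • r = 0 → ∀ j, j ≠ l → ∀ b,
    ∃ v : V, arr k j l b • r = z k j • v
  mem_of_arr_smul_eq_zero : ∀ r : V, e k l • r = r → z k l • r = 0 →
    (∀ j, j ≠ l → ∀ b, arr k j l b • r = 0) → ∃ v : V, r = z k l • v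

theorem exactAt_self (l : Fin n) : ExactAt k n l (Zigzag k n) where
  arr_smul_mem r he hz j hj b := by
    obtain ⟨y, c, rfl⟩ := exists_eq_of_z_mul_eq_zero he hz
    exact ⟨c j b • 1, by rw [smul_eq_mul, arr_mul_eq hj, smul_eq_mul, mul_smul_comm, mul_one]⟩
  mem_of_arr_smul_eq_zero r he hz h := by
    obtain ⟨y, c, rfl⟩ := exists_eq_of_z_mul_eq_zero he hz
    have hc : ∀ j b, c j b • arr k l j b = 0 := by
      intro j b
      by_cases hj : j = l
      · subst hj; simp
      · have := h j hj b
        rw [smul_eq_mul, arr_mul_eq hj, smul_eq_zero, or_iff_left (z_ne_zero j)] at this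
        rw [this, zero_smul]
    exact ⟨y • 1, by simp [hc]⟩

theorem exactAt_pi (l : Fin n) (ι : Type*) : ExactAt k n l (ι → Zigzag k n) where
  arr_smul_mem r he hz j hj b := by
    choose y hy using fun i => (exactAt_self (k := k) l).arr_smul_mem (r i) (congrFun he i)
      (congrFun hz i) j hj b
    exact ⟨y, funext hy⟩
  mem_of_arr_smul_eq_zero r he hz h := by
    choose y hy using fun i => (exactAt_self (k := k) l).mem_of_arr_smul_eq_zero (r i)
      (congrFun he i) (congrFun hz i) fun j hj b => congrFun (h j hj b) i
    exact ⟨y, funext hy⟩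

theorem exactAt_of_retract {l : Fin n} {V F : Type*} [AddCommGroup V] [Module (Zigzag k n) V]
    [AddCommGroup F] [Module (Zigzag k n) F] (i : V →ₗ[Zigzag k n] F) (q : F →ₗ[Zigzag k n] V)
    (h : ∀ v, q (i v) = v) (hF : ExactAt k n l F) : ExactAt k n l V where
  arr_smul_mem r he hz j hj b := by
    obtain ⟨y, hy⟩ := hF.arr_smul_mem (i r) (by rw [← map_smul, he])
      (by rw [← map_smul, hz, map_zero]) j hj b
    exact ⟨q y, by rw [← map_smul, ← hy, map_smul, h]⟩
  mem_of_arr_smul_eq_zero r he hz h' := by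
    obtain ⟨y, hy⟩ := hF.mem_of_arr_smul_eq_zero (i r) (by rw [← map_smul, he])
      (by rw [← map_smul, hz, map_zero])
      fun j hj b => by rw [← map_smul, h' j hj b, map_zero]
    exact ⟨q y, by rw [← map_smul, ← hy, h]⟩

/-- The properties hold for Â by inspection of coefficients, for powers of Â componentwise, and pass
to direct summands. -/
theorem exactAt_of_projective (l : Fin n) (V : Type*) [AddCommGroup V] [Module (Zigzag k n) V]
    [Module.Finite (Zigzag k n) V] [Module.Projective (Zigzag k n) V] : ExactAt k n l V := by
  obtain ⟨m, q, hq⟩ := Module.Finite.exists_fin' (Zigzag k n) V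
  obtain ⟨i, hi⟩ := Module.projective_lifting_property q LinearMap.id hq
  exact exactAt_of_retract i q (LinearMap.congr_fun hi) (exactAt_pi l _)

end Exactness

/-! ### Linear algebra -/

section LinearAlgebra

variable {k : Type*} [Field k] {V W : Type*} [AddCommGroup V] [Module k V]
  [AddCommGroup W] [Module k W]

open Module

theorem map_pi_submodule {ι : Type*} (p : ι → Submodule k V) (φ : V →ₗ[k] W) :
    (Submodule.pi Set.univ p).map (φ.compLeft ι) = Submodule.pi Set.univ fun i => (p i).map φ := by
  ext f
  constructor
  · rintro ⟨g, hg, rfl⟩ i -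
    exact ⟨g i, hg i trivial, rfl⟩
  · intro hf
    choose g hg using fun i => hf i trivial
    exact ⟨g, fun i _ => (hg i).1, funext fun i => (hg i).2⟩

variable [FiniteDimensional k V]

/-- Rank–nullity on a subspace. The homological statements below are proved as dimension counts with
this formula, without forming homology spaces. -/
theorem finrank_map_add_finrank_inf_ker (φ : V →ₗ[k] W) (p : Submodule k V) :
    finrank k (p.map φ) + finrank k (p ⊓ LinearMap.ker φ : Submodule k V) = finrank k p := by
  have h := (φ.domRestrict p).finrank_range_add_finrank_ker
  rw [LinearMap.range_domRestrict, LinearMap.ker_domRestrict] at h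
  rw [← h]
  congr 1
  rw [← Submodule.finrank_map_subtype_eq p ((LinearMap.ker φ).comap p.subtype),
    Submodule.map_comap_subtype]

theorem finrank_map_of_injOn {φ : V →ₗ[k] W} {p : Submodule k V}
    (h : ∀ v ∈ p, φ v = 0 → v = 0) : finrank k (p.map φ) = finrank k p := by
  rw [← finrank_map_add_finrank_inf_ker φ p, (_ : p ⊓ LinearMap.ker φ = ⊥), finrank_bot, add_zero]
  rw [eq_bot_iff]
  exact fun v hv => h v hv.1 hv.2

theorem finrank_prod_submodule (p q : Submodule k V) :
    finrank k (p.prod q) = finrank k p + finrank k q := by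
  let e : p.prod q ≃ₗ[k] p × q :=
    { toFun := fun x => (⟨x.1.1, x.2.1⟩, ⟨x.1.2, x.2.2⟩)
      invFun := fun x => ⟨(x.1.1, x.2.1), x.1.2, x.2.2⟩
      map_add' := fun _ _ => rfl
      map_smul' := fun _ _ => rfl
      left_inv := fun _ => rfl
      right_inv := fun _ => rfl }
  rw [e.finrank_eq, Module.finrank_prod]

theorem finrank_pi_submodule {ι : Type*} [Fintype ι]
    (p : ι → Submodule k V) :
    finrank k (Submodule.pi Set.univ p) = ∑ i, finrank k (p i) := by
  let e : Submodule.pi Set.univ p ≃ₗ[k] ((i : ι) → p i) :=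
    { toFun := fun f i => ⟨f.1 i, f.2 i trivial⟩
      invFun := fun f => ⟨fun i => (f i).1, fun i _ => (f i).2⟩
      map_add' := fun _ _ => rfl
      map_smul' := fun _ _ => rfl
      left_inv := fun _ => rfl
      right_inv := fun _ => rfl }
  rw [e.finrank_eq, Module.finrank_pi_fintype]

end LinearAlgebra

/-! ### Multiplicities of differential modules -/

namespace DiffMod

open Zigzag Module

variable {k : Type u} [Field k] {n : ℕ} {V : Type v} [AddCommGroup V] [Module k V]
  [Module (Zigzag k n) V] [IsScalarTower k (Zigzag k n) V]

variable (k V) in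
/-- Multiplication by an element of the algebra, as a `k`-linear map. -/
def act (a : Zigzag k n) : V →ₗ[k] V where
  toFun v := a • v
  map_add' := smul_add a
  map_smul' r v := smul_comm a r v

@[simp] theorem act_apply (a : Zigzag k n) (v : V) : act k V a v = a • v := rfl

variable (k V) in
/-- The subspace `z_j V`. -/
def socle (j : Fin n) : Submodule k V := LinearMap.range (act k V (z k j))

variable (k V) in
/-- The subspace `e_l V`. -/
def vertex (l : Fin n) : Submodule k V := LinearMap.ker (act k V (e k l) - LinearMap.id)

variable (k V) in
/-- The kernel of `z_l` on `e_l V`. -/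
def rad (l : Fin n) : Submodule k V := vertex k V l ⊓ LinearMap.ker (act k V (z k l))

theorem mem_vertex {l : Fin n} {v : V} : v ∈ vertex k V l ↔ e k l • v = v := by
  simp [vertex, sub_eq_zero]

theorem mem_rad {l : Fin n} {v : V} : v ∈ rad k V l ↔ e k l • v = v ∧ z k l • v = 0 := by
  rw [rad, Submodule.mem_inf, mem_vertex]; rfl

theorem socle_le_rad (l : Fin n) : socle k V l ≤ rad k V l := by
  rintro _ ⟨w, rfl⟩
  rw [mem_rad]
  simp [← mul_smul]

theorem rad_le_vertex (l : Fin n) : rad k V l ≤ vertex k V l := inf_le_left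

theorem map_act_vertex (l : Fin n) : (vertex k V l).map (act k V (z k l)) = socle k V l := by
  ext v
  constructor
  · rintro ⟨w, -, rfl⟩; exact ⟨w, rfl⟩
  · rintro ⟨w, rfl⟩
    exact ⟨e k l • w, mem_vertex.2 (by simp [← mul_smul]), by simp [← mul_smul]⟩

/-- The index set of the arrows out of the vertices `j ≠ l` into `l`. -/
abbrev Arrows (l : Fin n) : Type := {j : Fin n // j ≠ l} × Bool

variable (k V) in
/-- The action of all the arrows `j ⟶ l`. -/
def arrows (l : Fin n) : V →ₗ[k] (Arrows l → V) :=
  LinearMap.pi fun a => act k V (arr k a.1 l a.2)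

theorem arrows_apply (l : Fin n) (v : V) (a : Arrows l) :
    arrows k V l v a = arr k a.1.1 l a.2 • v := rfl

variable (k V) in
/-- The space `⨁ z_j V`, the sum being over the arrows `j ⟶ l`. -/
def socles (l : Fin n) : Submodule k (Arrows l → V) :=
  Submodule.pi Set.univ fun a => socle k V a.1.1

/-- Together with `rad_inf_ker_arrows` this identifies rad/soc at l with the sum of z_jV over the
arrows j ⟶ l. With e_lV/rad ≅ z_lV it gives a three-step filtration of e_lV compatible with D. -/
theorem map_arrows_rad {l : Fin n} (hV : ExactAt k n l V) :
    (rad k V l).map (arrows k V l) = socles k V l := by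
  ext f
  constructor
  · rintro ⟨r, hr, rfl⟩ a -
    obtain ⟨v, hv⟩ := hV.arr_smul_mem r (mem_rad.1 hr).1 (mem_rad.1 hr).2 a.1.1 a.1.2 a.2
    exact ⟨v, hv.symm⟩
  · intro hf
    choose v hv using fun a => hf a trivial
    -- The preimage is built from the dual arrows, since a times its dual is z_j and all other
    -- products vanish.
    refine ⟨∑ a : Arrows l, arr k l a.1.1 a.2 • v a, mem_rad.2 ⟨?_, ?_⟩, ?_⟩
    · simp [Finset.smul_sum, ← mul_smul]
    · simp [Finset.smul_sum, ← mul_smul]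
    · funext a
      rw [arrows_apply, Finset.smul_sum, Finset.sum_eq_single a, ← mul_smul, arr_mul_arr,
        if_pos ⟨rfl, a.1.2, rfl⟩]
      · exact hv a
      · intro b _ hb
        rw [← mul_smul, arr_mul_arr, if_neg, zero_smul]
        rintro ⟨h1, -, h2⟩
        exact hb (Prod.ext (Subtype.ext h1.symm) h2.symm)
      · simp

theorem rad_inf_ker_arrows {l : Fin n} (hV : ExactAt k n l V) :
    rad k V l ⊓ LinearMap.ker (arrows k V l) = socle k V l := by
  refine le_antisymm ?_ (le_inf (socle_le_rad l) ?_)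
  · rintro r ⟨hr, hr'⟩
    obtain ⟨v, hv⟩ := hV.mem_of_arr_smul_eq_zero r (mem_rad.1 hr).1 (mem_rad.1 hr).2
      fun j hj b => congrFun hr' (⟨j, hj⟩, b)
    exact ⟨v, hv.symm⟩
  · rintro _ ⟨v, rfl⟩
    funext a
    rw [arrows_apply, act_apply, ← mul_smul, arr_mul_z, zero_smul]
    rfl

variable (D : V →ₗ[Zigzag k n] V)

/-- The dimension of the homology of `z_j V`. -/
def mult (j : Fin n) : ℤ :=
  finrank k (socle k V j) - 2 * finrank k ((socle k V j).map (D.restrictScalars k))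

/-- The image of the elements `v` of `e_l V` with `z_l D v = 0` under the connecting map. -/
def connecting (l : Fin n) : Submodule k (Arrows l → V) :=
  (vertex k V l ⊓ LinearMap.ker (act k V (z k l) ∘ₗ D.restrictScalars k)).map
    (arrows k V l ∘ₗ D.restrictScalars k)

/-- The rank of the connecting map for the twist in `P_l`. -/
def rkPos (l : Fin n) : ℤ :=
  finrank k (connecting D l) -
    finrank k ((socles k V l).map ((D.restrictScalars k).compLeft (Arrows l)))

/-- The rank of the connecting map for the inverse twist in `P_l`. -/
def rkNeg (l : Fin n) : ℤ :=
  finrank k ((rad k V l).map (D.restrictScalars k) ⊓ socle k V l : Submodule k V) -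
    finrank k ((socle k V l).map (D.restrictScalars k))

variable {D}

theorem map_socle_le (j : Fin n) : (socle k V j).map (D.restrictScalars k) ≤ socle k V j := by
  rintro _ ⟨_, ⟨v, rfl⟩, rfl⟩
  exact ⟨D v, (map_smul D _ _).symm⟩

theorem map_vertex_le (l : Fin n) : (vertex k V l).map (D.restrictScalars k) ≤ vertex k V l := by
  rintro _ ⟨v, hv, rfl⟩
  rw [mem_vertex]
  exact (map_smul D _ _).symm.trans (congrArg D (mem_vertex.1 hv))

theorem map_rad_le (l : Fin n) : (rad k V l).map (D.restrictScalars k) ≤ rad k V l := by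
  rintro _ ⟨v, hv, rfl⟩
  obtain ⟨h1, h2⟩ := mem_rad.1 hv
  rw [mem_rad]
  exact ⟨(map_smul D _ _).symm.trans (congrArg D h1),
    (map_smul D _ _).symm.trans ((congrArg D h2).trans (map_zero D))⟩

theorem map_socles_le_connecting {l : Fin n} (hV : ExactAt k n l V) :
    (socles k V l).map ((D.restrictScalars k).compLeft (Arrows l)) ≤ connecting D l := by
  rw [← map_arrows_rad hV]
  rintro _ ⟨_, ⟨r, hr, rfl⟩, rfl⟩
  obtain ⟨h1, h2⟩ := mem_rad.1 hr
  refine ⟨r, ⟨mem_vertex.2 h1, ?_⟩, ?_⟩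
  · exact (map_smul D _ _).symm.trans ((congrArg D h2).trans (map_zero D))
  · funext a
    exact (map_smul D _ _).symm

theorem map_act_map (a : Zigzag k n) (p : Submodule k V) :
    (p.map (D.restrictScalars k)).map (act k V a) =
      (p.map (act k V a)).map (D.restrictScalars k) := by
  rw [← Submodule.map_comp, ← Submodule.map_comp]
  congr 1
  ext v
  exact (map_smul D _ _).symm

theorem map_arrows_map (l : Fin n) (p : Submodule k V) :
    (p.map (D.restrictScalars k)).map (arrows k V l) =
      (p.map (arrows k V l)).map ((D.restrictScalars k).compLeft (Arrows l)) := by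
  rw [← Submodule.map_comp, ← Submodule.map_comp]
  congr 1
  ext v a
  exact (map_smul D _ _).symm

theorem map_socle_le_inf (l : Fin n) : (socle k V l).map (D.restrictScalars k) ≤
    (rad k V l).map (D.restrictScalars k) ⊓ socle k V l :=
  le_inf (Submodule.map_mono (socle_le_rad l)) (map_socle_le l)

variable [FiniteDimensional k V]

theorem finrank_vertex (l : Fin n) :
    finrank k (vertex k V l) = finrank k (rad k V l) + finrank k (socle k V l) := by
  rw [← finrank_map_add_finrank_inf_ker (act k V (z k l)) (vertex k V l), map_act_vertex,
    add_comm]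
  rfl

theorem finrank_rad {l : Fin n} (hV : ExactAt k n l V) :
    finrank k (rad k V l) = finrank k (socle k V l) + finrank k (socles k V l) := by
  rw [← finrank_map_add_finrank_inf_ker (arrows k V l) (rad k V l), map_arrows_rad hV,
    rad_inf_ker_arrows hV, add_comm]

theorem mult_nonneg (hD : ∀ v, D (D v) = 0) (j : Fin n) : 0 ≤ mult D j := by
  have h := finrank_map_add_finrank_inf_ker (D.restrictScalars k) (socle k V j)
  have h' : (socle k V j).map (D.restrictScalars k) ≤
      socle k V j ⊓ LinearMap.ker (D.restrictScalars k) := by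
    refine le_inf (map_socle_le j) ?_
    rintro _ ⟨v, -, rfl⟩
    exact hD v
  have := Submodule.finrank_mono h'
  rw [mult]
  omega

/-- The sum of the multiplicities at the vertices different from `l`. -/
def multSum (D : V →ₗ[Zigzag k n] V) (l : Fin n) : ℤ :=
  ∑ j ∈ Finset.univ.erase l, mult D j

/-- The factor 2 on the right is the number of arrows j ⟶ l for each j ≠ l. -/
theorem finrank_socles (l : Fin n) :
    (finrank k (socles k V l) : ℤ) -
      2 * finrank k ((socles k V l).map ((D.restrictScalars k).compLeft (Arrows l))) =
      2 * multSum D l := by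
  rw [socles, map_pi_submodule, finrank_pi_submodule, finrank_pi_submodule]
  push_cast
  rw [Finset.mul_sum, ← Finset.sum_sub_distrib]
  change ∑ a : Arrows l, mult D a.1.1 = _
  rw [Fintype.sum_prod_type, multSum, Finset.mul_sum,
    Finset.sum_subtype (p := fun j => j ≠ l) _ (by simp)]
  exact Finset.sum_congr rfl fun j _ => by simp [two_mul]

/-- This computes the rank of D on e_lV/z_lV, which governs the twist. The sum is filtered by its
image under z_l, then by the image of the kernel under the arrows; what remains is z_lV. -/
theorem finrank_map_vertex_sup {l : Fin n} (hV : ExactAt k n l V) :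
    finrank k ((vertex k V l).map (D.restrictScalars k) ⊔ socle k V l : Submodule k V) =
      finrank k ((socle k V l).map (D.restrictScalars k)) + finrank k (socle k V l) +
        finrank k (connecting D l) := by
  set S := (vertex k V l).map (D.restrictScalars k) ⊔ socle k V l with hS
  have hSE : S ≤ vertex k V l :=
    sup_le (map_vertex_le l) ((socle_le_rad l).trans (rad_le_vertex l))
  have hUz : (socle k V l).map (act k V (z k l)) = ⊥ := by
    rw [eq_bot_iff]
    rintro _ ⟨v, hv, rfl⟩
    exact (mem_rad.1 (socle_le_rad l hv)).2
  have h1 : S.map (act k V (z k l)) = (socle k V l).map (D.restrictScalars k) := by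
    rw [hS, Submodule.map_sup, map_act_map, map_act_vertex, hUz, sup_bot_eq]
  -- The summand z_lV is killed by z_l and by all arrows, so only the summand D v matters.
  have h2 : (S ⊓ LinearMap.ker (act k V (z k l))).map (arrows k V l) = connecting D l := by
    ext f
    constructor
    · rintro ⟨x, ⟨hx, hx'⟩, rfl⟩
      obtain ⟨_, ⟨v, hv, rfl⟩, u, hu, rfl⟩ := Submodule.mem_sup.1 hx
      have hu' := hu
      rw [← rad_inf_ker_arrows hV] at hu'
      refine ⟨v, ⟨hv, ?_⟩, ?_⟩
      · have hx' : act k V (z k l) (D.restrictScalars k v + u) = 0 := hx'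
        rw [map_add, show act k V (z k l) u = 0 from (mem_rad.1 hu'.1).2, add_zero] at hx'
        exact hx'
      · rw [map_add, show arrows k V l u = 0 from hu'.2, add_zero]
        rfl
    · rintro ⟨v, ⟨hv, hv'⟩, rfl⟩
      exact ⟨D v, ⟨Submodule.mem_sup_left ⟨v, hv, rfl⟩, hv'⟩, rfl⟩
  have h3 : S ⊓ LinearMap.ker (act k V (z k l)) ⊓ LinearMap.ker (arrows k V l) =
      socle k V l := by
    refine le_antisymm ?_ ?_
    · rw [← rad_inf_ker_arrows hV]
      exact inf_le_inf_right _ (inf_le_inf_right _ hSE)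
    · refine le_inf (le_inf le_sup_right ?_) ?_
      · exact (socle_le_rad l).trans inf_le_right
      · rw [← rad_inf_ker_arrows hV]
        exact inf_le_right
  rw [← finrank_map_add_finrank_inf_ker (act k V (z k l)) S, h1,
    ← finrank_map_add_finrank_inf_ker (arrows k V l) (S ⊓ LinearMap.ker (act k V (z k l))), h2, h3]
  ring

/-- The analogous rank of D on the radical part, which governs the inverse twist. -/
theorem finrank_map_rad {l : Fin n} (hV : ExactAt k n l V) :
    finrank k ((rad k V l).map (D.restrictScalars k)) =
      finrank k ((socles k V l).map ((D.restrictScalars k).compLeft (Arrows l))) +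
        finrank k ((rad k V l).map (D.restrictScalars k) ⊓ socle k V l : Submodule k V) := by
  rw [← finrank_map_add_finrank_inf_ker (arrows k V l) ((rad k V l).map (D.restrictScalars k)),
    map_arrows_map, map_arrows_rad hV, ← rad_inf_ker_arrows hV, ← inf_assoc,
    inf_eq_left.2 (map_rad_le (D := D) l)]

theorem rkPos_nonneg {l : Fin n} (hV : ExactAt k n l V) : 0 ≤ rkPos D l := by
  have := Submodule.finrank_mono (map_socles_le_connecting (D := D) hV)
  rw [rkPos]
  omega

theorem rkNeg_nonneg (l : Fin n) : 0 ≤ rkNeg D l := by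
  have := Submodule.finrank_mono (map_socle_le_inf (D := D) l)
  rw [rkNeg]
  omega

/-- The connecting map has values in H(z_lV): its representatives lie in z_lV and are killed by D
because D² = 0. -/
theorem rkNeg_le_mult (hD : ∀ v, D (D v) = 0) (l : Fin n) : rkNeg D l ≤ mult D l := by
  have h := finrank_map_add_finrank_inf_ker (D.restrictScalars k) (socle k V l)
  have h' : (rad k V l).map (D.restrictScalars k) ⊓ socle k V l ≤
      socle k V l ⊓ LinearMap.ker (D.restrictScalars k) := by
    rintro x ⟨⟨v, -, rfl⟩, hx⟩
    exact ⟨hx, hD v⟩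
  have := Submodule.finrank_mono h'
  rw [mult, rkNeg]
  omega

/-- The connecting map is defined on H(z_lV). The inequality follows from the ranks of D on e_lV and
on its radical part, and from D z_l V ⊆ z_l(e_lV ∩ ker D). -/
theorem rkPos_le_mult (hD : ∀ v, D (D v) = 0) {l : Fin n} (hV : ExactAt k n l V) :
    rkPos D l ≤ mult D l := by
  have h1 := finrank_map_add_finrank_inf_ker (D.restrictScalars k) (vertex k V l)
  have h2 := finrank_map_add_finrank_inf_ker (D.restrictScalars k) (rad k V l)
  have h3 := finrank_map_add_finrank_inf_ker (act k V (z k l))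
    (vertex k V l ⊓ LinearMap.ker (D.restrictScalars k))
  have h4 : (socle k V l).map (D.restrictScalars k) ≤
      (vertex k V l ⊓ LinearMap.ker (D.restrictScalars k)).map (act k V (z k l)) := by
    rw [← map_act_vertex, ← map_act_map]
    refine Submodule.map_mono (le_inf (map_vertex_le l) ?_)
    rintro _ ⟨v, -, rfl⟩
    exact hD v
  have h5 : vertex k V l ⊓ LinearMap.ker (D.restrictScalars k) ⊓
      LinearMap.ker (act k V (z k l)) = rad k V l ⊓ LinearMap.ker (D.restrictScalars k) := by
    rw [rad, inf_right_comm]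
  rw [h5] at h3
  have h6 := Submodule.finrank_mono h4
  have h7 := finrank_map_rad (D := D) hV
  have h8 := finrank_map_vertex_sup (D := D) hV
  have h9 := Submodule.finrank_sup_add_finrank_inf_eq ((vertex k V l).map (D.restrictScalars k))
    (socle k V l)
  have h10 : (rad k V l).map (D.restrictScalars k) ⊓ socle k V l ≤
      (vertex k V l).map (D.restrictScalars k) ⊓ socle k V l :=
    inf_le_inf_right _ (Submodule.map_mono (rad_le_vertex l))
  have h11 := Submodule.finrank_mono h10
  have h12 := finrank_vertex (k := k) (V := V) l
  rw [mult, rkPos]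
  omega

end DiffMod

namespace DiffMod

set_option linter.unusedSectionVars false

/-! ### The effect of the twists on multiplicities -/

open Zigzag Module

variable {k : Type u} [Field k] {n : ℕ} {V W V' : Type v}
  [AddCommGroup V] [Module k V] [Module (Zigzag k n) V] [IsScalarTower k (Zigzag k n) V]
  [AddCommGroup W] [Module k W] [Module (Zigzag k n) W] [IsScalarTower k (Zigzag k n) W]
  [AddCommGroup V'] [Module k V'] [Module (Zigzag k n) V'] [IsScalarTower k (Zigzag k n) V']

/-- The differential module `W` behaves like `P_l ⊗ e_l V`; here `ω v = z_l ⊗ e_l v`, and `χ` and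
`ε` take the coefficients of `e_l` and of `z_l`. -/
structure IsTensor (l : Fin n) (D : V →ₗ[Zigzag k n] V) (DW : W →ₗ[Zigzag k n] W)
    (ω : V →ₗ[k] W) (χ ε : W →ₗ[k] V) : Prop where
  comm : ∀ v, DW (ω v) = ω (D v)
  e_smul_χ : ∀ w, e k l • χ w = χ w
  e_smul_ε : ∀ w, e k l • ε w = ε w
  ε_ω : ∀ v, ε (ω v) = e k l • v
  z_smul : ∀ w, z k l • w = ω (χ w)
  exists_ω_eq : ∀ v, ∃ w, ω v = z k l • w
  eq_ω_ε : ∀ w, e k l • w = w → z k l • w = 0 → w = ω (ε w)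
  z_smul_ne : ∀ j, j ≠ l → ∀ w : W, z k j • w = 0

/-- The module `V'` is the direct sum of `V` and `W`. -/
structure IsSum (I : V →ₗ[Zigzag k n] V') (J : W →ₗ[Zigzag k n] V') : Prop where
  exists_eq : ∀ x, ∃ v w, x = I v + J w
  eq_zero : ∀ v w, I v + J w = 0 → v = 0 ∧ w = 0

namespace IsSum

variable {I : V →ₗ[Zigzag k n] V'} {J : W →ₗ[Zigzag k n] V'}

theorem eq_of_eq (h : IsSum I J) {v v' : V} {w w' : W} (H : I v + J w = I v' + J w') : v = v' ∧ w = w' := by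
  have := h.eq_zero (v - v') (w - w') (by rw [map_sub, map_sub, sub_add_sub_comm, H, sub_self])
  exact ⟨sub_eq_zero.1 this.1, sub_eq_zero.1 this.2⟩

theorem inl_eq_zero (h : IsSum I J) {v : V} (H : I v = 0) : v = 0 :=
  (h.eq_zero v 0 (by rw [map_zero, add_zero, H])).1

theorem smul_eq (h : IsSum I J) {a : Zigzag k n} {v v' : V} {w w' : W} (H : a • (I v + J w) = I v' + J w') :
    a • v = v' ∧ a • w = w' :=
  h.eq_of_eq (by rw [map_smul, map_smul, ← smul_add, H])

end IsSum

section

variable {l : Fin n} {D : V →ₗ[Zigzag k n] V} {DW : W →ₗ[Zigzag k n] W} {ω : V →ₗ[k] W}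
  {χ ε : W →ₗ[k] V} {I : V →ₗ[Zigzag k n] V'} {J : W →ₗ[Zigzag k n] V'}
  {D' : V' →ₗ[Zigzag k n] V'}

theorem IsTensor.eq_zero (hW : IsTensor l D DW ω χ ε) {v : V} (hv : v ∈ vertex k V l)
    (h : ω v = 0) : v = 0 := by
  rw [← mem_vertex.1 hv, ← hW.ε_ω, h, map_zero]

/-- For j ≠ l nothing changes, as z_j kills P_l. -/
theorem socle_eq_map (hW : IsTensor l D DW ω χ ε) (hs : IsSum I J) {j : Fin n} (hj : j ≠ l) :
    socle k V' j = (socle k V j).map (I.restrictScalars k) := by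
  ext x
  constructor
  · rintro ⟨x, rfl⟩
    obtain ⟨v, w, rfl⟩ := hs.exists_eq x
    refine ⟨z k j • v, ⟨v, rfl⟩, ?_⟩
    rw [act_apply, smul_add, ← map_smul, ← map_smul, hW.z_smul_ne j hj, map_zero, add_zero]
    rfl
  · rintro ⟨_, ⟨v, rfl⟩, rfl⟩
    exact ⟨I v, (map_smul I _ _).symm⟩

/-- At l the new summand contributes z_l ⊗ e_lV, a copy of all of e_lV. -/
theorem socle_eq_map_coprod (hW : IsTensor l D DW ω χ ε) (hs : IsSum I J) :
    socle k V' l = ((socle k V l).prod (vertex k V l)).map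
      ((I.restrictScalars k).coprod (J.restrictScalars k ∘ₗ ω)) := by
  ext x
  constructor
  · rintro ⟨x, rfl⟩
    obtain ⟨v, w, rfl⟩ := hs.exists_eq x
    refine ⟨(z k l • v, χ w), ⟨⟨v, rfl⟩, mem_vertex.2 (hW.e_smul_χ w)⟩, ?_⟩
    simp [← hW.z_smul]
  · rintro ⟨⟨_, m⟩, ⟨⟨v, rfl⟩, -⟩, rfl⟩
    obtain ⟨w, hw⟩ := hW.exists_ω_eq m
    exact ⟨I v + J w, by simp [hw]⟩

variable [FiniteDimensional k V] [FiniteDimensional k V']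

theorem finrank_socle_self (hW : IsTensor l D DW ω χ ε) (hs : IsSum I J) :
    finrank k (socle k V' l) = finrank k (socle k V l) + finrank k (vertex k V l) := by
  rw [socle_eq_map_coprod hW hs, finrank_map_of_injOn]
  · exact finrank_prod_submodule _ _
  · rintro ⟨v, m⟩ ⟨-, hm⟩ h
    obtain ⟨h1, h2⟩ := hs.eq_zero v (ω m) (by simpa using h)
    exact Prod.ext h1 (hW.eq_zero hm h2)

end

/-! ### Multiplicities and connecting ranks under a twist. -/

section Pos

variable {l : Fin n} {D : V →ₗ[Zigzag k n] V} {DW : W →ₗ[Zigzag k n] W} {ω : V →ₗ[k] W}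
  {χ ε : W →ₗ[k] V} {I : V →ₗ[Zigzag k n] V'} {J : W →ₗ[Zigzag k n] V'}
  {D' : V' →ₗ[Zigzag k n] V'} {g : V →ₗ[Zigzag k n] W}

/-- The differential module `V'` is the twist of `V` in `P_l`. -/
structure IsTwist (l : Fin n) (D : V →ₗ[Zigzag k n] V) (DW : W →ₗ[Zigzag k n] W) (ω : V →ₗ[k] W)
    (I : V →ₗ[Zigzag k n] V') (J : W →ₗ[Zigzag k n] V') (g : V →ₗ[Zigzag k n] W)
    (D' : V' →ₗ[Zigzag k n] V') : Prop extends IsSum I J where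
  map_inl : ∀ v, D' (I v) = I (D v) - J (g v)
  map_inr : ∀ w, D' (J w) = - J (DW w)
  z_smul_g : ∀ v, z k l • g v = ω (z k l • v)

theorem IsTwist.map_socle (hW : IsTensor l D DW ω χ ε) (h : IsTwist l D DW ω I J g D')
    {j : Fin n} (hj : j ≠ l) :
    (socle k V' j).map (D'.restrictScalars k) =
      ((socle k V j).map (D.restrictScalars k)).map (I.restrictScalars k) := by
  rw [socle_eq_map hW h.toIsSum hj]
  ext x
  constructor
  · rintro ⟨_, ⟨_, ⟨v, rfl⟩, rfl⟩, rfl⟩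
    refine ⟨_, ⟨_, ⟨v, rfl⟩, rfl⟩, ?_⟩
    change I (D (z k j • v)) = D' (I (z k j • v))
    rw [h.map_inl, map_smul g, hW.z_smul_ne j hj, map_zero, sub_zero]
  · rintro ⟨_, ⟨_, ⟨v, rfl⟩, rfl⟩, rfl⟩
    refine ⟨_, ⟨_, ⟨v, rfl⟩, rfl⟩, ?_⟩
    change D' (I (z k j • v)) = I (D (z k j • v))
    rw [h.map_inl, map_smul g, hW.z_smul_ne j hj, map_zero, sub_zero]

/-- On z_lV ⊕ e_lV the twisted differential is that of the cone of the inclusion z_lV ⊆ e_lV. Its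
value on (z v, m) depends only on D m + z v. -/
theorem IsTwist.map_socle_self (hD : ∀ v, D (D v) = 0) (hW : IsTensor l D DW ω χ ε)
    (h : IsTwist l D DW ω I J g D') :
    (socle k V' l).map (D'.restrictScalars k) =
      ((vertex k V l).map (D.restrictScalars k) ⊔ socle k V l).map
        (I.restrictScalars k ∘ₗ D.restrictScalars k - J.restrictScalars k ∘ₗ ω) := by
  have key : ∀ v m, D' (I (z k l • v) + J (ω m)) =
      I (D (D m + z k l • v)) - J (ω (D m + z k l • v)) := by
    intro v m
    rw [map_add, h.map_inl, h.map_inr, hW.comm, map_smul g, h.z_smul_g, map_add D, hD, zero_add,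
      map_add ω, map_add J]
    abel
  rw [socle_eq_map_coprod hW h.toIsSum]
  ext x
  constructor
  · rintro ⟨_, ⟨⟨_, m⟩, ⟨⟨v, rfl⟩, hm⟩, rfl⟩, rfl⟩
    exact ⟨D m + z k l • v, Submodule.add_mem_sup ⟨m, hm, rfl⟩ ⟨v, rfl⟩, (key v m).symm⟩
  · rintro ⟨y, hy, rfl⟩
    obtain ⟨_, ⟨m, hm, rfl⟩, _, ⟨v, rfl⟩, rfl⟩ := Submodule.mem_sup.1 hy
    exact ⟨_, ⟨(z k l • v, m), ⟨⟨v, rfl⟩, hm⟩, rfl⟩, key v m⟩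

/-- By exactness of V', an arrow j ⟶ l sends D'x into z_jV', which lies in the summand V. Hence only
the V-component of x contributes, and it satisfies the defining condition in V. -/
theorem IsTwist.connecting_le (hW : IsTensor l D DW ω χ ε) (h : IsTwist l D DW ω I J g D')
    (hV' : ExactAt k n l V') :
    connecting D' l ≤ (connecting D l).map ((I.restrictScalars k).compLeft (Arrows l)) := by
  rintro _ ⟨x, ⟨hx, hx'⟩, rfl⟩
  obtain ⟨v, w, rfl⟩ := h.exists_eq x
  have hD' : D' (I v + J w) = I (D v) + J (- g v - DW w) := by
    rw [map_add, h.map_inl, h.map_inr, map_sub, map_neg]; abel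
  have hx' : z k l • D' (I v + J w) = 0 := hx'
  have h1 : e k l • v = v := (h.smul_eq (mem_vertex.1 hx)).1
  have h2 : z k l • D v = 0 := by
    rw [hD'] at hx'
    exact (h.smul_eq (v' := 0) (w' := 0) (by rw [hx', map_zero, map_zero, add_zero])).1
  refine ⟨_, ⟨v, ⟨mem_vertex.2 h1, h2⟩, rfl⟩, funext fun a => ?_⟩
  change I (arr k a.1.1 l a.2 • D v) = arr k a.1.1 l a.2 • D' (I v + J w)
  obtain ⟨y, hy⟩ := hV'.arr_smul_mem (D' (I v + J w))
    (by rw [← map_smul, mem_vertex.1 hx]) hx' a.1.1 a.1.2 a.2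
  have hy' : arr k a.1.1 l a.2 • D' (I v + J w) ∈ socle k V' a.1.1 := ⟨y, hy.symm⟩
  rw [socle_eq_map hW h.toIsSum a.1.2] at hy'
  obtain ⟨u, -, hu⟩ := hy'
  have hu : I u = arr k a.1.1 l a.2 • D' (I v + J w) := hu
  rw [← hu]
  rw [hD'] at hu
  rw [(h.smul_eq (v' := u) (w' := 0) (by rw [← hu, map_zero, add_zero])).1]

variable [FiniteDimensional k V]

theorem IsTwist.mult_of_ne (hW : IsTensor l D DW ω χ ε) (h : IsTwist l D DW ω I J g D')
    {j : Fin n} (hj : j ≠ l) : mult D' j = mult D j := by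
  rw [mult, mult, h.map_socle hW hj, socle_eq_map hW h.toIsSum hj,
    finrank_map_of_injOn fun v _ hv => h.inl_eq_zero hv,
    finrank_map_of_injOn fun v _ hv => h.inl_eq_zero hv]

variable [FiniteDimensional k V']

/-- H(z_lV') is, up to a shift, the homology of e_lV/z_lV. Its filtration has graded pieces with
homology of dimensions 2∑_{j≠l} m_j and m_l, and the connecting rank is lost twice. -/
theorem IsTwist.mult_self (hD : ∀ v, D (D v) = 0) (hV : ExactAt k n l V)
    (hW : IsTensor l D DW ω χ ε) (h : IsTwist l D DW ω I J g D') :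
    mult D' l = mult D l + 2 * multSum D l - 2 * rkPos D l := by
  -- The parametrisation of the image is injective, because ω is injective on e_lV.
  have h1 : finrank k ((socle k V' l).map (D'.restrictScalars k)) =
      finrank k ((vertex k V l).map (D.restrictScalars k) ⊔ socle k V l : Submodule k V) := by
    rw [h.map_socle_self hD hW, finrank_map_of_injOn]
    intro v hv hv'
    have hv'' : I (D v) + J (- ω v) = 0 := by rw [map_neg, ← sub_eq_add_neg]; exact hv'
    have hE : v ∈ vertex k V l := sup_le (map_vertex_le (D := D) l)
      ((socle_le_rad l).trans (rad_le_vertex l)) hv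
    exact hW.eq_zero hE (neg_eq_zero.1 (h.eq_zero _ _ hv'').2)
  rw [← finrank_socles, mult, mult, rkPos, h1, finrank_socle_self hW h.toIsSum]
  have := finrank_map_vertex_sup (D := D) hV
  have := finrank_vertex (k := k) (V := V) l
  have := finrank_rad hV
  push_cast
  omega

/-- The subtracted ranks on the spaces z_jV are unchanged, and the space of connecting values does
not grow. This monotonicity controls repeated letters. -/
theorem IsTwist.rkPos_le (hW : IsTensor l D DW ω χ ε) (h : IsTwist l D DW ω I J g D')
    (hV' : ExactAt k n l V') : rkPos D' l ≤ rkPos D l := by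
  have hinj : ∀ (p : Submodule k (Arrows l → V)),
      finrank k (p.map ((I.restrictScalars k).compLeft (Arrows l))) = finrank k p :=
    fun p => finrank_map_of_injOn fun f _ hf => funext fun a => h.inl_eq_zero (congrFun hf a)
  have h1 := Submodule.finrank_mono (h.connecting_le hW hV')
  rw [hinj] at h1
  have h2 : (socles k V' l).map ((D'.restrictScalars k).compLeft (Arrows l)) =
      ((socles k V l).map ((D.restrictScalars k).compLeft (Arrows l))).map
        ((I.restrictScalars k).compLeft (Arrows l)) := by
    rw [socles, socles, map_pi_submodule, map_pi_submodule, map_pi_submodule]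
    congr 1
    funext a
    exact h.map_socle hW a.1.2
  rw [rkPos, rkPos, h2, hinj]
  omega

end Pos

/-! ### Multiplicities and connecting ranks under an inverse twist. -/

section Neg

variable {l : Fin n} {D : V →ₗ[Zigzag k n] V} {DW : W →ₗ[Zigzag k n] W} {ω : V →ₗ[k] W}
  {χ ε : W →ₗ[k] V} {I : V →ₗ[Zigzag k n] V'} {J : W →ₗ[Zigzag k n] V'}
  {D' : V' →ₗ[Zigzag k n] V'} {f : W →ₗ[Zigzag k n] V}

/-- The differential module `V'` is the inverse twist of `V` in `P_l`. -/
structure IsTwistInv (l : Fin n) (D : V →ₗ[Zigzag k n] V) (DW : W →ₗ[Zigzag k n] W)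
    (ω : V →ₗ[k] W) (I : V →ₗ[Zigzag k n] V') (J : W →ₗ[Zigzag k n] V')
    (f : W →ₗ[Zigzag k n] V) (D' : V' →ₗ[Zigzag k n] V') : Prop extends IsSum I J where
  map_inl : ∀ v, D' (I v) = I (D v)
  map_inr : ∀ w, D' (J w) = I (f w) - J (DW w)
  f_ω : ∀ v, f (ω v) = z k l • v

theorem IsTwistInv.map_socle (hW : IsTensor l D DW ω χ ε) (h : IsTwistInv l D DW ω I J f D')
    {j : Fin n} (hj : j ≠ l) :
    (socle k V' j).map (D'.restrictScalars k) =
      ((socle k V j).map (D.restrictScalars k)).map (I.restrictScalars k) := by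
  rw [socle_eq_map hW h.toIsSum hj, ← Submodule.map_comp, ← Submodule.map_comp]
  congr 1
  ext v
  exact h.map_inl v

/-- Now z_lV' behaves as the cone of the surjection z_l : e_lV ⟶ z_lV, and the value on (z v, m)
depends only on m + D v. -/
theorem IsTwistInv.map_socle_self (hW : IsTensor l D DW ω χ ε) (hD : ∀ v, D (D v) = 0)
    (h : IsTwistInv l D DW ω I J f D') :
    (socle k V' l).map (D'.restrictScalars k) =
      (vertex k V l).map (I.restrictScalars k ∘ₗ act k V (z k l) -
        J.restrictScalars k ∘ₗ ω ∘ₗ D.restrictScalars k) := by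
  have key : ∀ v m, D' (I (z k l • v) + J (ω m)) =
      I (z k l • (m + D v)) - J (ω (D (m + D v))) := by
    intro v m
    rw [map_add, h.map_inl, h.map_inr, hW.comm, h.f_ω, map_add D, hD, add_zero, smul_add,
      map_add I, map_smul D]
    abel
  rw [socle_eq_map_coprod hW h.toIsSum]
  ext x
  constructor
  · rintro ⟨_, ⟨⟨_, m⟩, ⟨⟨v, rfl⟩, hm⟩, rfl⟩, rfl⟩
    refine ⟨m + D (e k l • v), add_mem hm (map_vertex_le l ⟨e k l • v, ?_, rfl⟩), ?_⟩
    · exact mem_vertex.2 (by simp [← mul_smul])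
    · have := key (e k l • v) m
      rw [← mul_smul, z_mul_e] at this
      exact this.symm
  · rintro ⟨y, hy, rfl⟩
    refine ⟨_, ⟨(z k l • 0, y), ⟨⟨0, rfl⟩, hy⟩, rfl⟩, ?_⟩
    have := key 0 y
    rw [map_zero D, add_zero] at this
    exact this

/-- If I v + J w is killed by z_l, then w lies in z_lW, so J w is in the new socle and its image is
harmless. What remains is D v, and comparing V-components puts it in z_lV. -/
theorem IsTwistInv.map_rad_inf_le (hW : IsTensor l D DW ω χ ε)
    (h : IsTwistInv l D DW ω I J f D') :
    (rad k V' l).map (D'.restrictScalars k) ⊓ socle k V' l ≤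
      (socle k V' l).map (D'.restrictScalars k) ⊔
        ((rad k V l).map (D.restrictScalars k) ⊓ socle k V l).map (I.restrictScalars k) := by
  rintro _ ⟨⟨x, hx, rfl⟩, hx'⟩
  obtain ⟨v, w, rfl⟩ := h.exists_eq x
  obtain ⟨h1, h2⟩ := mem_rad.1 hx
  obtain ⟨hv, hw⟩ := h.smul_eq h1
  obtain ⟨hv', hw'⟩ := h.smul_eq (v' := 0) (w' := 0) (by rw [h2, map_zero, map_zero, add_zero])
  have hω := hW.eq_ω_ε w hw hw'
  set m := ε w with hm
  have hD' : D' (I v + J w) = I (D v + z k l • m) + J (- ω (D m)) := by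
    rw [hω, map_add, h.map_inl, h.map_inr, h.f_ω, hW.comm, map_add I, map_neg]
    abel
  obtain ⟨w', hw''⟩ := hW.exists_ω_eq m
  have hJ : J w ∈ socle k V' l := ⟨J w', by rw [act_apply, ← map_smul, ← hw'', ← hω]⟩
  have hx' : D' (I v + J w) ∈ socle k V' l := hx'
  have hDv : D v ∈ socle k V l := by
    rw [socle_eq_map_coprod hW h.toIsSum] at hx'
    obtain ⟨⟨u, m'⟩, ⟨hu, -⟩, hum⟩ := hx'
    have hum : I u + J (ω m') = D' (I v + J w) := by simpa using hum
    rw [hD'] at hum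
    have := (h.eq_of_eq hum).1
    have hu : u ∈ socle k V l := hu
    rw [this] at hu
    have hm' : z k l • m ∈ socle k V l := ⟨m, rfl⟩
    exact (Submodule.add_mem_iff_left _ hm').1 hu
  have hfin : D' (I v + J w) = D' (J w) + I (D v) := by rw [map_add, h.map_inl, add_comm]
  change D' (I v + J w) ∈ _
  rw [hfin]
  exact Submodule.add_mem_sup ⟨J w, hJ, rfl⟩ ⟨D v, ⟨⟨v, mem_rad.2 ⟨hv, hv'⟩, rfl⟩, hDv⟩, rfl⟩

theorem IsTwistInv.map_socle_le (h : IsTwistInv l D DW ω I J f D') :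
    ((socle k V l).map (D.restrictScalars k)).map (I.restrictScalars k) ≤
      (socle k V' l).map (D'.restrictScalars k) := by
  rintro _ ⟨_, ⟨_, ⟨v, rfl⟩, rfl⟩, rfl⟩
  refine ⟨_, ⟨I v, rfl⟩, ?_⟩
  change D' (z k l • I v) = I (D (z k l • v))
  rw [← map_smul, h.map_inl]

variable [FiniteDimensional k V]

theorem IsTwistInv.mult_of_ne (hW : IsTensor l D DW ω χ ε) (h : IsTwistInv l D DW ω I J f D')
    {j : Fin n} (hj : j ≠ l) : mult D' j = mult D j := by
  rw [mult, mult, h.map_socle hW hj, socle_eq_map hW h.toIsSum hj,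
    finrank_map_of_injOn fun v _ hv => h.inl_eq_zero hv,
    finrank_map_of_injOn fun v _ hv => h.inl_eq_zero hv]

variable [FiniteDimensional k V']

/-- H(z_lV') is, up to a shift, the homology of the kernel of z_l on e_lV, filtered by z_lV and the
sum of the z_jV over the arrows j ⟶ l; again the connecting rank is lost twice. -/
theorem IsTwistInv.mult_self (hD : ∀ v, D (D v) = 0) (hV : ExactAt k n l V)
    (hW : IsTensor l D DW ω χ ε) (h : IsTwistInv l D DW ω I J f D') :
    mult D' l = mult D l + 2 * multSum D l - 2 * rkNeg D l := by
  have h1 := finrank_map_add_finrank_inf_ker (I.restrictScalars k ∘ₗ act k V (z k l) -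
        J.restrictScalars k ∘ₗ ω ∘ₗ D.restrictScalars k) (vertex k V l)
  rw [← h.map_socle_self hW hD] at h1
  have h2 : vertex k V l ⊓ LinearMap.ker (I.restrictScalars k ∘ₗ act k V (z k l) -
      J.restrictScalars k ∘ₗ ω ∘ₗ D.restrictScalars k) =
      rad k V l ⊓ LinearMap.ker (D.restrictScalars k) := by
    ext v
    constructor
    · rintro ⟨hv, hv'⟩
      have hv' : I (z k l • v) + J (- ω (D v)) = 0 := by
        rw [map_neg, ← sub_eq_add_neg]; exact hv'
      obtain ⟨h3, h4⟩ := h.eq_zero _ _ hv'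
      exact ⟨⟨hv, h3⟩, hW.eq_zero (map_vertex_le l ⟨v, hv, rfl⟩) (neg_eq_zero.1 h4)⟩
    · rintro ⟨⟨hv, h3⟩, h4⟩
      refine ⟨hv, ?_⟩
      have h3 : z k l • v = 0 := h3
      have h4 : D v = 0 := h4
      change I (z k l • v) - J (ω (D v)) = 0
      rw [h3, h4, map_zero, map_zero, map_zero, sub_zero]
  rw [h2] at h1
  have h3 := finrank_map_add_finrank_inf_ker (D.restrictScalars k) (rad k V l)
  rw [← finrank_socles, mult, mult, rkNeg, finrank_socle_self hW h.toIsSum]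
  have := finrank_map_rad (D := D) hV
  have := finrank_vertex (k := k) (V := V) l
  have := finrank_rad hV
  push_cast
  omega

/-- The new numerator lies in a sum whose first term is the new denominator. The second term meets
that denominator at least in I D z_lV, whose dimension is the old denominator. -/
theorem IsTwistInv.rkNeg_le (hW : IsTensor l D DW ω χ ε) (h : IsTwistInv l D DW ω I J f D') :
    rkNeg D' l ≤ rkNeg D l := by
  have hinj : ∀ p : Submodule k V, finrank k (p.map (I.restrictScalars k)) = finrank k p :=
    fun p => finrank_map_of_injOn fun v _ hv => h.inl_eq_zero hv
  have h1 := Submodule.finrank_mono (h.map_rad_inf_le hW)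
  have h2 := Submodule.finrank_sup_add_finrank_inf_eq
    ((socle k V' l).map (D'.restrictScalars k))
    (((rad k V l).map (D.restrictScalars k) ⊓ socle k V l).map (I.restrictScalars k))
  have h3 := Submodule.finrank_mono (le_inf h.map_socle_le
    (Submodule.map_mono (f := I.restrictScalars k) (map_socle_le_inf (D := D) l)))
  rw [hinj] at h2 h3
  rw [rkNeg, rkNeg]
  omega

end Neg

end DiffMod

/-! ### Total modules of complexes -/

section Total

open CochainComplex HomComplex DirectSum

variable {k : Type u} [Field k] {n : ℕ} {K L M : CochainComplex (GrProj k n) ℤ}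

variable (K) in
/-- The total module of a complex of graded modules. -/
abbrev Tot : Type u := ⨁ p : ℤ, (K.X p).carrier

/-- The map of total modules induced by a cochain. -/
def totMap {m : ℤ} (φ : Cochain K L m) : Tot K →ₗ[Zigzag k n] Tot L :=
  DirectSum.toModule (Zigzag k n) ℤ _ fun p =>
    DirectSum.lof (Zigzag k n) ℤ (fun q => (L.X q).carrier) (p + m) ∘ₗ
      GrProj.lin (φ.v p (p + m) rfl)

theorem totMap_lof {m : ℤ} (φ : Cochain K L m) (p q : ℤ) (h : p + m = q) (x : K.X p) :
    totMap φ (DirectSum.lof (Zigzag k n) ℤ (fun q => (K.X q).carrier) p x) =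
      DirectSum.lof (Zigzag k n) ℤ (fun q => (L.X q).carrier) q (GrProj.lin (φ.v p q h) x) := by
  subst h
  exact DirectSum.toModule_lof _ _ _

theorem tot_ext {N : Type*} [AddCommGroup N] [Module (Zigzag k n) N]
    {φ ψ : Tot K →ₗ[Zigzag k n] N}
    (h : ∀ p x, φ (DirectSum.lof (Zigzag k n) ℤ (fun q => (K.X q).carrier) p x) =
      ψ (DirectSum.lof (Zigzag k n) ℤ (fun q => (K.X q).carrier) p x)) (x : Tot K) : φ x = ψ x :=
  LinearMap.congr_fun (DirectSum.linearMap_ext _ fun p => LinearMap.ext (h p)) x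

theorem totMap_comp {a b c : ℤ} (φ : Cochain K L a) (ψ : Cochain L M b) (h : a + b = c)
    (x : Tot K) : totMap (φ.comp ψ h) x = totMap ψ (totMap φ x) := by
  refine tot_ext (ψ := totMap ψ ∘ₗ totMap φ) (fun p x => ?_) x
  rw [LinearMap.comp_apply, totMap_lof φ p _ rfl, totMap_lof ψ (p + a) (p + c) (by omega),
    totMap_lof _ p (p + c) rfl, Cochain.comp_v φ ψ h p (p + a) (p + c) rfl (by omega)]
  rfl

theorem totMap_add {a : ℤ} (φ ψ : Cochain K L a) (x : Tot K) :
    totMap (φ + ψ) x = totMap φ x + totMap ψ x := by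
  refine tot_ext (ψ := totMap φ + totMap ψ) (fun p x => ?_) x
  rw [LinearMap.add_apply, totMap_lof _ p _ rfl, totMap_lof _ p _ rfl, totMap_lof _ p _ rfl,
    Cochain.add_v, ← map_add]
  rfl

theorem totMap_zero {a : ℤ} (x : Tot K) : totMap (0 : Cochain K L a) x = 0 := by
  refine tot_ext (ψ := 0) (fun p x => ?_) x
  rw [totMap_lof _ p _ rfl, Cochain.zero_v, LinearMap.zero_apply]
  exact map_zero _

theorem totMap_sub {a : ℤ} (φ ψ : Cochain K L a) (x : Tot K) :
    totMap (φ - ψ) x = totMap φ x - totMap ψ x := by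
  rw [eq_sub_iff_add_eq, ← totMap_add, sub_add_cancel]

theorem totMap_id (x : Tot K) : totMap (Cochain.ofHom (𝟙 K)) x = x := by
  refine tot_ext (ψ := LinearMap.id) (fun p x => ?_) x
  rw [totMap_lof _ p p (add_zero p), Cochain.ofHom_v]
  rfl

variable (K) in
/-- The differential of the total module. -/
def totD : Tot K →ₗ[Zigzag k n] Tot K := totMap (Cochain.diff K)

theorem totD_lof (p : ℤ) (x : K.X p) :
    totD K (DirectSum.lof (Zigzag k n) ℤ (fun q => (K.X q).carrier) p x) =
      DirectSum.lof (Zigzag k n) ℤ (fun q => (K.X q).carrier) (p + 1)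
        (GrProj.lin (K.d p (p + 1)) x) :=
  totMap_lof _ p (p + 1) rfl x

theorem totD_totD (x : Tot K) : totD K (totD K x) = 0 := by
  refine tot_ext (φ := totD K ∘ₗ totD K) (ψ := 0) (fun p x => ?_) x
  rw [LinearMap.comp_apply, totD_lof, totD_lof]
  have h : GrProj.lin (K.d (p + 1) (p + 1 + 1)) (GrProj.lin (K.d p (p + 1)) x) = 0 :=
    LinearMap.congr_fun (congrArg GrProj.lin (K.d_comp_d p (p + 1) (p + 1 + 1))) x
  rw [h, map_zero, LinearMap.zero_apply]

/-- Evenness of b removes the sign in the differential of cochains. The cases used are b = 0, for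
homotopies and the cone inclusion, and b = 2, for the shift. -/
theorem totMap_δ {a b : ℤ} (hab : a + 1 = b) (hb : b.negOnePow = 1) (φ : Cochain K L a)
    (x : Tot K) : totMap (δ a b φ) x = totD L (totMap φ x) + totMap φ (totD K x) := by
  refine tot_ext (ψ := totD L ∘ₗ totMap φ + totMap φ ∘ₗ totD K) (fun p x => ?_) x
  rw [LinearMap.add_apply, LinearMap.comp_apply, LinearMap.comp_apply, totD_lof,
    totMap_lof φ p (p + b - 1) (by omega), totMap_lof φ (p + 1) (p + b) (by omega),
    totMap_lof _ p (p + b) rfl, totD, totMap_lof _ (p + b - 1) (p + b) (by omega),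
    δ_v a b hab φ p (p + b) rfl (p + b - 1) (p + 1) rfl rfl, hb, one_smul, ← map_add]
  rfl

theorem totD_totMap_ofHom (φ : K ⟶ L) (x : Tot K) :
    totD L (totMap (Cochain.ofHom φ) x) = totMap (Cochain.ofHom φ) (totD K x) := by
  refine tot_ext (φ := totD L ∘ₗ totMap (Cochain.ofHom φ))
    (ψ := totMap (Cochain.ofHom φ) ∘ₗ totD K) (fun p x => ?_) x
  rw [LinearMap.comp_apply, LinearMap.comp_apply, totD_lof, totMap_lof _ p p (add_zero p), totD_lof,
    totMap_lof _ (p + 1) (p + 1) (add_zero _), Cochain.ofHom_v, Cochain.ofHom_v]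
  congr 1
  exact LinearMap.congr_fun (congrArg GrProj.lin (φ.comm p (p + 1))) x

/-! #### Mapping cones and shifts -/

section Cone

variable (φ : K ⟶ L)

theorem isSum_mappingCone :
    DiffMod.IsSum (totMap (mappingCone.inl φ)) (totMap (Cochain.ofHom (mappingCone.inr φ))) where
  exists_eq x := by
    refine ⟨totMap (mappingCone.fst φ).1 x, totMap (mappingCone.snd φ) x, ?_⟩
    have h := congrArg (fun c => totMap c x) (mappingCone.id φ)
    simp only [totMap_add, totMap_comp, totMap_id] at h
    exact h.symm
  eq_zero v w h := by
    constructor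
    · have h' := congrArg (totMap (mappingCone.fst φ).1) h
      rw [map_add, ← totMap_comp _ _ (show (-1 : ℤ) + 1 = 0 by norm_num), mappingCone.inl_fst,
        totMap_id, ← totMap_comp _ _ (zero_add 1), mappingCone.inr_fst, totMap_zero, add_zero,
        map_zero] at h'
      exact h'
    · have h' := congrArg (totMap (mappingCone.snd φ)) h
      rw [map_add, ← totMap_comp _ _ (add_zero (-1)), mappingCone.inl_snd, totMap_zero,
        ← totMap_comp _ _ (zero_add 0), mappingCone.inr_snd, totMap_id, zero_add, map_zero] at h'
      exact h'

theorem totD_inl (x : Tot K) : totD _ (totMap (mappingCone.inl φ) x) =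
    totMap (Cochain.ofHom (mappingCone.inr φ)) (totMap (Cochain.ofHom φ) x) -
      totMap (mappingCone.inl φ) (totD K x) := by
  rw [eq_sub_iff_add_eq, ← totMap_δ (by norm_num) Int.negOnePow_zero, mappingCone.δ_inl,
    Cochain.ofHom_comp, totMap_comp]

end Cone

variable (K) in
/-- The identification of the total module of a complex with that of its shift. -/
def totShift : Tot K →ₗ[Zigzag k n] Tot (K⟦(-1 : ℤ)⟧) :=
  totMap ((Cochain.ofHom (𝟙 K)).rightShift (-1) 1 (by norm_num))

/-- The shift by −1 negates the differential; this sign produces the signs in `DiffMod.IsTwist`. -/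
theorem totD_totShift (x : Tot K) : totD _ (totShift K x) = - totShift K (totD K x) := by
  rw [eq_neg_iff_add_eq_zero, totShift, ← totMap_δ (b := 2) (by norm_num) (by decide),
    Cochain.δ_rightShift _ (-1) 1 2 (by norm_num) 1 (by norm_num), δ_ofHom,
    Cochain.rightShift_zero, smul_zero, totMap_zero]

theorem totShift_bijective : Function.Bijective (totShift K) := by
  have h₁ : ((Cochain.ofHom (𝟙 K)).rightShift (-1) 1 (by norm_num)).comp
      ((Cochain.ofHom (𝟙 (K⟦(-1 : ℤ)⟧))).rightUnshift (-1) (by norm_num)) (add_neg_cancel 1) =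
      Cochain.ofHom (𝟙 K) := by
    ext p
    rw [Cochain.comp_v _ _ _ p (p + 1) p rfl (by omega),
      Cochain.rightShift_v _ _ _ _ _ _ _ p (add_zero p),
      Cochain.rightUnshift_v _ _ _ _ _ _ (p + 1) (add_zero _)]
    simp
  have h₂ : ((Cochain.ofHom (𝟙 (K⟦(-1 : ℤ)⟧))).rightUnshift (-1) (by norm_num)).comp
      ((Cochain.ofHom (𝟙 K)).rightShift (-1) 1 (by norm_num)) (neg_add_cancel 1) =
      Cochain.ofHom (𝟙 (K⟦(-1 : ℤ)⟧)) := by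
    ext p
    rw [Cochain.comp_v _ _ _ p (p + -1) p rfl (by omega),
      Cochain.rightShift_v _ _ _ _ _ _ _ (p + -1) (add_zero _),
      Cochain.rightUnshift_v _ _ _ _ _ _ p (add_zero _)]
    simp
    rfl
  refine Function.bijective_iff_has_inverse.2
    ⟨totMap ((Cochain.ofHom (𝟙 (K⟦(-1 : ℤ)⟧))).rightUnshift (-1) (by norm_num)),
      fun x => ?_, fun x => ?_⟩
  · rw [totShift, ← totMap_comp _ _ (add_neg_cancel 1), h₁, totMap_id]
  · rw [totShift, ← totMap_comp _ _ (neg_add_cancel 1), h₂, totMap_id]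

theorem finiteDimensional_tot (hK : bounded (GrProj k n)
    ((HomotopyCategory.quotient _ (ComplexShape.up ℤ)).obj K)) : FiniteDimensional k (Tot K) := by
  obtain ⟨a, b, h⟩ := hK
  have hzero : ∀ p, p < a ∨ b < p → ∀ x : K.X p, x = 0 := by
    intro p hp x
    have := (IsZero.iff_id_eq_zero _).1 (h p hp)
    exact LinearMap.congr_fun (congrArg GrProj.lin this) x
  let φ : ((p : Finset.Icc a b) → (K.X p).carrier) →ₗ[k] Tot K :=
    ∑ p : Finset.Icc a b, DirectSum.lof k ℤ (fun q => (K.X q).carrier) p ∘ₗ LinearMap.proj p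
  refine Module.Finite.of_surjective φ fun x => ⟨fun p => x p, ?_⟩
  induction x using DirectSum.induction_on with
  | zero => simp [φ]
  | add x y hx hy =>
    conv_rhs => rw [← hx, ← hy]
    rw [← map_add]
    rfl
  | of p x =>
    by_cases hp : p ∈ Finset.Icc a b
    · simp only [φ, LinearMap.sum_apply, LinearMap.comp_apply, LinearMap.proj_apply]
      rw [Finset.sum_eq_single ⟨p, hp⟩]
      · rw [DirectSum.of_eq_same]; rfl
      · intro q _ hq
        rw [DirectSum.of_eq_of_ne _ _ _ fun h => hq (Subtype.ext h), map_zero]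
      · simp
    · have : x = 0 := hzero p (by rw [Finset.mem_Icc] at hp; omega) x
      subst this
      simp [φ]

end Total

/-! ### Total modules of twists -/

section TensorTotal

open CochainComplex HomComplex DirectSum Zigzag

variable {k : Type u} [Field k] {n : ℕ}

theorem Zigzag.z_mul_mul_e {j l : Fin n} (h : j ≠ l) (a : Zigzag k n) :
    z k j * a * e k l = 0 := by
  have : LinearMap.mulRight k (e k l) ∘ₗ LinearMap.mulLeft k (z k j) = 0 := by
    refine linearMap_ext (fun i => ?_) (fun i => ?_) fun i i' c => ?_
    · by_cases hi : j = i
      · subst hi; simp [z_mul_e', h]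
      · simp [z_mul_e', hi]
    · simp [z_mul_z']
    · simp [z_mul_arr']
  exact LinearMap.congr_fun this a

/-- A functor behaving like `M ↦ P_l ⊗ e_l M` up to a shift of the grading: `ω m = z_l ⊗ e_l m`,
`η m = e_l ⊗ e_l m`, and `χ`, `ε` take the coefficients of `e_l` and of `z_l`. -/
structure TensorLike (l : Fin n) (T : GrProj k n ⥤ GrProj k n) where
  ω (M : GrProj k n) : M →ₗ[k] T.obj M
  η (M : GrProj k n) : M →ₗ[k] T.obj M
  χ (M : GrProj k n) : T.obj M →ₗ[k] M
  ε (M : GrProj k n) : T.obj M →ₗ[k] M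
  naturality {M N : GrProj k n} (f : M ⟶ N) (m : M) :
    GrProj.lin (T.map f) (ω M m) = ω N (GrProj.lin f m)
  e_smul_χ (M : GrProj k n) (w : T.obj M) : e k l • χ M w = χ M w
  e_smul_ε (M : GrProj k n) (w : T.obj M) : e k l • ε M w = ε M w
  ε_ω (M : GrProj k n) (m : M) : ε M (ω M m) = e k l • m
  z_smul (M : GrProj k n) (w : T.obj M) : z k l • w = ω M (χ M w)
  z_smul_η (M : GrProj k n) (m : M) : z k l • η M m = ω M m
  e_smul (M : GrProj k n) (w : T.obj M) : e k l • w = η M (χ M w) + ω M (ε M w)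
  z_smul_ne (M : GrProj k n) (j : Fin n) (hj : j ≠ l) (w : T.obj M) : z k j • w = 0

/-- If z_l kills w, its coefficient at e_l vanishes, since ω is injective on e_lM with retraction ε.
-/
theorem TensorLike.eq_ω_ε {l : Fin n} {T : GrProj k n ⥤ GrProj k n} (S : TensorLike l T)
    (M : GrProj k n) (w : T.obj M) (he : e k l • w = w) (hz : z k l • w = 0) :
    w = S.ω M (S.ε M w) := by
  have hχ : S.χ M w = 0 := by rw [← S.e_smul_χ, ← S.ε_ω, ← S.z_smul, hz, map_zero]
  have := S.e_smul M w
  rwa [hχ, map_zero, zero_add, he] at this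

namespace GrProj

variable (l : Fin n) (M : GrProj k n)

theorem toCorner_e_coe (m : corner l M) : toCorner l M (e k l) (by simp) m.1 = m :=
  Subtype.ext m.2

theorem z_smul_tensor {j : Fin n} (hj : j ≠ l) {X : Type u} [AddCommGroup X] [Module k X]
    (w : P k l ⊗[k] X) : z k j • w = 0 := by
  induction w using TensorProduct.induction_on with
  | zero => exact smul_zero _
  | add x y hx hy => rw [smul_add, hx, hy, add_zero]
  | tmul a m =>
    have : z k j • a = 0 := by
      refine Subtype.ext ?_
      change z k j * a.1 = 0
      rw [← mem_ideal.1 a.2, ← mul_assoc]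
      exact z_mul_mul_e hj _
    rw [TensorProduct.smul_tmul', this, TensorProduct.zero_tmul]

/-- The structure of `P_l ⊗ e_l M`. -/
def tensorLike : TensorLike l (tensor l : GrProj k n ⥤ GrProj k n) where
  ω M := TensorProduct.mk k (P k l) (corner l M) (zP k l) ∘ₗ toCorner l M (e k l) (by simp)
  η M := TensorProduct.mk k (P k l) (corner l M) (eP k l) ∘ₗ toCorner l M (e k l) (by simp)
  χ M := (corner l M).subtype ∘ₗ eProj l (corner l M)
  ε M := (corner l M).subtype ∘ₗ zProj l (corner l M)
  naturality {M N} f m := by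
    refine congrArg (fun x : corner l N => zP k l ⊗ₜ[k] x) (Subtype.ext ?_)
    exact map_smul (lin f) _ _
  e_smul_χ M w := (eProj l (corner l M) w).2
  e_smul_ε M w := (zProj l (corner l M) w).2
  ε_ω M m := congrArg Subtype.val (zProj_zP (k := k) l (toCorner l M (e k l) (by simp) m))
  z_smul M w := by
    refine (z_smul_eq l w).trans ?_
    exact congrArg (fun x : corner l M => zP k l ⊗ₜ[k] x) (toCorner_e_coe l M _).symm
  z_smul_η M m := by
    refine (z_smul_eq l _).trans ?_
    exact congrArg (fun x : corner l M => zP k l ⊗ₜ[k] x) (eProj_eP (k := k) l _)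
  e_smul M w := by
    refine (e_smul_eq l w).trans ?_
    exact congrArg₂ (fun x y : corner l M => eP k l ⊗ₜ[k] x + zP k l ⊗ₜ[k] y)
      (toCorner_e_coe l M _).symm (toCorner_e_coe l M _).symm
  z_smul_ne M j hj w := z_smul_tensor l hj w

/-- The structure of `(P_l ⊗ e_l M)⟨1⟩`. -/
def tensorLikeShift : TensorLike l (tensor l ⋙ shift 1 : GrProj k n ⥤ GrProj k n) where
  ω := (tensorLike l).ω
  η := (tensorLike l).η
  χ := (tensorLike l).χ
  ε := (tensorLike l).ε
  naturality := (tensorLike l).naturality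
  e_smul_χ := (tensorLike l).e_smul_χ
  e_smul_ε := (tensorLike l).e_smul_ε
  ε_ω := (tensorLike l).ε_ω
  z_smul := (tensorLike l).z_smul
  z_smul_η := (tensorLike l).z_smul_η
  e_smul := (tensorLike l).e_smul
  z_smul_ne := (tensorLike l).z_smul_ne

theorem z_smul_coeval (m : M) :
    z k l • (lin ((gNat l).app M) m) = (tensorLikeShift l).ω M (z k l • m) := by
  refine (map_smul (coevalLin l M) (z k l) m).symm.trans ?_
  have h : z k l • m ∈ corner l M := by rw [mem_corner, ← mul_smul, e_mul_z]
  refine (coevalBase_corner l M ⟨_, h⟩).trans ?_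
  have h1 : zCorner l M ⟨_, h⟩ = 0 := Subtype.ext (by
    change z k l • z k l • m = 0
    rw [← mul_smul, z_mul_z, zero_smul])
  rw [h1, TensorProduct.tmul_zero, add_zero]
  exact congrArg (fun x : corner l M => zP k l ⊗ₜ[k] x) (toCorner_e_coe l M ⟨_, h⟩).symm

theorem eval_ω (m : M) : lin ((fNat l).app M) ((tensorLike l).ω M m) = z k l • m := by
  change z k l • e k l • m = z k l • m
  rw [← mul_smul, z_mul_e]

end GrProj

theorem tot_ext_base {K : CochainComplex (GrProj k n) ℤ} {N : Type*} [AddCommGroup N] [Module k N]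
    {φ ψ : Tot K →ₗ[k] N}
    (h : ∀ p x, φ (DirectSum.lof k ℤ (fun q => (K.X q).carrier) p x) =
      ψ (DirectSum.lof k ℤ (fun q => (K.X q).carrier) p x)) (x : Tot K) : φ x = ψ x :=
  LinearMap.congr_fun (DirectSum.linearMap_ext _ fun p => LinearMap.ext (h p)) x

variable {l : Fin n} {T : GrProj k n ⥤ GrProj k n} [T.Additive] (S : TensorLike l T)
  (K : CochainComplex (GrProj k n) ℤ)

/-- The total version of `ω`. -/
def TensorLike.totω : Tot K →ₗ[k] Tot ((T.mapHomologicalComplex (ComplexShape.up ℤ)).obj K) :=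
  DirectSum.lmap fun p => S.ω (K.X p)

/-- The total version of `χ`. -/
def TensorLike.totχ : Tot ((T.mapHomologicalComplex (ComplexShape.up ℤ)).obj K) →ₗ[k] Tot K :=
  DirectSum.lmap fun p => S.χ (K.X p)

/-- The total version of `ε`. -/
def TensorLike.totε : Tot ((T.mapHomologicalComplex (ComplexShape.up ℤ)).obj K) →ₗ[k] Tot K :=
  DirectSum.lmap fun p => S.ε (K.X p)

theorem TensorLike.isTensor :
    DiffMod.IsTensor l (totD K) (totD ((T.mapHomologicalComplex (ComplexShape.up ℤ)).obj K))
      (S.totω K) (S.totχ K) (S.totε K) where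
  comm v := by
    refine tot_ext_base (φ := (totD _).restrictScalars k ∘ₗ S.totω K)
      (ψ := S.totω K ∘ₗ (totD K).restrictScalars k) (fun p x => ?_) v
    have h1 : S.totω K (DirectSum.lof k ℤ (fun q => (K.X q).carrier) p x) =
        DirectSum.lof (Zigzag k n) ℤ (fun q => (T.obj (K.X q)).carrier) p (S.ω (K.X p) x) :=
      DirectSum.lmap_lof _ _ _
    have h2 : S.totω K (DirectSum.lof (Zigzag k n) ℤ (fun q => (K.X q).carrier) (p + 1)
        (GrProj.lin (K.d p (p + 1)) x)) =
        DirectSum.lof (Zigzag k n) ℤ (fun q => (T.obj (K.X q)).carrier) (p + 1)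
          (S.ω (K.X (p + 1)) (GrProj.lin (K.d p (p + 1)) x)) :=
      DirectSum.lmap_lof _ _ _
    refine (congrArg (totD _) h1).trans ((totD_lof p _).trans ?_)
    refine Eq.trans ?_ ((congrArg (S.totω K) (totD_lof p x)).trans h2).symm
    exact congrArg _ (S.naturality (K.d p (p + 1)) x)
  e_smul_χ w := by
    refine DFinsupp.ext fun p => ?_
    exact S.e_smul_χ (K.X p) (w p)
  e_smul_ε w := by
    refine DFinsupp.ext fun p => ?_
    exact S.e_smul_ε (K.X p) (w p)
  ε_ω v := by
    refine DFinsupp.ext fun p => ?_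
    exact S.ε_ω (K.X p) (v p)
  z_smul w := by
    refine DFinsupp.ext fun p => ?_
    exact S.z_smul (K.X p) (w p)
  exists_ω_eq v := ⟨DirectSum.lmap (R := k) (fun p => S.η (K.X p)) v,
    DFinsupp.ext fun p => (S.z_smul_η (K.X p) (v p)).symm⟩
  eq_ω_ε w he hz := by
    refine DFinsupp.ext fun p => ?_
    exact S.eq_ω_ε (K.X p) (w p) (DFunLike.congr_fun he p) (DFunLike.congr_fun hz p)
  z_smul_ne j hj w := by
    refine DFinsupp.ext fun p => ?_
    exact S.z_smul_ne (K.X p) j hj (w p)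

end TensorTotal

/-! ### Homotopy invariance of multiplicities -/

namespace DiffMod

open Zigzag Module

variable {k : Type u} [Field k] {n : ℕ} {V V' : Type v}
  [AddCommGroup V] [Module k V] [Module (Zigzag k n) V] [IsScalarTower k (Zigzag k n) V]
  [AddCommGroup V'] [Module k V'] [Module (Zigzag k n) V'] [IsScalarTower k (Zigzag k n) V']
  [FiniteDimensional k V] [FiniteDimensional k V']

/-- Algebra-linear maps and homotopies preserve z_jV. As GF is homotopic to the identity, F is
injective on the homology of z_jV. -/
theorem mult_le_of_homotopy {D : V →ₗ[Zigzag k n] V} {D' : V' →ₗ[Zigzag k n] V'}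
    (hD' : ∀ v, D' (D' v) = 0)
    (F : V →ₗ[Zigzag k n] V') (G : V' →ₗ[Zigzag k n] V) (s : V →ₗ[Zigzag k n] V)
    (hF : ∀ v, D' (F v) = F (D v)) (hG : ∀ v, D (G v) = G (D' v))
    (hs : ∀ v, G (F v) - v = D (s v) + s (D v)) (j : Fin n) : mult D j ≤ mult D' j := by
  set B' := (socle k V' j).map (D'.restrictScalars k) with hB'
  set Z := socle k V j ⊓ LinearMap.ker (D.restrictScalars k) with hZ
  set Z' := socle k V' j ⊓ LinearMap.ker (D'.restrictScalars k) with hZ'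
  have h1 := finrank_map_add_finrank_inf_ker (D.restrictScalars k) (socle k V j)
  have h2 := finrank_map_add_finrank_inf_ker (D'.restrictScalars k) (socle k V' j)
  have h3 := finrank_map_add_finrank_inf_ker (B'.mkQ ∘ₗ F.restrictScalars k) Z
  have h4 := finrank_map_add_finrank_inf_ker B'.mkQ Z'
  have h5 : Z ⊓ LinearMap.ker (B'.mkQ ∘ₗ F.restrictScalars k) ≤
      (socle k V j).map (D.restrictScalars k) := by
    rintro x ⟨⟨⟨v, rfl⟩, hx⟩, hx'⟩
    have hx : D (z k j • v) = 0 := hx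
    have hx' : F (z k j • v) ∈ B' := by
      rw [LinearMap.ker_comp, Submodule.ker_mkQ] at hx'
      exact hx'
    obtain ⟨_, ⟨u, rfl⟩, hu⟩ := hx'
    have hu : D' (z k j • u) = F (z k j • v) := hu
    refine ⟨_, ⟨G u - s v, rfl⟩, ?_⟩
    change D (z k j • (G u - s v)) = z k j • v
    have := hs (z k j • v)
    rw [hx, map_zero, add_zero, ← hu, ← hG, sub_eq_iff_eq_add] at this
    rw [smul_sub, ← map_smul, ← map_smul, map_sub, this, add_sub_cancel_left]
  have h6 : Z.map (B'.mkQ ∘ₗ F.restrictScalars k) ≤ Z'.map B'.mkQ := by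
    rw [Submodule.map_comp]
    refine Submodule.map_mono ?_
    rintro _ ⟨_, ⟨⟨v, rfl⟩, hx⟩, rfl⟩
    have hx : D (z k j • v) = 0 := hx
    refine ⟨⟨F v, (map_smul F _ _).symm⟩, ?_⟩
    change D' (F (z k j • v)) = 0
    rw [hF, hx, map_zero]
  have h7 : Z' ⊓ LinearMap.ker B'.mkQ = B' := by
    rw [Submodule.ker_mkQ, inf_eq_right]
    refine le_inf (map_socle_le j) ?_
    rintro _ ⟨v, -, rfl⟩
    exact hD' v
  rw [h7] at h4
  have h8 := Submodule.finrank_mono h5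
  have h9 := Submodule.finrank_mono h6
  rw [← hZ] at h1
  rw [← hB', ← hZ'] at h2
  rw [mult, mult, ← hB']
  omega

end DiffMod

/-! ### Multiplicities of objects and their change under letters. -/

section Objects

open CochainComplex HomComplex DirectSum Zigzag DiffMod Module

variable {k : Type u} [Field k] {n : ℕ}

instance (X : D k n) : FiniteDimensional k (Tot X.obj.as) :=
  finiteDimensional_tot X.property

theorem exactAt_tot (X : D k n) (l : Fin n) : ExactAt k n l (Tot X.obj.as) := by
  have : Module.Finite (Zigzag k n) (Tot X.obj.as) :=
    Module.Finite.of_restrictScalars_finite k _ _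
  exact exactAt_of_projective l _

/-- The multiplicity of an object of `𝒟` at the vertex `j`. -/
def multD (X : D k n) (j : Fin n) : ℤ := mult (totD X.obj.as) j

theorem multD_le_of_homotopyEquiv {X Y : D k n} (h : HomotopyEquiv X.obj.as Y.obj.as)
    (j : Fin n) : multD X j ≤ multD Y j := by
  refine mult_le_of_homotopy totD_totD (totMap (Cochain.ofHom h.hom))
    (totMap (Cochain.ofHom h.inv)) (totMap (Cochain.ofHomotopy h.homotopyHomInvId))
    (totD_totMap_ofHom _) (totD_totMap_ofHom _) (fun x => ?_) j
  rw [← totMap_δ (by norm_num) Int.negOnePow_zero, δ_ofHomotopy, totMap_sub, totMap_id,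
    Cochain.ofHom_comp, totMap_comp]

theorem multD_eq_of_iso {X Y : D k n} (e : X ≅ Y) (j : Fin n) : multD X j = multD Y j := by
  let h : HomotopyEquiv X.obj.as Y.obj.as :=
    HomotopyCategory.homotopyEquivOfIso ((bounded (GrProj k n)).ι.mapIso e)
  exact le_antisymm (multD_le_of_homotopyEquiv h j) (multD_le_of_homotopyEquiv h.symm j)

/-! ### Multiplicities of twists -/

variable (l : Fin n) (K : CochainComplex (GrProj k n) ℤ)

theorem totMap_ofHom_apply {K L : CochainComplex (GrProj k n) ℤ} (φ : K ⟶ L) (x : Tot K) (p : ℤ) :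
    totMap (Cochain.ofHom φ) x p = GrProj.lin (φ.f p) (x p) := by
  have : totMap (Cochain.ofHom φ) x = DirectSum.lmap (fun p => GrProj.lin (φ.f p)) x := by
    refine tot_ext (fun p x => ?_) x
    rw [totMap_lof _ p p (add_zero p), DirectSum.lmap_lof, Cochain.ofHom_v]
  rw [this]
  rfl

theorem z_smul_totMap_coeval (v : Tot K) :
    z k l • (totMap (Cochain.ofHom (natApp (GrProj.gNat l) K)) : Tot K →ₗ[Zigzag k n] _) v =
      (GrProj.tensorLikeShift l).totω K (z k l • v) := by
  refine DFinsupp.ext fun p => ?_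
  refine (congrArg (z k l • ·) (totMap_ofHom_apply (natApp (GrProj.gNat l) K) v p)).trans ?_
  exact GrProj.z_smul_coeval l (K.X p) (v p)

theorem totMap_eval_ω (v : Tot K) :
    (totMap (Cochain.ofHom (natApp (GrProj.fNat l) K)) : _ →ₗ[Zigzag k n] Tot K)
      ((GrProj.tensorLike l).totω K v) = z k l • v := by
  refine DFinsupp.ext fun p => ?_
  refine (totMap_ofHom_apply (natApp (GrProj.fNat l) K) _ p).trans ?_
  exact GrProj.eval_ω l (K.X p) (v p)

/-- In the cone, the inclusion of K has degree −1 and its differential carries the opposite sign.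
The shift by −1 corrects that sign and moves the minus onto the tensor part. -/
theorem isTwist_tot :
    IsTwist l (totD K) (totD _) ((GrProj.tensorLikeShift l).totω K)
      (totShift _ ∘ₗ totMap (mappingCone.inl (natApp (GrProj.gNat l) K)))
      (totShift _ ∘ₗ totMap (Cochain.ofHom (mappingCone.inr (natApp (GrProj.gNat l) K))))
      (totMap (Cochain.ofHom (natApp (GrProj.gNat l) K)))
      (totD (((cone (GrProj.gNat l)).obj K)⟦(-1 : ℤ)⟧)) where
  exists_eq x := by
    obtain ⟨x, rfl⟩ := totShift_bijective.2 x
    obtain ⟨v, w, rfl⟩ := (isSum_mappingCone (natApp (GrProj.gNat l) K)).exists_eq x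
    exact ⟨v, w, map_add _ _ _⟩
  eq_zero v w h := by
    refine (isSum_mappingCone (natApp (GrProj.gNat l) K)).eq_zero v w (totShift_bijective.1 ?_)
    rw [map_add, map_zero]
    exact h
  map_inl v := by
    refine (totD_totShift _).trans ?_
    refine (congrArg (fun y => - totShift _ y) (totD_inl (natApp (GrProj.gNat l) K) v)).trans ?_
    rw [map_sub, neg_sub]
    rfl
  map_inr w := by
    refine (totD_totShift _).trans ?_
    exact congrArg (fun y => - totShift _ y)
      (totD_totMap_ofHom (mappingCone.inr (natApp (GrProj.gNat l) K)) w)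
  z_smul_g v := z_smul_totMap_coeval l K v

theorem isTwistInv_tot :
    IsTwistInv l (totD K) (totD _) ((GrProj.tensorLike l).totω K)
      (totMap (Cochain.ofHom (mappingCone.inr (natApp (GrProj.fNat l) K))))
      (totMap (mappingCone.inl (natApp (GrProj.fNat l) K)))
      (totMap (Cochain.ofHom (natApp (GrProj.fNat l) K)))
      (totD ((cone (GrProj.fNat l)).obj K)) where
  exists_eq x := by
    obtain ⟨w, v, rfl⟩ := (isSum_mappingCone (natApp (GrProj.fNat l) K)).exists_eq x
    exact ⟨v, w, add_comm _ _⟩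
  eq_zero v w h :=
    ((isSum_mappingCone (natApp (GrProj.fNat l) K)).eq_zero w v ((add_comm _ _).trans h)).symm
  map_inl v := totD_totMap_ofHom (mappingCone.inr (natApp (GrProj.fNat l) K)) v
  map_inr w := totD_inl (natApp (GrProj.fNat l) K) w
  f_ω v := totMap_eval_ω l K v

/-- The functor attached to a letter. -/
def letterFunctor (k : Type u) [Field k] {n : ℕ} (a : Fin n × Bool) : D k n ⥤ D k n :=
  if a.2 then twistFunctor k a.1 else twistInvFunctor k a.1

/-- The rank of the connecting map for a letter. -/
def rkD (X : D k n) (a : Fin n × Bool) : ℤ :=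
  if a.2 then rkPos (totD X.obj.as) a.1 else rkNeg (totD X.obj.as) a.1

/-- The sum of the multiplicities at the vertices different from `l`. -/
def multSumD (X : D k n) (l : Fin n) : ℤ := ∑ j ∈ Finset.univ.erase l, multD X j

theorem multD_nonneg (X : D k n) (j : Fin n) : 0 ≤ multD X j := mult_nonneg totD_totD j

theorem rkD_nonneg (X : D k n) (a : Fin n × Bool) : 0 ≤ rkD X a := by
  unfold rkD
  split_ifs
  · exact rkPos_nonneg (exactAt_tot X a.1)
  · exact rkNeg_nonneg a.1

theorem rkD_le (X : D k n) (a : Fin n × Bool) : rkD X a ≤ multD X a.1 := by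
  unfold rkD
  split_ifs
  · exact rkPos_le_mult totD_totD (exactAt_tot X a.1)
  · exact rkNeg_le_mult totD_totD a.1

theorem multD_letter_of_ne (X : D k n) (a : Fin n × Bool) {j : Fin n} (hj : j ≠ a.1) :
    multD ((letterFunctor k a).obj X) j = multD X j := by
  obtain ⟨l, _ | _⟩ := a
  · exact (isTwistInv_tot l X.obj.as).mult_of_ne ((GrProj.tensorLike l).isTensor X.obj.as) hj
  · exact (isTwist_tot l X.obj.as).mult_of_ne ((GrProj.tensorLikeShift l).isTensor X.obj.as) hj

theorem multD_letter_self (X : D k n) (a : Fin n × Bool) :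
    multD ((letterFunctor k a).obj X) a.1 = multD X a.1 + 2 * multSumD X a.1 - 2 * rkD X a := by
  obtain ⟨l, _ | _⟩ := a
  · have : FiniteDimensional k (Tot ((cone (GrProj.fNat l)).obj X.obj.as)) :=
      inferInstanceAs (FiniteDimensional k (Tot ((twistInvFunctor k l).obj X).obj.as))
    exact (isTwistInv_tot l X.obj.as).mult_self totD_totD (exactAt_tot X l)
      ((GrProj.tensorLike l).isTensor X.obj.as)
  · have : FiniteDimensional k (Tot (((cone (GrProj.gNat l)).obj X.obj.as)⟦(-1 : ℤ)⟧)) :=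
      inferInstanceAs (FiniteDimensional k (Tot ((twistFunctor k l).obj X).obj.as))
    exact (isTwist_tot l X.obj.as).mult_self totD_totD (exactAt_tot X l)
      ((GrProj.tensorLikeShift l).isTensor X.obj.as)

theorem rkD_letter_le (X : D k n) (a : Fin n × Bool) :
    rkD ((letterFunctor k a).obj X) a ≤ rkD X a := by
  obtain ⟨l, _ | _⟩ := a
  · have : FiniteDimensional k (Tot ((cone (GrProj.fNat l)).obj X.obj.as)) :=
      inferInstanceAs (FiniteDimensional k (Tot ((twistInvFunctor k l).obj X).obj.as))
    exact (isTwistInv_tot l X.obj.as).rkNeg_le ((GrProj.tensorLike l).isTensor X.obj.as)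
  · have : FiniteDimensional k (Tot (((cone (GrProj.gNat l)).obj X.obj.as)⟦(-1 : ℤ)⟧)) :=
      inferInstanceAs (FiniteDimensional k (Tot ((twistFunctor k l).obj X).obj.as))
    exact (isTwist_tot l X.obj.as).rkPos_le ((GrProj.tensorLikeShift l).isTensor X.obj.as)
      (exactAt_tot ((twistFunctor k l).obj X) l)

end Objects

/-! ### Multiplicities of the indecomposable projectives -/

section Projective

open CochainComplex HomComplex DirectSum Zigzag DiffMod Module

variable {k : Type u} [Field k] {n : ℕ}

/-- Without differential no homology needs to be taken; this applies to a complex concentrated in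
one degree. -/
theorem DiffMod.mult_eq_finrank_socle {V : Type v} [AddCommGroup V] [Module k V]
    [Module (Zigzag k n) V] [IsScalarTower k (Zigzag k n) V] {D : V →ₗ[Zigzag k n] V}
    (hD : ∀ v, D v = 0) (i : Fin n) : mult D i = finrank k (socle k V i) := by
  have : (socle k V i).map (D.restrictScalars k) = ⊥ := by
    rw [eq_bot_iff]
    rintro _ ⟨v, -, rfl⟩
    exact hD v
  rw [mult, this, finrank_bot]
  simp

theorem DiffMod.finrank_socle_eq {V V' : Type v} [AddCommGroup V] [Module k V]
    [Module (Zigzag k n) V] [IsScalarTower k (Zigzag k n) V] [AddCommGroup V'] [Module k V']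
    [Module (Zigzag k n) V'] [IsScalarTower k (Zigzag k n) V'] (f : V →ₗ[Zigzag k n] V')
    (hf : Function.Bijective f) (i : Fin n) :
    finrank k (socle k V' i) = finrank k (socle k V i) := by
  have : socle k V' i = (socle k V i).map (f.restrictScalars k) := by
    ext v
    constructor
    · rintro ⟨w, rfl⟩
      obtain ⟨w, rfl⟩ := hf.2 w
      exact ⟨_, ⟨w, rfl⟩, map_smul f _ _⟩
    · rintro ⟨_, ⟨w, rfl⟩, rfl⟩
      exact ⟨f w, (map_smul f _ _).symm⟩
  rw [this]
  exact (Submodule.equivMapOfInjective (f.restrictScalars k) hf.1 _).finrank_eq.symm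

/-- z_iÂe_j is spanned by z_i if i = j and is zero otherwise: the multiplicity of P_i in P_j. -/
theorem finrank_socle_ideal (i j : Fin n) :
    finrank k (socle k (GrProj.ideal k j) i) = if i = j then 1 else 0 := by
  split_ifs with h
  · subst h
    have : socle k (GrProj.ideal k i) i = Submodule.span k {⟨z k i, by simp [GrProj.ideal]⟩} := by
      ext v
      rw [Submodule.mem_span_singleton]
      constructor
      · rintro ⟨w, rfl⟩
        refine ⟨eCoeff i w.1, Subtype.ext ?_⟩
        change eCoeff i w.1 • z k i = z k i * w.1
        have h1 := e_mul_mul_e i w.1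
        have h2 : w.1 * e k i = w.1 := w.2
        rw [mul_assoc, h2] at h1
        rw [← z_mul_e, mul_assoc, h1, mul_add, mul_smul_comm, mul_smul_comm, z_mul_z, smul_zero,
          add_zero]
      · rintro ⟨c, rfl⟩
        refine ⟨c • ⟨e k i, by simp [GrProj.ideal]⟩, Subtype.ext ?_⟩
        change z k i * (c • e k i) = c • z k i
        rw [mul_smul_comm, z_mul_e]
    rw [this, finrank_span_singleton]
    exact fun h => z_ne_zero i (congrArg Subtype.val h)
  · have : socle k (GrProj.ideal k j) i = ⊥ := by
      rw [eq_bot_iff]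
      rintro _ ⟨w, rfl⟩
      refine Subtype.ext ?_
      change z k i * w.1 = 0
      have h2 : w.1 * e k j = w.1 := w.2
      rw [← h2, ← mul_assoc, z_mul_mul_e h]
    rw [this, finrank_bot]

theorem GrProj.subsingleton_of_isZero {M : GrProj k n} (h : IsZero M) (x : M) : x = 0 :=
  LinearMap.congr_fun (congrArg GrProj.lin (h.eq_of_src (𝟙 M) 0)) x

variable (M : GrProj k n)

/-- The inclusion of a module in the total module of the complex concentrated in degree zero. -/
def totSingle : M →ₗ[Zigzag k n] Tot ((CochainComplex.singleFunctor (GrProj k n) 0).obj M) :=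
  DirectSum.lof (Zigzag k n) ℤ
    (fun q => (((CochainComplex.singleFunctor (GrProj k n) 0).obj M).X q).carrier) 0 ∘ₗ
    GrProj.lin (HomologicalComplex.singleObjXSelf (ComplexShape.up ℤ) 0 M).inv

theorem totSingle_bijective : Function.Bijective (totSingle M) := by
  have hl : ∀ x, GrProj.lin (HomologicalComplex.singleObjXSelf (ComplexShape.up ℤ) 0 M).hom
      (GrProj.lin (HomologicalComplex.singleObjXSelf (ComplexShape.up ℤ) 0 M).inv x) = x := fun x =>
    LinearMap.congr_fun (congrArg GrProj.lin
      (HomologicalComplex.singleObjXSelf (ComplexShape.up ℤ) 0 M).inv_hom_id) x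
  have hr : ∀ x, GrProj.lin (HomologicalComplex.singleObjXSelf (ComplexShape.up ℤ) 0 M).inv
      (GrProj.lin (HomologicalComplex.singleObjXSelf (ComplexShape.up ℤ) 0 M).hom x) = x := fun x =>
    LinearMap.congr_fun (congrArg GrProj.lin
      (HomologicalComplex.singleObjXSelf (ComplexShape.up ℤ) 0 M).hom_inv_id) x
  constructor
  · intro x y h
    have h' := DirectSum.of_injective (β := fun q =>
      (((CochainComplex.singleFunctor (GrProj k n) 0).obj M).X q).carrier) 0 h
    exact (hl x).symm.trans ((congrArg _ h').trans (hl y))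
  · intro x
    refine ⟨GrProj.lin (HomologicalComplex.singleObjXSelf (ComplexShape.up ℤ) 0 M).hom (x 0), ?_⟩
    refine DFinsupp.ext fun p => ?_
    by_cases hp : p = 0
    · subst hp
      refine (DirectSum.of_eq_same 0 _).trans (hr _)
    · exact ((GrProj.subsingleton_of_isZero
        (HomologicalComplex.isZero_single_obj_X _ _ _ _ hp) _)).trans
        (GrProj.subsingleton_of_isZero
        (HomologicalComplex.isZero_single_obj_X _ _ _ _ hp) _).symm

theorem totD_single (x : Tot ((CochainComplex.singleFunctor (GrProj k n) 0).obj M)) :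
    totD _ x = 0 := by
  refine tot_ext (ψ := 0) (fun p x => ?_) x
  rw [totD_lof, LinearMap.zero_apply]
  have : ((CochainComplex.singleFunctor (GrProj k n) 0).obj M).d p (p + 1) = 0 :=
    HomologicalComplex.single_obj_d _ _ _ _ _
  rw [this]
  exact map_zero _

theorem multD_projD (i j : Fin n) : multD (projD k j) i = if i = j then 1 else 0 := by
  refine (mult_eq_finrank_socle (totD_single (GrProj.P k j)) i).trans ?_
  rw [finrank_socle_eq (totSingle (GrProj.P k j)) (totSingle_bijective _) i]
  have := finrank_socle_ideal (k := k) i j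
  split_ifs at this ⊢ with h
  · exact congrArg Nat.cast this
  · exact congrArg Nat.cast this

end Projective

/-! ### Growth of multiplicities under reduced words -/

section PingPong

variable {k : Type u} [Field k] {n : ℕ}

theorem wordFunctor_cons (a : Fin n × Bool) (w : List (Fin n × Bool)) :
    wordFunctor k (a :: w) = wordFunctor k w ⋙ letterFunctor k a := by
  obtain ⟨l, _ | _⟩ := a <;> rfl

/-- An object whose multiplicity at the vertex of the letter `a` dominates all other ones. -/
structure Dominated (X : D k n) (a : Fin n × Bool) : Prop where
  lt : ∀ i, i ≠ a.1 → multD X i < multD X a.1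
  rk_lt : rkD X a < multSumD X a.1
  two_le : 2 ≤ multD X a.1

theorem multSumD_letter (X : D k n) (a : Fin n × Bool) :
    multSumD ((letterFunctor k a).obj X) a.1 = multSumD X a.1 :=
  Finset.sum_congr rfl fun _ hj => multD_letter_of_ne X a (Finset.ne_of_mem_erase hj)

theorem multD_le_multSumD (X : D k n) {i l : Fin n} (h : i ≠ l) : multD X i ≤ multSumD X l :=
  Finset.single_le_sum (f := multD X) (fun j _ => multD_nonneg X j)
    (Finset.mem_erase.2 ⟨h, Finset.mem_univ _⟩)

/-- The strict bound on the rank survives the twist, because the other multiplicities are unchanged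
and the rank does not grow. -/
theorem dominated_letter {X : D k n} {a : Fin n × Bool} (h : rkD X a < multSumD X a.1)
    (h' : ∀ i, i ≠ a.1 → multD X i < multD X a.1 + 2 * multSumD X a.1 - 2 * rkD X a)
    (h'' : 2 ≤ multD X a.1 + 2 * multSumD X a.1 - 2 * rkD X a) :
    Dominated ((letterFunctor k a).obj X) a where
  lt i hi := by
    rw [multD_letter_self, multD_letter_of_ne X a hi]
    exact h' i hi
  rk_lt := by
    rw [multSumD_letter]
    exact (rkD_letter_le X a).trans_lt h
  two_le := by rwa [multD_letter_self]

/-- Repeating a letter adds 2(∑ − r) > 0 to the dominating multiplicity. -/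
theorem Dominated.letter_self {X : D k n} {a : Fin n × Bool} (h : Dominated X a) :
    Dominated ((letterFunctor k a).obj X) a :=
  dominated_letter h.rk_lt (fun i hi => by linarith [h.lt i hi, h.rk_lt])
    (by linarith [h.two_le, h.rk_lt])

/-- For a letter at b ≠ a one has r ≤ m_b < m_a ≤ ∑. The new value m_b + 2∑ − 2r exceeds ∑, which
bounds every other multiplicity. -/
theorem Dominated.letter_of_ne {X : D k n} {a b : Fin n × Bool} (h : Dominated X a)
    (hab : b.1 ≠ a.1) : Dominated ((letterFunctor k b).obj X) b := by
  have h1 := h.lt b.1 hab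
  have h2 := multD_le_multSumD X hab.symm
  have h3 := rkD_le X b
  refine dominated_letter (by linarith) (fun i hi => ?_) (by linarith [h.two_le])
  linarith [multD_le_multSumD X hi]

theorem multSumD_of_eq {X : D k n} {j : Fin n} (h : ∀ i, multD X i = if i = j then 1 else 0)
    (l : Fin n) : multSumD X l = if l = j then 0 else 1 := by
  rw [multSumD, Finset.sum_congr rfl fun i _ => h i, Finset.sum_ite_eq']
  by_cases hl : l = j
  · simp [hl]
  · simp [hl, Ne.symm hl]

/-- The multiplicities of `Ψ_w(P_j)` for a reduced word `w`. -/
theorem multD_word (j : Fin n) (w : List (Fin n × Bool)) (hw : FreeGroup.IsReduced w) :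
    ((∀ a ∈ w, a.1 = j) ∧
      ∀ i, multD ((wordFunctor k w).obj (projD k j)) i = if i = j then 1 else 0) ∨
    ∃ a ∈ w.head?, Dominated ((wordFunctor k w).obj (projD k j)) a := by
  induction w with
  | nil => exact Or.inl ⟨by simp, fun i => multD_projD i j⟩
  | cons a w ih =>
    have hw' : FreeGroup.IsReduced w := List.IsChain.tail hw
    rw [wordFunctor_cons, Functor.comp_obj]
    set X := (wordFunctor k w).obj (projD k j)
    rcases ih hw' with ⟨h1, h2⟩ | ⟨b, hb, hX⟩
    · have hs := multSumD_of_eq h2 a.1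
      have hr := rkD_le X a
      have hr' := rkD_nonneg X a
      rw [h2] at hr
      -- At j itself the other multiplicities vanish and the new one is 1 − 2r. Nonnegativity forces
      -- r = 0, so nothing changes. At any other vertex r = 0 and the new multiplicity is 2.
      by_cases ha : a.1 = j
      · left
        refine ⟨List.forall_mem_cons.2 ⟨ha, h1⟩, fun i => ?_⟩
        have hm := multD_letter_self X a
        have hm' := multD_nonneg ((letterFunctor k a).obj X) a.1
        rw [h2, hs, if_pos ha, if_pos ha] at hm
        by_cases hi : i = a.1
        · rw [hi, if_pos ha]
          omega
        · rw [multD_letter_of_ne X a hi, h2]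
      · right
        rw [if_neg ha] at hr hs
        refine ⟨a, rfl, dominated_letter (by omega) (fun i _ => ?_) ?_⟩
        · rw [h2, h2, if_neg ha]
          split_ifs <;> omega
        · rw [h2, if_neg ha]
          omega
    · right
      refine ⟨a, rfl, ?_⟩
      by_cases hab : a.1 = b.1
      · obtain ⟨w', rfl⟩ : ∃ w', w = b :: w' := by
          cases w with
          | nil => simp at hb
          | cons c w' => exact ⟨w', by simpa using hb⟩
        -- In a reduced word two adjacent letters at the same vertex have the same sign, so
        -- domination is never undone by an inverse letter.
        have := (FreeGroup.isReduced_cons_cons.1 hw).1 hab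
        obtain rfl : a = b := Prod.ext hab this
        exact hX.letter_self
      · exact hX.letter_of_ne hab

theorem mem_zpowers_of_word {j : Fin n} (w : List (Fin n × Bool)) (h : ∀ a ∈ w, a.1 = j) :
    FreeGroup.mk w ∈ Subgroup.zpowers (FreeGroup.of j) := by
  induction w with
  | nil => exact one_mem _
  | cons a w ih =>
    have : FreeGroup.mk (a :: w) = FreeGroup.mk [a] * FreeGroup.mk w := rfl
    rw [this]
    refine mul_mem ?_ (ih fun b hb => h b (List.mem_cons_of_mem _ hb))
    obtain ⟨l, _ | _⟩ := a
    · obtain rfl : l = j := h _ List.mem_cons_self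
      exact inv_mem (Subgroup.mem_zpowers (FreeGroup.of l))
    · obtain rfl : l = j := h _ List.mem_cons_self
      exact Subgroup.mem_zpowers (FreeGroup.of l)

/-- The reflection attached to a spherical object in the orbit of `P_j` is well defined. -/
theorem conj_eq_of_iso (g : FreeGroup (Fin n)) (j l : Fin n)
    (e : (Psi k g).obj (projD k j) ≅ projD k l) :
    g * FreeGroup.of j * g⁻¹ = FreeGroup.of l := by
  have hm : ∀ i, multD ((Psi k g).obj (projD k j)) i = if i = l then 1 else 0 := fun i =>
    (multD_eq_of_iso e i).trans (multD_projD i l)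
  rcases multD_word (k := k) j g.toWord FreeGroup.isReduced_toWord with ⟨h1, h2⟩ | ⟨a, -, ha⟩
  · have hj := hm j
    rw [show multD ((Psi k g).obj (projD k j)) j = _ from h2 j, if_pos rfl] at hj
    -- All letters of g lie at j, so g is a power of σ_j and centralises it. Comparing
    -- multiplicities at j identifies the vertex.
    have hjl : j = l := by
      by_contra h
      simp [h] at hj
    obtain ⟨m, hm⟩ := mem_zpowers_of_word _ h1
    rw [FreeGroup.mk_toWord] at hm
    rw [← hjl, ← hm]
    group
  · have := ha.two_le
    rw [show multD ((wordFunctor k g.toWord).obj (projD k j)) a.1 = _ from hm a.1] at this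
    split_ifs at this <;> omega

end PingPong

/-! ### Hurwitz moves on tuples in an augmented set -/

section Augmented

variable {G X : Type*} [Group G] [MulAction G X] {n : ℕ} (t : X → G)

/-- `τᵢ (x₁, …, xₙ) = (x₁, …, t(xᵢ) xᵢ₊₁, xᵢ, …, xₙ)`. -/
def augMove (i : Fin (n - 1)) (x : Fin n → X) : Fin n → X := fun j =>
  if j = lo i then t (x (lo i)) • x (hi i) else if j = hi i then x (lo i) else x j

/-- The inverse of `augMove`. -/
def augMoveInv (i : Fin (n - 1)) (x : Fin n → X) : Fin n → X := fun j =>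
  if j = lo i then x (hi i) else if j = hi i then (t (x (hi i)))⁻¹ • x (lo i) else x j

/-- `augMove` as a permutation of the set of tuples. -/
def augPerm (i : Fin (n - 1)) : Equiv.Perm (Fin n → X) where
  toFun := augMove t i
  invFun := augMoveInv t i
  left_inv x := by
    funext j
    have := hi_ne_lo i
    by_cases h1 : j = lo i
    · subst h1; simp [augMove, augMoveInv, this]
    · by_cases h2 : j = hi i
      · subst h2; simp [augMove, augMoveInv, this]
      · simp [augMove, augMoveInv, h1, h2]
  right_inv x := by
    funext j
    have := hi_ne_lo i
    by_cases h1 : j = lo i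
    · subst h1; simp [augMove, augMoveInv, this]
    · by_cases h2 : j = hi i
      · subst h2; simp [augMove, augMoveInv, this]
      · simp [augMove, augMoveInv, h1, h2]

variable {t}

/-- The only nontrivial comparison is at the first entry of the braid relation: t(t(x)y)t(x) =
t(x)t(y), which is the equivariance of t. -/
theorem augPerm_rels (ht : ∀ (g : G) (x : X), t (g • x) = g * t x * g⁻¹)
    (w : FreeGroup (Fin (n - 1))) (hw : w ∈ braidRels n) :
    FreeGroup.lift (fun i => augPerm (n := n) t i) w = 1 := by
  rcases hw with ⟨i, j, hij, rfl⟩ | ⟨i, j, hij, rfl⟩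
  · rw [map_mul, map_inv, mul_inv_eq_one]
    simp only [map_mul, FreeGroup.lift_apply_of]
    refine Equiv.ext fun x => funext fun l => ?_
    have h1 : lo j = hi i := by simp [lo, hi, hij]
    have h2 : hi j ≠ hi i := by simp [hi, Fin.ext_iff, hij]
    have h3 : hi j ≠ lo i := by simp [lo, hi, Fin.ext_iff, hij]; omega
    have h4 := hi_ne_lo i
    change augMove t i (augMove t j (augMove t i x)) l =
      augMove t j (augMove t i (augMove t j x)) l
    by_cases e1 : l = lo i
    · subst e1
      simp [augMove, h1, h2, h3, h3.symm, h4, h4.symm, ht, smul_smul]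
    · by_cases e2 : l = hi i
      · subst e2
        simp [augMove, h1, h2, h3, h3.symm, h4, h4.symm]
      · by_cases e3 : l = hi j
        · subst e3
          simp [augMove, h1, h2, h3, h3.symm, h4, h4.symm]
        · simp [augMove, h1, e1, e2, e3]
  · rw [map_mul, map_inv, mul_inv_eq_one]
    simp only [map_mul, FreeGroup.lift_apply_of]
    refine Equiv.ext fun x => funext fun l => ?_
    have h1 : lo j ≠ lo i := by simp [lo, Fin.ext_iff]; omega
    have h2 : lo j ≠ hi i := by simp [lo, hi, Fin.ext_iff]; omega
    have h3 : hi j ≠ lo i := by simp [lo, hi, Fin.ext_iff]; omega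
    have h4 : hi j ≠ hi i := by simp [hi, Fin.ext_iff]; omega
    change augMove t i (augMove t j x) l = augMove t j (augMove t i x) l
    by_cases e1 : l = lo i
    · subst e1; simp [augMove, h1.symm, h2.symm, h3.symm, h4.symm]
    · by_cases e2 : l = hi i
      · subst e2; simp [augMove, h1.symm, h2.symm, h3.symm, h4.symm]
      · by_cases e3 : l = lo j
        · subst e3; simp [augMove, h1, h2, h3, h4]
        · by_cases e4 : l = hi j
          · subst e4; simp [augMove, h1, h2, h3, h4]
          · simp [augMove, e1, e2, e3, e4]

/-- The Hurwitz action of the braid group on tuples in an augmented set. -/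
def augHurwitz (n : ℕ) (ht : ∀ (g : G) (x : X), t (g • x) = g * t x * g⁻¹) :
    BraidGroup n →* Equiv.Perm (Fin n → X) :=
  PresentedGroup.toGroup (f := fun i => augPerm (n := n) t i) (augPerm_rels ht)

theorem augHurwitz_gen (ht : ∀ (g : G) (x : X), t (g • x) = g * t x * g⁻¹)
    (i : Fin (n - 1)) (x : Fin n → X) :
    augHurwitz n ht (braidGen i) x = augMove t i x := by
  simp [augHurwitz, braidGen, augPerm]

theorem comp_augMove (ht : ∀ (g : G) (x : X), t (g • x) = g * t x * g⁻¹)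
    (i : Fin (n - 1)) (x : Fin n → X) :
    t ∘ augMove t i x = hurwitzMove i (t ∘ x) := by
  funext j
  simp only [Function.comp_apply, augMove, hurwitzMove]
  split_ifs
  · exact ht _ _
  · rfl
  · rfl

/-- The invariant t intertwines the actions, so freeness in the group implies freeness on tuples in
X. -/
theorem comp_augHurwitz (ht : ∀ (g : G) (x : X), t (g • x) = g * t x * g⁻¹)
    (β : BraidGroup n) (x : Fin n → X) :
    t ∘ augHurwitz n ht β x = hurwitz G n β (t ∘ x) := by
  have h : β ∈ Subgroup.closure (Set.range (PresentedGroup.of (rels := braidRels n))) := by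
    rw [PresentedGroup.closure_range_of]; trivial
  induction h using Subgroup.closure_induction generalizing x with
  | mem y hy =>
    obtain ⟨i, rfl⟩ := hy
    change t ∘ augHurwitz n ht (braidGen i) x = hurwitz G n (braidGen i) (t ∘ x)
    rw [augHurwitz_gen, hurwitz_gen, comp_augMove ht]
  | one => simp
  | mul y y' _ _ hy hy' =>
    rw [map_mul, Equiv.Perm.mul_apply, map_mul, Equiv.Perm.mul_apply, hy, hy']
  | inv y _ hy =>
    have h := hy (augHurwitz n ht y⁻¹ x)
    rw [← Equiv.Perm.mul_apply, ← map_mul, mul_inv_cancel, map_one, Equiv.Perm.one_apply] at h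
    rw [h, ← Equiv.Perm.mul_apply, ← map_mul, inv_mul_cancel, map_one, Equiv.Perm.one_apply]

end Augmented

/-! ### The free group acts on spherical objects -/

section Spherical

variable {k : Type u} [Field k] {n : ℕ}

/-- The map induced by a functor on isomorphism classes. -/
def isoMap (F : D k n ⥤ D k n) : IsoClass k n → IsoClass k n :=
  Quotient.map F.obj fun _ _ ⟨e⟩ => ⟨F.mapIso e⟩

theorem exists_isoClass_eq (x : IsoClass k n) : ∃ X : D k n, isoClass X = x := Quotient.exists_rep x

theorem isoClass_eq_iff {X Y : D k n} : isoClass X = isoClass Y ↔ Nonempty (X ≅ Y) := Quotient.eq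

variable (k) in
/-- The permutation of the set of isomorphism classes induced by `Σᵢ`. -/
def twistPerm (i : Fin n) : Equiv.Perm (IsoClass k n) where
  toFun := isoMap (twistFunctor k i)
  invFun := isoMap (twistInvFunctor k i)
  left_inv x := by
    obtain ⟨X, rfl⟩ := exists_isoClass_eq x
    exact isoClass_eq_iff.2 (nonempty_twistInv_twist_iso i X)
  right_inv x := by
    obtain ⟨X, rfl⟩ := exists_isoClass_eq x
    exact isoClass_eq_iff.2 (nonempty_twist_twistInv_iso i X)

variable (k n) in
/-- The action of the free group on isomorphism classes of objects of `𝒟`. -/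
def psi : FreeGroup (Fin n) →* Equiv.Perm (IsoClass k n) := FreeGroup.lift (twistPerm k)

theorem psi_of (i : Fin n) (X : D k n) :
    psi k n (FreeGroup.of i) (isoClass X) = isoClass ((twistFunctor k i).obj X) := by
  rw [psi, FreeGroup.lift_apply_of]
  rfl

theorem psi_of_inv (i : Fin n) (X : D k n) :
    psi k n (FreeGroup.of i)⁻¹ (isoClass X) = isoClass ((twistInvFunctor k i).obj X) := by
  rw [psi, map_inv, FreeGroup.lift_apply_of]
  rfl

theorem isoClass_word (w : List (Fin n × Bool)) (X : D k n) :
    isoClass ((wordFunctor k w).obj X) = psi k n (FreeGroup.mk w) (isoClass X) := by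
  induction w with
  | nil =>
    have : FreeGroup.mk ([] : List (Fin n × Bool)) = 1 := rfl
    rw [this, map_one]
    rfl
  | cons a w ih =>
    have : FreeGroup.mk (a :: w) = FreeGroup.mk [a] * FreeGroup.mk w := rfl
    rw [this, map_mul, Equiv.Perm.mul_apply, ← ih]
    obtain ⟨l, _ | _⟩ := a
    · exact (psi_of_inv l _).symm
    · exact (psi_of l _).symm

theorem isoClass_Psi (g : FreeGroup (Fin n)) (X : D k n) :
    isoClass ((Psi k g).obj X) = psi k n g (isoClass X) := by
  rw [Psi, isoClass_word, FreeGroup.mk_toWord]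

/-- On isomorphism classes Φ_E is the action of the reflection of E, so independence of the
presentation becomes a statement about `sphericalReflection`. -/
theorem isoClass_sphericalTwist (g : FreeGroup (Fin n)) (j : Fin n) (Y : D k n) :
    isoClass ((sphericalTwist k g j).obj Y) =
      psi k n (g * FreeGroup.of j * g⁻¹) (isoClass Y) := by
  rw [map_mul, map_mul, Equiv.Perm.mul_apply, Equiv.Perm.mul_apply, ← isoClass_Psi, psi_of,
    ← isoClass_Psi]
  rfl

/-- The action of the free group on spherical objects. -/
instance : MulAction (FreeGroup (Fin n)) (Spherical k n) where
  smul g E := ⟨psi k n g E.1, by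
    obtain ⟨h, j, hE⟩ := E.2
    exact ⟨g * h, j, by rw [hE, isoClass_Psi, isoClass_Psi, map_mul, Equiv.Perm.mul_apply]⟩⟩
  one_smul E := Subtype.ext (by
    change psi k n 1 E.1 = E.1
    rw [map_one, Equiv.Perm.one_apply])
  mul_smul g h E := Subtype.ext (by
    change psi k n (g * h) E.1 = psi k n g (psi k n h E.1)
    rw [map_mul, Equiv.Perm.mul_apply])

theorem smul_coe (g : FreeGroup (Fin n)) (E : Spherical k n) : (g • E).1 = psi k n g E.1 := rfl

theorem exists_presentation (E : Spherical k n) :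
    ∃ p : FreeGroup (Fin n) × Fin n, E.1 = psi k n p.1 (isoClass (projD k p.2)) := by
  obtain ⟨g, j, h⟩ := E.2
  exact ⟨(g, j), by rw [h, isoClass_Psi]⟩

/-- The reflection `g σ_j g⁻¹` attached to the spherical object `Ψ_g(P_j)`. -/
def sphericalReflection (E : Spherical k n) : FreeGroup (Fin n) :=
  (exists_presentation E).choose.1 * FreeGroup.of (exists_presentation E).choose.2 *
    (exists_presentation E).choose.1⁻¹

/-- Two presentations Ψ_g(P_j) and Ψ_h(P_l) of one object give Ψ_{g⁻¹h}(P_l) ≅ P_j, and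
`conj_eq_of_iso` applies. -/
theorem sphericalReflection_eq {E : Spherical k n} {g : FreeGroup (Fin n)} {j : Fin n}
    (h : E.1 = psi k n g (isoClass (projD k j))) :
    sphericalReflection E = g * FreeGroup.of j * g⁻¹ := by
  have h' := (exists_presentation E).choose_spec
  rw [sphericalReflection]
  set p := (exists_presentation E).choose
  rw [h'] at h
  have h2 : isoClass ((Psi k (g⁻¹ * p.1)).obj (projD k p.2)) = isoClass (projD k j) := by
    rw [isoClass_Psi, map_mul, Equiv.Perm.mul_apply, h, ← Equiv.Perm.mul_apply, ← map_mul,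
      inv_mul_cancel, map_one, Equiv.Perm.one_apply]
  obtain ⟨e⟩ := isoClass_eq_iff.1 h2
  rw [← conj_eq_of_iso _ _ _ e]
  group

theorem sphericalReflection_smul (g : FreeGroup (Fin n)) (E : Spherical k n) :
    sphericalReflection (g • E) = g * sphericalReflection E * g⁻¹ := by
  obtain ⟨⟨h, j⟩, hE⟩ := exists_presentation E
  have : (g • E).1 = psi k n (g * h) (isoClass (projD k j)) := by
    rw [smul_coe, hE, map_mul, Equiv.Perm.mul_apply]
  rw [sphericalReflection_eq this, sphericalReflection_eq hE]
  group

theorem sphericalReflection_stdCollection :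
    sphericalReflection ∘ stdCollection k n = fun i => FreeGroup.of i := by
  funext i
  have : (stdCollection k n i).1 = psi k n 1 (isoClass (projD k i)) := by
    rw [map_one]
    rfl
  rw [Function.comp_apply, sphericalReflection_eq this]
  simp

/-! ### The Hurwitz action on spherical collections -/

variable (k n) in
/-- The Hurwitz action of the braid group on ordered spherical collections. -/
def collectionAct : BraidGroup n →* Equiv.Perm (SphericalCollection k n) :=
  augHurwitz n (t := sphericalReflection) sphericalReflection_smul

theorem isHurwitzAction_collectionAct : IsHurwitzAction (collectionAct k n) := by
  intro i E
  rw [collectionAct, augHurwitz_gen]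
  refine ⟨fun g j Y hg hY => ?_, ?_, fun l h1 h2 => ?_⟩
  · rw [isoClass_Psi] at hg
    rw [isoClass_sphericalTwist, ← sphericalReflection_eq hg, ← hY]
    simp only [augMove, if_pos]
    rfl
  · simp [augMove, hi_ne_lo]
  · simp [augMove, h1, h2]

/-- The generators are determined because every spherical object has a presentation. -/
theorem IsHurwitzAction.eq_collectionAct {act : BraidGroup n →* Equiv.Perm (SphericalCollection k n)}
    (h : IsHurwitzAction act) : act = collectionAct k n := by
  refine PresentedGroup.ext fun i => Equiv.ext fun E => funext fun l => ?_
  change act (braidGen i) E l = collectionAct k n (braidGen i) E l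
  obtain ⟨h1, h2, h3⟩ := h i E
  obtain ⟨h1', h2', h3'⟩ := isHurwitzAction_collectionAct i E
  by_cases hl : l = lo i
  · subst hl
    obtain ⟨g, j, hg⟩ := (E (lo i)).2
    obtain ⟨Y, hY⟩ := exists_isoClass_eq (E (hi i)).1
    exact Subtype.ext ((h1 g j Y hg hY.symm).trans (h1' g j Y hg hY.symm).symm)
  · by_cases hl' : l = hi i
    · subst hl'
      rw [h2, h2']
    · rw [h3 l hl hl', h3' l hl hl']

theorem sphericalReflection_collectionAct (β : BraidGroup n) :
    sphericalReflection ∘ collectionAct k n β (stdCollection k n) = (redAct β (stdRed n)).1 := by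
  rw [collectionAct, comp_augHurwitz, sphericalReflection_stdCollection]
  rfl

theorem redAct_stdRed_injective {β β' : BraidGroup n}
    (h : redAct β (stdRed n) = redAct β' (stdRed n)) : β = β' := by
  have h' : redAct (β'⁻¹ * β) (stdRed n) = stdRed n := by
    rw [redAct_mul, h, ← redAct_mul, inv_mul_cancel]
    exact Subtype.ext (by simp [redAct])
  exact (inv_mul_eq_one.1 (hurwitz_faithful n _ (congrArg Subtype.val h'))).symm

/-- If β fixes β₀(P_1, …, P_n), then taking reflections shows that ββ₀ and β₀ agree on (σ_1, …,
σ_n), hence are equal. -/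
theorem collectionAct_free {E : SphericalCollection k n} (hE : E ∈ orbit (collectionAct k n))
    {β : BraidGroup n} (h : collectionAct k n β E = E) : β = 1 := by
  obtain ⟨β₀, rfl⟩ := hE
  have h' : collectionAct k n (β * β₀) (stdCollection k n) =
      collectionAct k n β₀ (stdCollection k n) := by
    rw [map_mul, Equiv.Perm.mul_apply]
    exact h
  have := redAct_stdRed_injective (Subtype.ext
    ((sphericalReflection_collectionAct (k := k) (β * β₀)).symm.trans
    ((congrArg (sphericalReflection ∘ ·) h').trans (sphericalReflection_collectionAct β₀))))
  exact mul_eq_right.1 this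

variable (k n) in
/-- The equivariant map from minimal reflection expressions to spherical collections. -/
def redToOrbit (r : Red n) : orbit (collectionAct k n) :=
  ⟨collectionAct k n (exists_redAct_eq r).choose (stdCollection k n), _, rfl⟩

theorem redToOrbit_redAct (β : BraidGroup n) :
    (redToOrbit k n (redAct β (stdRed n))).1 = collectionAct k n β (stdCollection k n) :=
   congrArg (fun β => collectionAct k n β (stdCollection k n))
    (redAct_stdRed_injective (exists_redAct_eq (redAct β (stdRed n))).choose_spec)

theorem redAct_one (r : Red n) : redAct 1 r = r := Subtype.ext (by simp [redAct])

theorem isEquivariantExtension_redToOrbit :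
    IsEquivariantExtension (collectionAct k n) (redToOrbit k n) := by
  constructor
  · have := redToOrbit_redAct (k := k) (n := n) 1
    rwa [redAct_one, map_one, Equiv.Perm.one_apply] at this
  · intro β r
    obtain ⟨β', rfl⟩ := exists_redAct_eq r
    rw [← redAct_mul, redToOrbit_redAct, redToOrbit_redAct, map_mul, Equiv.Perm.mul_apply]

theorem IsEquivariantExtension.apply_redAct {F : Red n → orbit (collectionAct k n)}
    (hF : IsEquivariantExtension (collectionAct k n) F) (β : BraidGroup n) :
    (F (redAct β (stdRed n))).1 = collectionAct k n β (stdCollection k n) := by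
  rw [hF.2, hF.1]

theorem IsEquivariantExtension.eq_redToOrbit {F : Red n → orbit (collectionAct k n)}
    (hF : IsEquivariantExtension (collectionAct k n) F) : F = redToOrbit k n := by
  funext r
  obtain ⟨β, rfl⟩ := exists_redAct_eq r
  exact Subtype.ext ((hF.apply_redAct β).trans (redToOrbit_redAct β).symm)

/-- Taking reflections entrywise recovers r from its image; surjectivity is the definition of the
orbit. -/
theorem IsEquivariantExtension.bijective {F : Red n → orbit (collectionAct k n)}
    (hF : IsEquivariantExtension (collectionAct k n) F) : Function.Bijective F := by
  constructor
  · intro r r' h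
    obtain ⟨β, rfl⟩ := exists_redAct_eq r
    obtain ⟨β', rfl⟩ := exists_redAct_eq r'
    have h' := congrArg (fun E : orbit (collectionAct k n) => sphericalReflection ∘ E.1) h
    simp only [hF.apply_redAct, sphericalReflection_collectionAct] at h'
    exact Subtype.ext h'
  · rintro ⟨_, β, rfl⟩
    exact ⟨redAct β (stdRed n), Subtype.ext (hF.apply_redAct β)⟩

end Spherical

end ZigzagFree

end

open ZigzagFree in
theorem mainTheorem7 (k : Type*) [Field k] [CharZero k] (n : ℕ) :
    (∃! act : BraidGroup n →* Equiv.Perm (SphericalCollection k n), IsHurwitzAction act) ∧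
    ∀ act : BraidGroup n →* Equiv.Perm (SphericalCollection k n), IsHurwitzAction act →
      (∀ E ∈ orbit act, ∀ β : BraidGroup n, act β E = E → β = 1) ∧
      (∃! F : Red n → orbit act, IsEquivariantExtension act F) ∧
      (∀ F : Red n → orbit act, IsEquivariantExtension act F → Function.Bijective F) := by
  refine ⟨⟨collectionAct k n, isHurwitzAction_collectionAct,
    fun act h => IsHurwitzAction.eq_collectionAct h⟩, fun act h => ?_⟩
  obtain rfl := IsHurwitzAction.eq_collectionAct h
  exact ⟨fun E hE β hβ => collectionAct_free hE hβ,
    ⟨redToOrbit k n, isEquivariantExtension_redToOrbit,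
      fun F hF => IsEquivariantExtension.eq_redToOrbit hF⟩,
    fun F hF => IsEquivariantExtension.bijective hF⟩
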